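/- **Setting.** Let $n\ge 1$, $q\ge 0$, and let $\phi_i:\mathbb{R}^i\to\mathbb{R}^q$ ($1\le i\le n$) be smooth with $\phi_i(0)=0$. Consider the system $$\dot x_i=\phi_i(\underline x_i)^\top\theta(t)+x_{i+1}\ (1\le i<n),\qquad \dot x_n=\phi_n(\underline x_n)^\top\theta(t)+b(t)u,\qquad \underline x_i=(x_1,\dots,x_i),$$ where $\theta:[0,\infty)\to\mathbb{R}^q$ and $b:[0,\infty)\to\mathbb{R}$ are unknown and piecewise continuous. Assume: (1) $\theta(t)\in\Theta_0$ for all $t\ge0$, where $\Theta_0$ is an unknown compact set contained in a closed Euclidean ball of known radius $\delta\ge 0$ and unknown centre; (2) $\operatorname{sgn} b(t)=\sigma$ for all $t\ge0$ with a known constant $\sigma\in\{1,-1\}$, and there is an unknown constant $\ell_b$ with $0<|\ell_b|\le|b(t)|$ for all $t\ge 0$. **Controller.** Fix constants $k_1,\dots,k_n,\lambda,\epsilon,\gamma_\rho>0$ and a symmetric positive definite matrix $\Gamma\in\mathbb{R}^{q\times q}$; let $\mu=e^{\lambda t}$, $\alpha_0=0$, $z_0=0$. Recursively for $i=1,\dots,n$,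 as functions of $(x,\hat\theta,\mu)$, $$z_i=x_i-\alpha_{i-1},\quad s_i=\mu z_i,\quad w_i=\phi_i-\sum_{j<i}\frac{\partial\alpha_{i-1}}{\partial x_j}\phi_j=W_i^\top\underline z_i,\quad \tau_i=\sum_{j\le i}\mu w_js_j,$$ $$\zeta_i=\lambda+\tfrac12\Big((n+1-i)\delta+\tfrac1\epsilon+\delta|W_i|_F^2\Big),$$ and for $i<n$ $$\alpha_i=-(k_i+\zeta_i)z_i-z_{i-1}-w_i^\top\hat\theta+\frac{\partial\alpha_{i-1}}{\partial\hat\theta}\Gamma\tau_i+\sum_{j=2}^{i-1}\frac{\partial\alpha_{j-1}}{\partial\hat\theta}\Gamma\mu s_jw_i+\sum_{j=1}^{i-1}\frac{\partial\alpha_{i-1}}{\partial x_j}x_{j+1}+\frac{\partial\alpha_{i-1}}{\partial\mu}\lambda\mu .$$ Here $W_i$ (an $i\times q$ matrix) is any solution of $w_i=W_i^\top\underline z_i$ that is a smooth function of $(\underline x_i,\hat\theta,\mu\underline x_i)$. Further let $$\psi=z_{n-1}+w_n^\top\hat\theta-\sum_{i=1}^{n-1}\frac{\partial\alpha_{n-1}}{\partial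 x_i}x_{i+1}-\frac{\partial\alpha_{n-1}}{\partial\hat\theta}\Gamma\tau_n-\frac{\partial\alpha_{n-1}}{\partial\mu}\lambda\mu-\sum_{i=2}^{n-1}\frac{\partial\alpha_{i-1}}{\partial\hat\theta}\Gamma\mu s_iw_n=\bar\psi^\top\underline z_n,$$ where $\bar\psi$ is any solution of the last equation that is a smooth function of $(x,\hat\theta,\mu x)$, and $$\kappa=k_n+\lambda+\tfrac12\Big(\delta(|W_n|_F^2+1)+\tfrac1\epsilon+\epsilon|\bar\psi|^2\Big),\quad \bar u=-\kappa z_n,\quad u=\hat\rho\bar u,\quad \dot{\hat\rho}=-\gamma_\rho\,\sigma\,\mu s_n\bar u,\quad \dot{\hat\theta}=\Gamma\tau_n .$$ **Theorem 1.** Such functions $W_i,\alpha_i,\bar\psi$ exist. For every choice of them and all $\theta,b$ as above there is a continuous function $N:\mathbb{R}^n\times\mathbb{R}^q\times\mathbb{R}\to(0,\infty)$ such that for all initial values $x(0)$, $\hat\theta(0)$ and all $\hat\rho(0)$ with $\sigma\hat\rho(0)>0$ the following holds. The closed loop has a solution on $[0,\infty)$, and every solution with these initial values on an interval $[0,T)$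 coincides with it there. It satisfies $$\|x(t)\|\le N(x(0),\hat\theta(0),\hat\rho(0))\,e^{-\lambda t}\qquad(t\ge0),$$ the signals $x,\hat\theta,\hat\rho,z_i,s_i,\alpha_i,w_i,\tau_i,\kappa,\bar u,u,\dot{\hat\theta},\dot{\hat\rho}$ are bounded on $[0,\infty)$, and $\lim_{t\to\infty}\hat\theta(t)$ and $\lim_{t\to\infty}\hat\rho(t)$ exist. (A solution is continuous, satisfies the adaptive laws everywhere and the system equations at all times $t>0$ at which $\theta$ and $b$ are continuous.) -/

import Mathlib

open scoped ContDiff Matrix Topology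

/-- A function of time is piecewise continuous on `[0, ∞)`: on every bounded interval `[0, T]`
it has finitely many discontinuities, and all one-sided limits exist (and are finite). -/
def PiecewiseContinuous {E : Type*} [TopologicalSpace E] (f : ℝ → E) : Prop :=
  (∀ T : ℝ, {t ∈ Set.Icc 0 T | ¬ ContinuousWithinAt f (Set.Ici 0) t}.Finite) ∧
  (∀ t : ℝ, 0 ≤ t → ∃ l : E, Filter.Tendsto f (𝓝[>] t) (𝓝 l)) ∧
  (∀ t : ℝ, 0 < t → ∃ l : E, Filter.Tendsto f (𝓝[<] t) (𝓝 l))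

/-- A signal is bounded on `[0, ∞)`. -/
def BoundedSignal {E : Type*} [Norm E] (f : ℝ → E) : Prop :=
  ∃ C : ℝ, ∀ t : ℝ, 0 ≤ t → ‖f t‖ ≤ C

namespace Backstepping

/-- States of a system of order `n = m + 1`. The coordinates `x₁, …, xₙ` are `x 0, …, x m`. -/
abbrev State (m : ℕ) : Type := Fin (m + 1) → ℝ

/-- Parameter vectors in `ℝ^q`. -/
abbrev Par (q : ℕ) : Type := Fin q → ℝ

/-- The arguments `(x, θ̂, μ)` of the control laws. -/
abbrev Pt (m q : ℕ) : Type := State m × Par q × ℝ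

variable {m q : ℕ}

/-- `∂f/∂xⱼ` for a function of `(x, θ̂, μ)`. -/
noncomputable def dx (f : Pt m q → ℝ) (j : Fin (m + 1)) (p : Pt m q) : ℝ :=
  fderiv ℝ f p (Pi.single j 1, 0, 0)

/-- `(∂f/∂θ̂) v` for a function of `(x, θ̂, μ)`. -/
noncomputable def dtheta (f : Pt m q → ℝ) (p : Pt m q) (v : Par q) : ℝ :=
  fderiv ℝ f p (0, v, 0)

/-- `∂f/∂μ` for a function of `(x, θ̂, μ)`. -/
noncomputable def dmu (f : Pt m q → ℝ) (p : Pt m q) : ℝ :=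
  fderiv ℝ f p (0, 0, 1)

/-- A map of `(x, θ̂, μ)` in which `μ` enters only through the scaled state `μ x`,
and which is a smooth function of `(x, θ̂, μ x)`. -/
def ScaledSmooth {E : Type*} [NormedAddCommGroup E] [NormedSpace ℝ E] (f : Pt m q → E) : Prop :=
  ∃ F : State m × Par q × State m → E, ContDiff ℝ ∞ F ∧
    ∀ (x : State m) (ϑ : Par q) (μ : ℝ), f (x, ϑ, μ) = F (x, ϑ, μ • x)

/-- The constants that the designer chooses (together with the known radius `δ`). -/
structure Params (m q : ℕ) where
  /-- the feedback gains `k₁, …, kₙ` -/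
  k : Fin (m + 1) → ℝ
  /-- the exponential rate `λ` -/
  lam : ℝ
  /-- the radius `δ` of the parameter set -/
  del : ℝ
  /-- the damping constant `ε_ψ` -/
  eps : ℝ
  /-- the adaptation gain `γ_ρ` -/
  gam : ℝ
  /-- the adaptation gain matrix `Γ` -/
  Gam : Matrix (Fin q) (Fin q) ℝ
  k_pos : ∀ i, 0 < k i
  lam_pos : 0 < lam
  del_nonneg : 0 ≤ del
  eps_pos : 0 < eps
  gam_pos : 0 < gam
  Gam_pos : Gam.PosDef

section Signals

variable (P : Params m q) (φ : Fin (m + 1) → State m → Par q)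
  (a : Fin (m + 1) → Pt m q → ℝ)
  (W : Fin (m + 1) → Pt m q → Matrix (Fin (m + 1)) (Fin q) ℝ)
  (ψbar : Pt m q → State m)

/- Throughout, `a i` is the reference signal of the coordinate `x i`: in one-based notation it is
`α_{i-1}` for the `i`-th coordinate, with `α₀ = 0`. -/

/-- `zᵢ = xᵢ - α_{i-1}`. -/
def z (i : Fin (m + 1)) (p : Pt m q) : ℝ := p.1 i - a i p

/-- `z_{i-1}`, which is `0` for the first coordinate. -/
def zPrev (i : Fin (m + 1)) (p : Pt m q) : ℝ :=
  Fin.cases (motive := fun _ => ℝ) 0 (fun j : Fin m => z a j.castSucc p) i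

/-- `sᵢ = μ zᵢ`. -/
def s (i : Fin (m + 1)) (p : Pt m q) : ℝ := p.2.2 * z a i p

/-- `wᵢ = φᵢ - ∑_{j<i} (∂α_{i-1}/∂xⱼ) φⱼ`. -/
noncomputable def w (i : Fin (m + 1)) (p : Pt m q) : Par q :=
  φ i p.1 - ∑ j ∈ Finset.Iio i, dx (a i) j p • φ j p.1

/-- The tuning function `τᵢ = ∑_{j≤i} μ wⱼ sⱼ`. -/
noncomputable def tau (i : Fin (m + 1)) (p : Pt m q) : Par q :=
  ∑ j ∈ Finset.Iic i, (p.2.2 * s a j p) • w φ a j p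

/-- `|Wᵢ|_F²` (the matrix `Wᵢ` has the rows `j ≤ i`). -/
def frobSq (i : Fin (m + 1)) (p : Pt m q) : ℝ :=
  ∑ j ∈ Finset.Iic i, ∑ c : Fin q, (W i p j c) ^ 2

/-- `ζᵢ = λ + ½((n+1-i)δ + 1/ε + δ|Wᵢ|_F²)`; here `n = m + 1` and `i` counts from zero. -/
noncomputable def zeta (i : Fin (m + 1)) (p : Pt m q) : ℝ :=
  P.lam + (1 / 2) *
    (((m : ℝ) + 1 - ((i : ℕ) : ℝ)) * P.del + 1 / P.eps + P.del * frobSq W i p)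

/-- `∑_{j<i} (∂α_{i-1}/∂xⱼ) x_{j+1}`. -/
noncomputable def chainTerm (i : Fin (m + 1)) (p : Pt m q) : ℝ :=
  ∑ j : Fin m, if j.castSucc < i then dx (a i) j.castSucc p * p.1 j.succ else 0

/-- `∑_{2≤j<i} (∂α_{j-1}/∂θ̂) Γ μ sⱼ wᵢ` (the term of the first coordinate vanishes, as
`α₀ = 0`). -/
noncomputable def crossTerm (i : Fin (m + 1)) (p : Pt m q) : ℝ :=
  ∑ j ∈ Finset.Iio i, dtheta (a j) p (P.Gam *ᵥ ((p.2.2 * s a j p) • w φ a i p))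

/-- The right-hand side of the definition of the virtual control `αᵢ`. -/
noncomputable def virtualControl (i : Fin (m + 1)) (p : Pt m q) : ℝ :=
  -(P.k i + zeta P W i p) * z a i p - zPrev a i p - w φ a i p ⬝ᵥ p.2.1
    + dtheta (a i) p (P.Gam *ᵥ tau φ a i p) + crossTerm P φ a i p
    + chainTerm a i p + dmu (a i) p * (P.lam * p.2.2)

/-- `ψ = z_{n-1} + wₙᵀθ̂ - ∑_{i<n} (∂α_{n-1}/∂xᵢ) x_{i+1} - (∂α_{n-1}/∂θ̂) Γ τₙ
  - (∂α_{n-1}/∂μ) λ μ - ∑_{2≤i<n} (∂α_{i-1}/∂θ̂) Γ μ sᵢ wₙ`. -/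
noncomputable def psi (p : Pt m q) : ℝ :=
  zPrev a (Fin.last m) p + w φ a (Fin.last m) p ⬝ᵥ p.2.1 - chainTerm a (Fin.last m) p
    - dtheta (a (Fin.last m)) p (P.Gam *ᵥ tau φ a (Fin.last m) p)
    - dmu (a (Fin.last m)) p * (P.lam * p.2.2) - crossTerm P φ a (Fin.last m) p

/-- `κ = kₙ + λ + ½(δ(|Wₙ|_F² + 1) + 1/ε + ε|ψ̄|²)`. -/
noncomputable def kappa (p : Pt m q) : ℝ :=
  P.k (Fin.last m) + P.lam + (1 / 2) *
    (P.del * (frobSq W (Fin.last m) p + 1) + 1 / P.eps + P.eps * ∑ j, (ψbar p j) ^ 2)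

/-- `ū = -κ zₙ`. -/
noncomputable def ubar (p : Pt m q) : ℝ :=
  -kappa P W ψbar p * z a (Fin.last m) p

end Signals

/-- A backstepping design for the regressors `φ`: a choice of regression matrices `Wᵢ` with
`wᵢ = Wᵢᵀ (z₁, …, zᵢ)`, the virtual controls that they determine recursively, and a choice of a
map `ψ̄` with `ψ = ψ̄ᵀ z`. -/
structure Design (P : Params m q) (φ : Fin (m + 1) → State m → Par q) where
  /-- the reference signals: `a 0 = 0` and `a i = α_i` (zero-based `i`, one-based `α`) -/
  a : Fin (m + 1) → Pt m q → ℝ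
  /-- the regression matrices (only the rows `j ≤ i` of `W i` are used) -/
  W : Fin (m + 1) → Pt m q → Matrix (Fin (m + 1)) (Fin q) ℝ
  /-- the factor of `ψ` -/
  ψbar : Pt m q → State m
  a_zero : a 0 = 0
  a_succ : ∀ (i : Fin m) (p : Pt m q), a i.succ p = virtualControl P φ a W i.castSucc p
  W_dependsOn : ∀ (i : Fin (m + 1)) (ϑ : Par q) (μ : ℝ),
    DependsOn (fun x : State m => W i (x, ϑ, μ)) (Set.Iic i)
  W_smooth : ∀ (i j : Fin (m + 1)) (c : Fin q), ScaledSmooth (fun p : Pt m q => W i p j c)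
  w_eq : ∀ (i : Fin (m + 1)) (p : Pt m q) (c : Fin q),
    w φ a i p c = ∑ j ∈ Finset.Iic i, W i p j c * z a j p
  ψbar_smooth : ScaledSmooth ψbar
  psi_eq : ∀ p : Pt m q, psi P φ a p = ∑ j, ψbar p j * z a j p

/-- The arguments of the control laws at time `t`: `(x(t), θ̂(t), μ(t))` with `μ(t) = e^{λt}`. -/
noncomputable def pt (P : Params m q) (x : ℝ → State m) (th : ℝ → Par q) (t : ℝ) : Pt m q :=
  (x t, th t, Real.exp (P.lam * t))

/-- The update rate of `θ̂`, namely `Γ τₙ`. -/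
noncomputable def thetaRate (P : Params m q) (φ : Fin (m + 1) → State m → Par q)
    (D : Design P φ) (p : Pt m q) : Par q :=
  P.Gam *ᵥ tau φ D.a (Fin.last m) p

/-- The update rate of `ρ̂`, namely `-γ_ρ σ μ sₙ ū`, where `σ = ±1` is the control direction. -/
noncomputable def rhoRate (P : Params m q) (φ : Fin (m + 1) → State m → Par q)
    (D : Design P φ) (σ : ℝ) (p : Pt m q) : ℝ :=
  -P.gam * σ * p.2.2 * s D.a (Fin.last m) p * ubar P D.a D.W D.ψbar p

/-- `(x, θ̂, ρ̂)` solves the closed loop on the time interval `J` (which is `[0, T)` or `[0, ∞)`):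
the signals are continuous, the adaptive laws hold on `J`, and the system equations with
`u = ρ̂ ū` hold at all times `t > 0` in `J` where the parameters `θ` and `b` are continuous. -/
structure IsSolution (P : Params m q) (φ : Fin (m + 1) → State m → Par q) (D : Design P φ)
    (σ : ℝ) (θ : ℝ → Par q) (b : ℝ → ℝ) (J : Set ℝ)
    (x : ℝ → State m) (th : ℝ → Par q) (rho : ℝ → ℝ) : Prop where
  cont : ContinuousOn x J
  ode : ∀ t ∈ J, 0 < t → ContinuousAt θ t → ContinuousAt b t → ∀ i : Fin m,
    HasDerivAt (fun r => x r i.castSucc) (φ i.castSucc (x t) ⬝ᵥ θ t + x t i.succ) t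
  ode_last : ∀ t ∈ J, 0 < t → ContinuousAt θ t → ContinuousAt b t →
    HasDerivAt (fun r => x r (Fin.last m))
      (φ (Fin.last m) (x t) ⬝ᵥ θ t
        + b t * (rho t * ubar P D.a D.W D.ψbar (pt P x th t))) t
  theta_law : ∀ t ∈ J, HasDerivWithinAt th (thetaRate P φ D (pt P x th t)) J t
  rho_law : ∀ t ∈ J, HasDerivWithinAt rho (rhoRate P φ D σ (pt P x th t)) J t

end Backstepping

/-! Let `s = μ z` be the scaled errors, `ℓ` the centre of the ball around `Θ₀` and `c = |ℓ_b|`. The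
stability claims rest on one Lyapunov function, `V = ½|s|² + ½(θ̂-ℓ)ᵀΓ⁻¹(θ̂-ℓ) + c/(2γ_ρ) (σρ̂ -
1/c)²`, which satisfies `V' ≤ -∑ kᵢ sᵢ²` (`lyapunovRate_le`). In `V'` the couplings of neighbouring
errors cancel by skew-symmetry. The terms caused by adapting `θ̂` cancel in pairs
(`sum_mul_dtheta_add_crossTerm`). The unknown parameter is split as `θ - θ̂ = (θ - ℓ) + (ℓ - θ̂)`:
the second part is cancelled by the adaptive law; the first has length at most `δ` and is absorbed
by the damping in `ζᵢ` and `κ`, because `wᵢ` is linear in `z₁, …, zᵢ`. The remainder `ψ` of the last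
row is absorbed in the same way. Finally `σρ̂` is nondecreasing and hence stays positive, so `|b|`
may be replaced by `c` in the input term, and the third part of `V` removes what depends on `ρ̂`.

Although `μ` is unbounded, bounds on `s` and `θ̂` suffice for all signals. These are smooth
functions of `(x, θ̂, μ x)` (`ScaledSmooth`), so bounds on these three arguments bound them. The
difficulty is that `∂/∂x` produces a factor `μ`. The recursion therefore propagates the stronger
property of being linear in `x` with such coefficients (`ScaledVanishing`): the additional factor
`x` absorbs `μ`. Since `α_{i-1}` involves only `x₁, …, x_{i-1}`, the map from `x` to `z` is
triangular. Its inversion gives the factorizations of `wᵢ` and `ψ` (`exists_design`) and recovers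
bounds on `μ x` from bounds on `s` (`exists_bound_scaled_state`). A bound on `μ x` is the
exponential decay of `x`.

The bound from `V` does not depend on time, so local solutions continue to `[0, ∞)`
(`exists_global_isTrajectory`), with uniqueness by Grönwall's inequality. The rate of `θ̂` is
quadratic in `s` and thus dominated by `-V'`, so a small multiple of a coordinate of `θ̂` plus `V`
is monotone; as `V` converges, so does `θ̂`. The estimate `ρ̂` is monotone and bounded. -/

section

/-! ### Arguments across finitely many exceptional times -/

open Set Filter

/-- A relation between the endpoints of an interval holds if it is transitive and holds on all
intervals without exceptional points in the interior. -/
theorem interval_induction_of_finite {Q : ℝ → ℝ → Prop} {S : Set ℝ} (hS : S.Finite)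
    (trans : ∀ a b c, a ≤ b → b ≤ c → Q a b → Q b c → Q a c)
    (base : ∀ a b, a ≤ b → (∀ t ∈ Ioo a b, t ∉ S) → Q a b) {a b : ℝ} (hab : a ≤ b) : Q a b := by
  -- The endpoints stay quantified, since removing one exceptional point splits the interval in two.
  have key : ∀ F : Finset ℝ, ∀ a b, a ≤ b → (∀ t ∈ Ioo a b, t ∈ S → t ∈ F) → Q a b := by
    intro F
    induction F using Finset.induction_on with
    | empty =>
      intro a b hab h
      exact base a b hab fun t ht hts => by simpa using h t ht hts
    | insert c F _ ih =>
      intro a b hab h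
      by_cases hc : c ∈ Ioo a b
      · refine trans a c b hc.1.le hc.2.le (ih a c hc.1.le fun t ht hts => ?_)
          (ih c b hc.2.le fun t ht hts => ?_)
        · exact Finset.mem_of_mem_insert_of_ne (h t ⟨ht.1, ht.2.trans hc.2⟩ hts) ht.2.ne
        · exact Finset.mem_of_mem_insert_of_ne (h t ⟨hc.1.trans ht.1, ht.2⟩ hts) ht.1.ne'
      · refine ih a b hab fun t ht hts => Finset.mem_of_mem_insert_of_ne (h t ht hts) ?_
        rintro rfl
        exact hc ht
  exact key hS.toFinset a b hab fun t _ hts => by simpa using hts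

theorem antitoneOn_of_hasDerivAt_nonpos_off_finite {g g' : ℝ → ℝ} {a b : ℝ} {S : Set ℝ}
    (hS : S.Finite) (hg : ContinuousOn g (Icc a b))
    (hd : ∀ t ∈ Ioo a b, t ∉ S → HasDerivAt g (g' t) t)
    (hn : ∀ t ∈ Ioo a b, t ∉ S → g' t ≤ 0) : AntitoneOn g (Icc a b) := by
  have key : ∀ c d, c ≤ d → (a ≤ c → d ≤ b → g d ≤ g c) := by
    intro c d hcd
    refine interval_induction_of_finite (Q := fun c d => a ≤ c → d ≤ b → g d ≤ g c) hS ?_ ?_ hcd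
    · intro c d e hcd hde h1 h2 hc he
      exact (h2 (hc.trans hcd) he).trans (h1 hc (hde.trans he))
    · intro c d hcd hno hc hd'
      have hsub : Ioo c d ⊆ Ioo a b := Ioo_subset_Ioo hc hd'
      have : AntitoneOn g (Icc c d) := by
        refine antitoneOn_of_deriv_nonpos (convex_Icc c d) (hg.mono (Icc_subset_Icc hc hd')) ?_ ?_
        · rw [interior_Icc]
          exact fun t ht => (hd t (hsub ht) (hno t ht)).differentiableAt.differentiableWithinAt
        · rw [interior_Icc]
          intro t ht
          rw [(hd t (hsub ht) (hno t ht)).deriv]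
          exact hn t (hsub ht) (hno t ht)
      exact this (left_mem_Icc.2 hcd) (right_mem_Icc.2 hcd) hcd
  exact fun c hc d hd hcd => key c d hcd hc.1 hd.2

/-! ### Trajectories: restriction, gluing and uniqueness -/

section Trajectories

variable {E : Type*} [NormedAddCommGroup E] [NormedSpace ℝ E]

/-- `X` is continuous on `[a, b]` and satisfies `X' = f(t, X)` on `(a, b)` up to finitely many
times. -/
def IsTrajectory (f : ℝ → E → E) (a b : ℝ) (X : ℝ → E) : Prop :=
  ContinuousOn X (Icc a b) ∧
    ∃ S : Set ℝ, S.Finite ∧ ∀ t ∈ Ioo a b, t ∉ S → HasDerivAt X (f t (X t)) t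

theorem IsTrajectory.mono {f : ℝ → E → E} {a b c d : ℝ} {X : ℝ → E} (h : IsTrajectory f a b X)
    (hac : a ≤ c) (hdb : d ≤ b) : IsTrajectory f c d X := by
  obtain ⟨hc, S, hS, hd⟩ := h
  exact ⟨hc.mono (Icc_subset_Icc hac hdb), S, hS, fun t ht => hd t (Ioo_subset_Ioo hac hdb ht)⟩

theorem IsTrajectory.congr {f g : ℝ → E → E} {a b : ℝ} {X Y : ℝ → E} {S : Set ℝ} (hS : S.Finite)
    (hfg : ∀ t ∈ Ioo a b, t ∉ S → f t = g t) (hXY : EqOn X Y (Icc a b))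
    (h : IsTrajectory f a b X) : IsTrajectory g a b Y := by
  obtain ⟨hc, S', hS', hd⟩ := h
  refine ⟨hc.congr hXY.symm, S ∪ S', hS.union hS', fun t ht hts => ?_⟩
  have h1 := hd t ht fun h => hts (Or.inr h)
  rw [hfg t ht fun h => hts (Or.inl h), hXY (Ioo_subset_Icc_self ht)] at h1
  refine h1.congr_of_eventuallyEq ?_
  filter_upwards [Ioo_mem_nhds ht.1 ht.2] with r hr using (hXY (Ioo_subset_Icc_self hr)).symm

theorem IsTrajectory.glue {f : ℝ → E → E} {a b c : ℝ} {X Y : ℝ → E} (hab : a ≤ b) (hbc : b ≤ c)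
    (hX : IsTrajectory f a b X) (hY : IsTrajectory f b c Y) (hXY : X b = Y b) :
    IsTrajectory f a c (fun t => if t ≤ b then X t else Y t) := by
  obtain ⟨hXc, S, hS, hXd⟩ := hX
  obtain ⟨hYc, S', hS', hYd⟩ := hY
  have e1 : EqOn (fun t => if t ≤ b then X t else Y t) X (Icc a b) := fun t ht => by
    simp [ht.2]
  have e2 : EqOn (fun t => if t ≤ b then X t else Y t) Y (Icc b c) := fun t ht => by
    rcases ht.1.eq_or_lt with rfl | h
    · simp [hXY]
    · simp [h.not_ge]
  refine ⟨?_, insert b (S ∪ S'), (hS.union hS').insert b, fun t ht hts => ?_⟩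
  · rw [← Icc_union_Icc_eq_Icc hab hbc]
    exact (hXc.congr e1).union_of_isClosed (hYc.congr e2) isClosed_Icc isClosed_Icc
  · rw [mem_insert_iff, mem_union, not_or, not_or] at hts
    rcases lt_or_gt_of_ne hts.1 with h | h
    · rw [e1 ⟨ht.1.le, h.le⟩]
      refine (hXd t ⟨ht.1, h⟩ hts.2.1).congr_of_eventuallyEq ?_
      filter_upwards [Ioo_mem_nhds ht.1 h] with r hr using e1 (Ioo_subset_Icc_self hr)
    · rw [e2 ⟨h.le, ht.2.le⟩]
      refine (hYd t ⟨h, ht.2⟩ hts.2.2).congr_of_eventuallyEq ?_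
      filter_upwards [Ioo_mem_nhds h ht.2] with r hr using e2 (Ioo_subset_Icc_self hr)

/-- Equality propagates over each interval free of exceptional times by Grönwall's inequality, with
the Lipschitz constant of a ball that contains both trajectories. -/
theorem IsTrajectory.eqOn {f : ℝ → E → E} {a b : ℝ} {X Y : ℝ → E}
    (hf : ∀ R : ℝ, ∃ K, ∀ t ∈ Icc a b, LipschitzOnWith K (f t) (Metric.closedBall 0 R))
    (hX : IsTrajectory f a b X) (hY : IsTrajectory f a b Y) (h0 : X a = Y a) :
    EqOn X Y (Icc a b) := by
  obtain ⟨hXc, S, hS, hXd⟩ := hX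
  obtain ⟨hYc, S', hS', hYd⟩ := hY
  obtain ⟨R₁, hR₁⟩ := isCompact_Icc.exists_bound_of_continuousOn hXc
  obtain ⟨R₂, hR₂⟩ := isCompact_Icc.exists_bound_of_continuousOn hYc
  obtain ⟨K, hK⟩ := hf (max R₁ R₂)
  have key : ∀ c d, c ≤ d → (a ≤ c → d ≤ b → X c = Y c → X d = Y d) := by
    intro c d hcd
    refine interval_induction_of_finite (Q := fun c d => a ≤ c → d ≤ b → X c = Y c → X d = Y d)
      (hS.union hS') ?_ ?_ hcd
    · intro c d e hcd hde h1 h2 hc he h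
      exact h2 (hc.trans hcd) he (h1 hc (hde.trans he) h)
    · intro c d hcd hno hc hd heq
      rcases hcd.eq_or_lt with rfl | hlt
      · exact heq
      have hXc' := hXc.mono (Icc_subset_Icc hc hd)
      have hYc' := hYc.mono (Icc_subset_Icc hc hd)
      -- Grönwall needs a right derivative at the initial time, and `c` may be exceptional; so it
      -- starts at `r > c`, and `r → c` uses continuity only.
      have bound : ∀ r ∈ Ioo c d, dist (X d) (Y d) ≤ dist (X r) (Y r) * Real.exp (K * (d - r)) := by
        intro r hr
        have hin : ∀ t ∈ Ico r d, t ∈ Ioo c d := fun t ht => ⟨hr.1.trans_le ht.1, ht.2⟩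
        have hin' : ∀ t ∈ Ico r d, t ∈ Icc a b := fun t ht =>
          ⟨hc.trans (hin t ht).1.le, (hin t ht).2.le.trans hd⟩
        have hin'' : ∀ t ∈ Ico r d, t ∈ Ioo a b := fun t ht =>
          ⟨hc.trans_lt (hin t ht).1, (hin t ht).2.trans_le hd⟩
        refine dist_le_of_trajectories_ODE_of_mem (v := f)
          (s := fun _ => Metric.closedBall 0 (max R₁ R₂))
          (fun t ht => hK t (hin' t ht)) (hXc'.mono (Icc_subset_Icc_left hr.1.le))
          (fun t ht => (hXd t (hin'' t ht) fun h => hno t (hin t ht) (Or.inl h)).hasDerivWithinAt)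
          (fun t ht => ?_) (hYc'.mono (Icc_subset_Icc_left hr.1.le))
          (fun t ht => (hYd t (hin'' t ht) fun h => hno t (hin t ht) (Or.inr h)).hasDerivWithinAt)
          (fun t ht => ?_) le_rfl d (right_mem_Icc.2 hr.2.le)
        · exact mem_closedBall_zero_iff.2 ((hR₁ t (hin' t ht)).trans (le_max_left _ _))
        · exact mem_closedBall_zero_iff.2 ((hR₂ t (hin' t ht)).trans (le_max_right _ _))
      have hlim : Tendsto (fun r => dist (X r) (Y r) * Real.exp (K * (d - r))) (𝓝[>] c)
          (𝓝 (dist (X c) (Y c) * Real.exp (K * (d - c)))) := by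
        have hle : 𝓝[>] c ≤ 𝓝[Icc c d] c := by
          rw [← nhdsWithin_Ioo_eq_nhdsGT hlt]
          exact nhdsWithin_mono _ Ioo_subset_Icc_self
        have h1 := (hXc' c (left_mem_Icc.2 hcd)).mono_left hle
        have h2 := (hYc' c (left_mem_Icc.2 hcd)).mono_left hle
        refine (h1.dist h2).mul ?_
        exact (Continuous.tendsto (by fun_prop) c).mono_left nhdsWithin_le_nhds
      rw [heq, dist_self, zero_mul] at hlim
      have := ge_of_tendsto hlim (by
        filter_upwards [Ioo_mem_nhdsGT hlt] with r hr using bound r hr)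
      exact dist_le_zero.1 this
  exact fun t ht => key a t ht.1 le_rfl ht.2 h0

end Trajectories

/-! ### Local existence with a uniform lifespan -/

section ParametrizedVectorField

variable {E F : Type*} [NormedAddCommGroup E] [NormedSpace ℝ E] [ProperSpace E]
  [NormedAddCommGroup F] [NormedSpace ℝ F] [ProperSpace F]

/-- A locally Lipschitz map is Lipschitz on the compact product of the two balls; passing to slices
makes the constants independent of the parameter `v`. -/
theorem exists_lipschitzOnWith_of_contDiff {G : F × E → E} (hG : ContDiff ℝ 1 G) (B R : ℝ) :
    ∃ K L : NNReal, ∀ v : F, ‖v‖ ≤ B →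
      LipschitzOnWith K (fun X => G (v, X)) (Metric.closedBall 0 R) ∧
      ∀ X ∈ Metric.closedBall (0 : E) R, ‖G (v, X)‖ ≤ L := by
  have hcomp : IsCompact (Metric.closedBall (0 : F) B ×ˢ Metric.closedBall (0 : E) R) :=
    (isCompact_closedBall _ _).prod (isCompact_closedBall _ _)
  obtain ⟨K, hK⟩ := hG.locallyLipschitz.locallyLipschitzOn.exists_lipschitzOnWith_of_compact hcomp
  obtain ⟨L, hL⟩ := hcomp.exists_bound_of_continuousOn hG.continuous.continuousOn
  refine ⟨K, L.toNNReal, fun v hv => ⟨?_, fun X hX => (hL (v, X) ⟨?_, hX⟩).trans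
    (Real.le_coe_toNNReal L)⟩⟩
  · intro X hX Y hY
    have := hK (x := (v, X)) ⟨mem_closedBall_zero_iff.2 hv, hX⟩ (y := (v, Y))
      ⟨mem_closedBall_zero_iff.2 hv, hY⟩
    simpa [Prod.edist_eq] using this
  · exact mem_closedBall_zero_iff.2 hv

/-- On an interval where the parameters are continuous, all trajectories that start in a given ball
exist for a uniform time. -/
theorem exists_uniform_time_isTrajectory [CompleteSpace E] {G : F × E → E} (hG : ContDiff ℝ 1 G)
    {π : ℝ → F} {a b : ℝ} (hπ : ContinuousOn π (Icc a b)) (M : ℝ) :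
    ∃ h > 0, ∀ t₀ ∈ Icc a b, ∀ t₁ ∈ Icc a b, t₀ ≤ t₁ → t₁ ≤ t₀ + h → ∀ X₀ : E, ‖X₀‖ ≤ M →
      ∃ X : ℝ → E, X t₀ = X₀ ∧ IsTrajectory (fun t X => G (π t, X)) t₀ t₁ X := by
  obtain ⟨B, hB⟩ := isCompact_Icc.exists_bound_of_continuousOn hπ
  obtain ⟨K, L, hKL⟩ := exists_lipschitzOnWith_of_contDiff hG B (M + 1)
  -- The unit ball around `X₀` lies in the ball of radius `M + 1`, where the speed is at most `L`;
  -- within time `1 / (L + 1)` it cannot be left.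
  refine ⟨1 / (L + 1), by positivity, fun t₀ h₀ t₁ h₁ h01 hle X₀ hX₀ => ?_⟩
  have hsub : Icc t₀ t₁ ⊆ Icc a b := Icc_subset_Icc h₀.1 h₁.2
  have hball : Metric.closedBall X₀ ((1 : NNReal) : ℝ) ⊆ Metric.closedBall 0 (M + 1) := by
    refine Metric.closedBall_subset_closedBall' ?_
    rw [dist_zero_right, NNReal.coe_one]
    linarith
  have hpl : IsPicardLindelof (fun t X => G (π t, X)) (⟨t₀, left_mem_Icc.2 h01⟩ : Icc t₀ t₁)
      X₀ 1 0 L K :=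
    { lipschitzOnWith := fun t ht => (hKL (π t) (hB t (hsub ht))).1.mono hball
      continuousOn := fun X _ => hG.continuous.comp_continuousOn
        ((hπ.mono hsub).prodMk continuousOn_const)
      norm_le := fun t ht X hX => (hKL (π t) (hB t (hsub ht))).2 X (hball hX)
      mul_max_le := by
        have h1 : max (t₁ - t₀) (t₀ - t₀) = t₁ - t₀ := by
          rw [sub_self]; exact max_eq_left (by linarith)
        simp only [h1, NNReal.coe_one, NNReal.coe_zero, sub_zero]
        have h2 : t₁ - t₀ ≤ 1 / ((L : ℝ) + 1) := by linarith
        calc (L : ℝ) * (t₁ - t₀) ≤ L * (1 / (L + 1)) := by gcongr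
          _ ≤ 1 := by
            rw [mul_one_div, div_le_one (by positivity)]
            linarith }
  obtain ⟨X, hX0, hX⟩ := hpl.exists_eq_forall_mem_Icc_hasDerivWithinAt₀
  refine ⟨X, hX0, fun t ht => (hX t ht).continuousWithinAt, ∅, finite_empty, fun t ht _ => ?_⟩
  exact (hX t (Ioo_subset_Icc_self ht)).hasDerivAt (Icc_mem_nhds ht.1 ht.2)

/-- Giving `π` the value `l` at `c` makes it continuous on a closed interval starting at `c`. The
change concerns a single time, which a trajectory does not notice. The lifespan depends on the data
and `M`, not on the initial time. -/
theorem exists_isTrajectory_right [CompleteSpace E] {G : F × E → E} (hG : ContDiff ℝ 1 G)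
    {π : ℝ → F} {c d : ℝ} (hcd : c < d) (hπ : ContinuousOn π (Ioo c d))
    {l : F} (hl : Tendsto π (𝓝[>] c) (𝓝 l)) (M : ℝ) :
    ∃ h > 0, ∀ t₀ ∈ Icc c (c + h), ∀ t₁ ∈ Icc t₀ (c + h), ∀ X₀ : E, ‖X₀‖ ≤ M →
      ∃ X : ℝ → E, X t₀ = X₀ ∧ IsTrajectory (fun t X => G (π t, X)) t₀ t₁ X := by
  have hcont : ContinuousOn (Function.update π c l) (Icc c ((c + d) / 2)) := by
    intro t ht
    rcases ht.1.eq_or_lt with rfl | h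
    · refine continuousWithinAt_update_same.2 (hl.mono_left ?_)
      refine nhdsWithin_mono _ fun r hr => lt_of_le_of_ne hr.1.1 (Ne.symm hr.2)
    · have h1 : ContinuousAt π t := hπ.continuousAt (Ioo_mem_nhds h (by linarith [ht.2]))
      exact ((continuousAt_update_of_ne h.ne').2 h1).continuousWithinAt
  obtain ⟨h, hpos, hex⟩ := exists_uniform_time_isTrajectory hG hcont M
  refine ⟨min h ((d - c) / 2), lt_min hpos (by linarith), fun t₀ h₀ t₁ h₁ X₀ hX₀ => ?_⟩
  have e1 := min_le_left h ((d - c) / 2)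
  have e2 := min_le_right h ((d - c) / 2)
  obtain ⟨X, hX0, hX⟩ := hex t₀ ⟨h₀.1, by linarith [h₀.2]⟩ t₁
    ⟨h₀.1.trans h₁.1, by linarith [h₁.2]⟩ h₁.1 (by linarith [h₀.1, h₁.2]) X₀ hX₀
  refine ⟨X, hX0, hX.congr (finite_singleton c) (fun t _ htc => ?_) fun t _ => rfl⟩
  simp [Function.update_of_ne htc]

theorem exists_isTrajectory_left [CompleteSpace E] {G : F × E → E} (hG : ContDiff ℝ 1 G)
    {π : ℝ → F} {c d : ℝ} (hdc : d < c) (hπ : ContinuousOn π (Ioo d c))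
    {l : F} (hl : Tendsto π (𝓝[<] c) (𝓝 l)) (M : ℝ) :
    ∃ h > 0, ∀ t₀ ∈ Icc (c - h) c, ∀ t₁ ∈ Icc t₀ c, ∀ X₀ : E, ‖X₀‖ ≤ M →
      ∃ X : ℝ → E, X t₀ = X₀ ∧ IsTrajectory (fun t X => G (π t, X)) t₀ t₁ X := by
  have hcont : ContinuousOn (Function.update π c l) (Icc ((c + d) / 2) c) := by
    intro t ht
    rcases ht.2.eq_or_lt with rfl | h
    · refine continuousWithinAt_update_same.2 (hl.mono_left ?_)
      refine nhdsWithin_mono _ fun r hr => lt_of_le_of_ne hr.1.2 hr.2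
    · have h1 : ContinuousAt π t := hπ.continuousAt (Ioo_mem_nhds (by linarith [ht.1]) h)
      exact ((continuousAt_update_of_ne h.ne).2 h1).continuousWithinAt
  obtain ⟨h, hpos, hex⟩ := exists_uniform_time_isTrajectory hG hcont M
  refine ⟨min h ((c - d) / 2), lt_min hpos (by linarith), fun t₀ h₀ t₁ h₁ X₀ hX₀ => ?_⟩
  have e1 := min_le_left h ((c - d) / 2)
  have e2 := min_le_right h ((c - d) / 2)
  obtain ⟨X, hX0, hX⟩ := hex t₀ ⟨by linarith [h₀.1], h₀.2⟩ t₁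
    ⟨by linarith [h₀.1, h₁.1], h₁.2⟩ h₁.1 (by linarith [h₀.1, h₁.2]) X₀ hX₀
  refine ⟨X, hX0, hX.congr (finite_singleton c) (fun t _ htc => ?_) fun t _ => rfl⟩
  simp [Function.update_of_ne htc]

end ParametrizedVectorField

/-! ### Piecewise continuous data -/

section PiecewiseContinuous

theorem PiecewiseContinuous.exists_punctured {F : Type*} [TopologicalSpace F] {π : ℝ → F}
    (hπ : PiecewiseContinuous π) (c : ℝ) :
    ∃ ε > 0, ∀ t, 0 ≤ t → c - ε < t → t < c + ε → t ≠ c → ContinuousWithinAt π (Ici 0) t := by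
  have hfin := (hπ.1 (c + 1)).subset (sdiff_subset (t := {c}))
  have hmem : ({t ∈ Icc 0 (c + 1) | ¬ ContinuousWithinAt π (Ici 0) t} \ {c})ᶜ ∈ 𝓝 c :=
    hfin.isClosed.isOpen_compl.mem_nhds fun h => h.2 rfl
  obtain ⟨ε, hε, hball⟩ := Metric.mem_nhds_iff.1 hmem
  refine ⟨min ε 1, by positivity, fun t h0 h1 h2 hne => ?_⟩
  have e1 := min_le_left ε 1
  have e2 := min_le_right ε 1
  by_contra hcon
  refine hball (show t ∈ Metric.ball c ε from ?_) ⟨⟨⟨h0, by linarith⟩, hcon⟩, hne⟩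
  rw [Metric.mem_ball, Real.dist_eq, abs_lt]
  constructor <;> linarith

/-- By compactness a local bound is enough. Near `t` it is the maximum of the bounds given by the
two one-sided limits and the value at `t`, which need not agree with either limit. -/
theorem PiecewiseContinuous.exists_bound {F : Type*} [NormedAddCommGroup F] {π : ℝ → F}
    (hπ : PiecewiseContinuous π) (T : ℝ) : ∃ B, ∀ t ∈ Icc 0 T, ‖π t‖ ≤ B := by
  refine (isCompact_Icc (a := (0 : ℝ)) (b := T)).induction_on
    (p := fun s => ∃ B, ∀ t ∈ s, ‖π t‖ ≤ B) ⟨0, by simp⟩ ?_ ?_ ?_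
  · rintro s t hst ⟨B, hB⟩
    exact ⟨B, fun r hr => hB r (hst hr)⟩
  · rintro s t ⟨B, hB⟩ ⟨C, hC⟩
    refine ⟨max B C, fun r hr => ?_⟩
    rcases hr with hr | hr
    · exact (hB r hr).trans (le_max_left _ _)
    · exact (hC r hr).trans (le_max_right _ _)
  · intro t ht
    obtain ⟨l, hl⟩ := hπ.2.1 t ht.1
    have hR : ∀ᶠ r in 𝓝[>] t, ‖π r‖ ≤ ‖l‖ + 1 :=
      hl.norm.eventually (ge_mem_nhds (lt_add_one _))
    have hL : ∃ B, ∀ᶠ r in 𝓝[<] t, 0 ≤ r → ‖π r‖ ≤ B := by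
      rcases ht.1.eq_or_lt with rfl | hpos
      · refine ⟨0, ?_⟩
        filter_upwards [self_mem_nhdsWithin] with r hr hr'
        exact absurd hr' (not_le.2 hr)
      · obtain ⟨l', hl'⟩ := hπ.2.2 t hpos
        refine ⟨‖l'‖ + 1, ?_⟩
        filter_upwards [hl'.norm.eventually (ge_mem_nhds (lt_add_one _))] with r hr _ using hr
    obtain ⟨B, hL⟩ := hL
    rw [eventually_nhdsWithin_iff] at hR hL
    refine ⟨{r | 0 ≤ r → ‖π r‖ ≤ max (‖l‖ + 1) (max B ‖π t‖)} ∩ Icc 0 T, ?_,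
      ⟨max (‖l‖ + 1) (max B ‖π t‖), fun r hr => hr.1 hr.2.1⟩⟩
    refine inter_mem (mem_nhdsWithin_of_mem_nhds ?_) self_mem_nhdsWithin
    filter_upwards [hR, hL] with r h1 h2 h0
    rcases lt_trichotomy r t with h | rfl | h
    · exact (h2 h h0).trans ((le_max_left _ _).trans (le_max_right _ _))
    · exact (le_max_right _ _).trans (le_max_right _ _)
    · exact (h1 h).trans (le_max_left _ _)

theorem PiecewiseContinuous.prodMk {F G : Type*} [TopologicalSpace F] [TopologicalSpace G]
    {π : ℝ → F} {ξ : ℝ → G} (hπ : PiecewiseContinuous π) (hξ : PiecewiseContinuous ξ) :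
    PiecewiseContinuous fun t => (π t, ξ t) := by
  refine ⟨fun T => ((hπ.1 T).union (hξ.1 T)).subset ?_, fun t ht => ?_, fun t ht => ?_⟩
  · rintro t ⟨ht, hcon⟩
    by_contra h
    simp only [mem_union, mem_ofPred_eq, not_or, not_and, not_not] at h
    exact hcon ((h.1 ht).prodMk (h.2 ht))
  · obtain ⟨l, hl⟩ := hπ.2.1 t ht
    obtain ⟨l', hl'⟩ := hξ.2.1 t ht
    exact ⟨(l, l'), hl.prodMk_nhds hl'⟩
  · obtain ⟨l, hl⟩ := hπ.2.2 t ht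
    obtain ⟨l', hl'⟩ := hξ.2.2 t ht
    exact ⟨(l, l'), hl.prodMk_nhds hl'⟩

theorem Continuous.piecewiseContinuous {F : Type*} [TopologicalSpace F] {π : ℝ → F}
    (hπ : Continuous π) : PiecewiseContinuous π :=
  ⟨fun T => by simp [hπ.continuousWithinAt],
    fun t _ => ⟨π t, hπ.continuousAt.mono_left nhdsWithin_le_nhds⟩,
    fun t _ => ⟨π t, hπ.continuousAt.mono_left nhdsWithin_le_nhds⟩⟩

end PiecewiseContinuous

/-! ### Continuation under an a priori bound -/

section GlobalExistence

variable {E F : Type*} [NormedAddCommGroup E] [NormedSpace ℝ E] [ProperSpace E]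
  [NormedAddCommGroup F] [NormedSpace ℝ F] [ProperSpace F]

theorem PiecewiseContinuous.exists_lipschitzOnWith {G : F × E → E} (hG : ContDiff ℝ 1 G)
    {π : ℝ → F} (hπ : PiecewiseContinuous π) (T R : ℝ) :
    ∃ K, ∀ t ∈ Icc 0 T, LipschitzOnWith K (fun X => G (π t, X)) (Metric.closedBall 0 R) := by
  obtain ⟨B, hB⟩ := hπ.exists_bound T
  obtain ⟨K, _, hKL⟩ := exists_lipschitzOnWith_of_contDiff hG B R
  exact ⟨K, fun t ht => (hKL (π t) (hB t ht)).1⟩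

/-- A trajectory exists up to time `T` if the values of all trajectories are bounded a priori. -/
theorem exists_isTrajectory_of_bound {G : F × E → E} (hG : ContDiff ℝ 1 G)
    {π : ℝ → F} (hπ : PiecewiseContinuous π) {T M : ℝ} (hT : 0 ≤ T) {X₀ : E}
    (hM : ∀ t ∈ Icc 0 T, ∀ X : ℝ → E, IsTrajectory (fun t X => G (π t, X)) 0 t X → X 0 = X₀ →
      ‖X t‖ ≤ M) :
    ∃ X : ℝ → E, X 0 = X₀ ∧ IsTrajectory (fun t X => G (π t, X)) 0 T X := by
  have : CompleteSpace E := inferInstance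
  set A : Set ℝ := {t ∈ Icc 0 T | ∃ X : ℝ → E, X 0 = X₀ ∧
    IsTrajectory (fun t X => G (π t, X)) 0 t X} with hA
  have extend : ∀ t₀ ∈ A, ∀ t₁ ∈ Icc t₀ T, (∀ X₁ : E, ‖X₁‖ ≤ M → ∃ X : ℝ → E, X t₀ = X₁ ∧
      IsTrajectory (fun t X => G (π t, X)) t₀ t₁ X) → t₁ ∈ A := by
    rintro t₀ ⟨h₀, X, hX0, hX⟩ t₁ h₁ hex
    obtain ⟨Y, hY0, hY⟩ := hex (X t₀) (hM t₀ h₀ X hX hX0)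
    refine ⟨⟨h₀.1.trans h₁.1, h₁.2⟩, _, ?_, hX.glue h₀.1 h₁.1 hY hY0.symm⟩
    simp [h₀.1, hX0]
  have h0A : (0 : ℝ) ∈ A := by
    refine ⟨⟨le_rfl, hT⟩, fun _ => X₀, rfl, continuousOn_const, ∅, finite_empty, ?_⟩
    intro t ht
    exact absurd (ht.1.trans ht.2) (lt_irrefl _)
  have hbdd : BddAbove A := ⟨T, fun t ht => ht.1.2⟩
  -- The supremum is attained: the lifespan `h` to the left of `c` is fixed first, so a start after
  -- `c - h` reaches `c`. If `c < T`, the lifespan to the right would lead beyond `c`.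
  set c := sSup A with hc
  have hc0 : 0 ≤ c := le_csSup hbdd h0A
  have hcT : c ≤ T := csSup_le ⟨0, h0A⟩ fun t ht => ht.1.2
  obtain ⟨ε, hε, hcont⟩ := hπ.exists_punctured c
  have hcA : c ∈ A := by
    rcases hc0.eq_or_lt with h | hpos
    · rwa [← h]
    · obtain ⟨l, hl⟩ := hπ.2.2 c hpos
      have hlt : max (c - ε) 0 < c := max_lt (by linarith) hpos
      obtain ⟨h, hh, hex⟩ := exists_isTrajectory_left hG hlt (fun t ht => by
        have h1 : c - ε < t := (le_max_left _ _).trans_lt ht.1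
        have h2 : 0 < t := (le_max_right _ _).trans_lt ht.1
        refine (hcont t h2.le h1 (by linarith [ht.2]) ht.2.ne).mono fun r hr => ?_
        exact (le_max_right _ _).trans hr.1.le) hl M
      obtain ⟨t₀, ht₀, hlt₀⟩ := exists_lt_of_lt_csSup ⟨0, h0A⟩ (show c - h < c by linarith)
      have hle := le_csSup hbdd ht₀
      exact extend t₀ ht₀ c ⟨hle, hcT⟩ fun X₁ hX₁ =>
        hex t₀ ⟨hlt₀.le, hle⟩ c ⟨hle, le_rfl⟩ X₁ hX₁
  obtain ⟨l, hl⟩ := hπ.2.1 c hc0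
  obtain ⟨h, hh, hex⟩ := exists_isTrajectory_right hG (show c < c + ε by linarith)
    (fun t ht => (hcont t (hc0.trans ht.1.le) (by linarith [ht.1]) ht.2 ht.1.ne').mono
      fun r hr => hc0.trans hr.1.le) hl M
  have hmem : min T (c + h) ∈ A := by
    have h1 : c ≤ min T (c + h) := le_min hcT (by linarith)
    exact extend c hcA _ ⟨h1, min_le_left _ _⟩ fun X₁ hX₁ =>
      hex c ⟨le_rfl, by linarith⟩ _ ⟨h1, min_le_right _ _⟩ X₁ hX₁
  have hle := le_csSup hbdd hmem
  have : T ≤ c := by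
    by_contra hcon
    have : c < min T (c + h) := lt_min (not_le.1 hcon) (by linarith)
    exact absurd hle (not_le.2 this)
  have hTc : T = c := le_antisymm this hcT
  rw [hTc]
  exact hcA.2

theorem exists_global_isTrajectory {G : F × E → E} (hG : ContDiff ℝ 1 G)
    {π : ℝ → F} (hπ : PiecewiseContinuous π) {X₀ : E}
    (hM : ∀ T : ℝ, ∃ M, ∀ t ∈ Icc 0 T, ∀ X : ℝ → E,
      IsTrajectory (fun t X => G (π t, X)) 0 t X → X 0 = X₀ → ‖X t‖ ≤ M) :
    ∃ X : ℝ → E, X 0 = X₀ ∧ ∀ T, IsTrajectory (fun t X => G (π t, X)) 0 T X := by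
  have hex : ∀ n : ℕ, ∃ X : ℝ → E, X 0 = X₀ ∧ IsTrajectory (fun t X => G (π t, X)) 0 n X := by
    intro n
    obtain ⟨M, hM⟩ := hM n
    exact exists_isTrajectory_of_bound hG hπ n.cast_nonneg hM
  choose X hX0 hX using hex
  have agree : ∀ (n k : ℕ) (t : ℝ), 0 ≤ t → t ≤ n → t ≤ k → X n t = X k t := by
    intro n k t h0 hn hk
    exact IsTrajectory.eqOn (hπ.exists_lipschitzOnWith hG t) ((hX n).mono le_rfl hn)
      ((hX k).mono le_rfl hk) ((hX0 n).trans (hX0 k).symm) ⟨h0, le_rfl⟩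
  -- By uniqueness the value at `t` is the same for every horizon `n ≥ t`, so the choice of `⌈t⌉₊`
  -- is immaterial.
  refine ⟨fun t => X ⌈t⌉₊ t, by simp [hX0], fun T => ?_⟩
  refine ((hX ⌈T⌉₊).mono le_rfl (Nat.le_ceil T)).congr finite_empty (fun t _ _ => rfl) ?_
  intro t ht
  exact agree _ _ t ht.1 (ht.2.trans (Nat.le_ceil T)) (Nat.le_ceil t)

end GlobalExistence

/-! ### Derivatives at exceptional times -/

section DerivativeAtExceptionalTimes

variable {E : Type*} [NormedAddCommGroup E] [NormedSpace ℝ E]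

/-- A continuous function whose derivative has a one-sided limit has that limit as one-sided
derivative. This recovers the equations at times of the unspecified finite set `S` where the
right-hand side is continuous. -/
theorem hasDerivWithinAt_Ici_of_off_finite {f g : ℝ → E} {a b : ℝ} {S : Set ℝ} (hS : S.Finite)
    (hf : ContinuousOn f (Icc a b)) (hd : ∀ t ∈ Ioo a b, t ∉ S → HasDerivAt f (g t) t)
    {t : ℝ} (ht : t ∈ Ico a b) (hg : Tendsto g (𝓝[>] t) (𝓝 (g t))) :
    HasDerivWithinAt f (g t) (Ici t) t := by
  have hU : Ioo t b ∩ (S \ {t})ᶜ ∈ 𝓝[>] t := by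
    refine inter_mem (Ioo_mem_nhdsGT ht.2) (mem_nhdsWithin_of_mem_nhds ?_)
    exact (hS.subset sdiff_subset).isClosed.isOpen_compl.mem_nhds fun h => h.2 rfl
  have hd' : ∀ r ∈ Ioo t b ∩ (S \ {t})ᶜ, HasDerivAt f (g r) r := fun r hr =>
    hd r ⟨ht.1.trans_lt hr.1.1, hr.1.2⟩ fun h => hr.2 ⟨h, hr.1.1.ne'⟩
  refine hasDerivWithinAt_Ici_of_tendsto_deriv (s := Ioo t b ∩ (S \ {t})ᶜ)
    (fun r hr => (hd' r hr).differentiableAt.differentiableWithinAt)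
    ((hf t ⟨ht.1, ht.2.le⟩).mono fun r hr => ⟨ht.1.trans hr.1.1.le, hr.1.2.le⟩) hU ?_
  refine hg.congr' ?_
  filter_upwards [hU] with r hr using (hd' r hr).deriv.symm

theorem hasDerivWithinAt_Iic_of_off_finite {f g : ℝ → E} {a b : ℝ} {S : Set ℝ} (hS : S.Finite)
    (hf : ContinuousOn f (Icc a b)) (hd : ∀ t ∈ Ioo a b, t ∉ S → HasDerivAt f (g t) t)
    {t : ℝ} (ht : t ∈ Ioc a b) (hg : Tendsto g (𝓝[<] t) (𝓝 (g t))) :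
    HasDerivWithinAt f (g t) (Iic t) t := by
  have hU : Ioo a t ∩ (S \ {t})ᶜ ∈ 𝓝[<] t := by
    refine inter_mem (Ioo_mem_nhdsLT ht.1) (mem_nhdsWithin_of_mem_nhds ?_)
    exact (hS.subset sdiff_subset).isClosed.isOpen_compl.mem_nhds fun h => h.2 rfl
  have hd' : ∀ r ∈ Ioo a t ∩ (S \ {t})ᶜ, HasDerivAt f (g r) r := fun r hr =>
    hd r ⟨hr.1.1, hr.1.2.trans_le ht.2⟩ fun h => hr.2 ⟨h, hr.1.2.ne⟩
  refine hasDerivWithinAt_Iic_of_tendsto_deriv (s := Ioo a t ∩ (S \ {t})ᶜ)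
    (fun r hr => (hd' r hr).differentiableAt.differentiableWithinAt)
    ((hf t ⟨ht.1.le, ht.2⟩).mono fun r hr => ⟨hr.1.1.le, hr.1.2.le.trans ht.2⟩) hU ?_
  refine hg.congr' ?_
  filter_upwards [hU] with r hr using (hd' r hr).deriv.symm

theorem hasDerivAt_of_off_finite {f g : ℝ → E} {a b : ℝ} {S : Set ℝ} (hS : S.Finite)
    (hf : ContinuousOn f (Icc a b)) (hd : ∀ t ∈ Ioo a b, t ∉ S → HasDerivAt f (g t) t)
    {t : ℝ} (ht : t ∈ Ioo a b) (hg : ContinuousAt g t) : HasDerivAt f (g t) t := by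
  have h1 := hasDerivWithinAt_Ici_of_off_finite hS hf hd ⟨ht.1.le, ht.2⟩
    (hg.mono_left nhdsWithin_le_nhds)
  have h2 := hasDerivWithinAt_Iic_of_off_finite hS hf hd ⟨ht.1, ht.2.le⟩
    (hg.mono_left nhdsWithin_le_nhds)
  simpa [hasDerivWithinAt_univ] using h1.union h2

end DerivativeAtExceptionalTimes

theorem exists_tendsto_of_antitoneOn {g : ℝ → ℝ} (hg : AntitoneOn g (Ici 0)) {B : ℝ}
    (hB : ∀ t, 0 ≤ t → B ≤ g t) : ∃ l, Tendsto g atTop (𝓝 l) := by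
  have h1 : Antitone fun t => g (max t 0) := fun r t hrt =>
    hg (mem_Ici.2 (le_max_right _ _)) (mem_Ici.2 (le_max_right _ _)) (max_le_max_right 0 hrt)
  refine ⟨_, (tendsto_atTop_ciInf h1 ⟨B, ?_⟩).congr' ?_⟩
  · rintro _ ⟨t, rfl⟩
    exact hB _ (le_max_right _ _)
  · filter_upwards [eventually_ge_atTop 0] with t ht
    rw [max_eq_left ht]

end

/-! ### Smoothness of parametric integrals -/

/-- Induction by differentiating under the integral sign. The target `F` is quantified inside the
induction because the derivative takes values in the linear maps from `E` to `F`. -/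
theorem contDiff_intervalIntegral {E : Type} [NormedAddCommGroup E] [NormedSpace ℝ E]
    [ProperSpace E] (n : ℕ) : ∀ {F : Type} [NormedAddCommGroup F] [NormedSpace ℝ F]
    {H : E × ℝ → F}, ContDiff ℝ n H → ContDiff ℝ n fun x => ∫ t in (0 : ℝ)..1, H (x, t) := by
  induction n with
  | zero =>
    intro F _ _ H hH
    have hc : Continuous H := hH.continuous
    exact contDiff_zero.2 (intervalIntegral.continuous_parametric_intervalIntegral_of_continuous'
      (f := fun x t => H (x, t)) hc 0 1)
  | succ n ih =>
    intro F _ _ H hH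
    have hH1 : ContDiff ℝ (n + 1) H := by exact_mod_cast hH
    have hD : ContDiff ℝ n fun r : E × ℝ => (fderiv ℝ H r).comp (ContinuousLinearMap.inl ℝ E ℝ) :=
      (hH1.fderiv_right le_rfl).clm_comp contDiff_const
    have hdiff : Differentiable ℝ H := hH1.differentiable (by simp)
    push_cast
    refine contDiff_succ_iff_hasFDerivAt.2 ⟨_, ih hD, fun x => ?_⟩
    obtain ⟨C, hC⟩ := ((isCompact_closedBall x 1).prod
      (isCompact_Icc (a := (0 : ℝ)) (b := 1))).exists_bound_of_continuousOn
      hD.continuous.continuousOn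
    refine (intervalIntegral.hasFDerivAt_integral_of_dominated_of_fderiv_le
      (F := fun x t => H (x, t)) (bound := fun _ => C)
      (F' := fun x t => (fderiv ℝ H (x, t)).comp (ContinuousLinearMap.inl ℝ E ℝ))
      (Metric.ball_mem_nhds x one_pos) ?_ ?_ ?_ ?_ (by simp) ?_)
    · exact Filter.Eventually.of_forall fun y =>
        (hH.continuous.comp (by fun_prop : Continuous fun t : ℝ => (y, t))).aestronglyMeasurable
    · exact (hH.continuous.comp (by fun_prop : Continuous fun t : ℝ => (x, t))).intervalIntegrable
        0 1
    · exact (hD.continuous.comp (by fun_prop : Continuous fun t : ℝ => (x, t))).aestronglyMeasurable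
    · refine Filter.Eventually.of_forall fun t ht y hy => hC (y, t) ⟨Metric.ball_subset_closedBall hy, ?_⟩
      rw [Set.uIoc_of_le zero_le_one] at ht
      exact Set.Ioc_subset_Icc_self ht
    · refine Filter.Eventually.of_forall fun t _ y _ => ?_
      exact (hdiff (y, t)).hasFDerivAt.comp y (hasFDerivAt_prodMk_left y t)

namespace Backstepping

variable {m q : ℕ}

/-! ### Functions that are smooth in `(x, θ̂, μ x)` -/

section ScaledSmooth

variable {E E' : Type*} [NormedAddCommGroup E] [NormedSpace ℝ E]
  [NormedAddCommGroup E'] [NormedSpace ℝ E']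

/-- The map `(x, ϑ, μ) ↦ (x, ϑ, μ x)`. -/
def lift (p : Pt m q) : State m × Par q × State m := (p.1, p.2.1, p.2.2 • p.1)

theorem contDiff_lift : ContDiff ℝ ∞ (lift : Pt m q → State m × Par q × State m) := by
  unfold lift; fun_prop

theorem scaledSmooth_iff {f : Pt m q → E} :
    ScaledSmooth f ↔ ∃ F : State m × Par q × State m → E, ContDiff ℝ ∞ F ∧ f = F ∘ lift :=
  ⟨fun ⟨F, hF, h⟩ => ⟨F, hF, funext fun p => h p.1 p.2.1 p.2.2⟩,
    fun ⟨F, hF, h⟩ => ⟨F, hF, fun _ _ _ => by rw [h]; rfl⟩⟩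

theorem ScaledSmooth.contDiff {f : Pt m q → E} (hf : ScaledSmooth f) : ContDiff ℝ ∞ f := by
  obtain ⟨F, hF, rfl⟩ := scaledSmooth_iff.1 hf
  exact hF.comp contDiff_lift

theorem ScaledSmooth.comp {f : Pt m q → E} (hf : ScaledSmooth f) {g : E → E'}
    (hg : ContDiff ℝ ∞ g) : ScaledSmooth fun p => g (f p) := by
  obtain ⟨F, hF, rfl⟩ := scaledSmooth_iff.1 hf
  exact scaledSmooth_iff.2 ⟨g ∘ F, hg.comp hF, rfl⟩

theorem ScaledSmooth.prodMk {f : Pt m q → E} {g : Pt m q → E'} (hf : ScaledSmooth f)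
    (hg : ScaledSmooth g) : ScaledSmooth fun p => (f p, g p) := by
  obtain ⟨F, hF, rfl⟩ := scaledSmooth_iff.1 hf
  obtain ⟨G, hG, rfl⟩ := scaledSmooth_iff.1 hg
  exact scaledSmooth_iff.2 ⟨fun r => (F r, G r), hF.prodMk hG, rfl⟩

theorem ScaledSmooth.const (c : E) : ScaledSmooth fun _ : Pt m q => c :=
  scaledSmooth_iff.2 ⟨fun _ => c, contDiff_const, rfl⟩

theorem ScaledSmooth.add {f g : Pt m q → E} (hf : ScaledSmooth f) (hg : ScaledSmooth g) :
    ScaledSmooth fun p => f p + g p :=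
  (hf.prodMk hg).comp (g := fun r : E × E => r.1 + r.2) (by fun_prop)

theorem ScaledSmooth.neg {f : Pt m q → E} (hf : ScaledSmooth f) : ScaledSmooth fun p => -f p :=
  hf.comp contDiff_neg

theorem ScaledSmooth.smul {f : Pt m q → ℝ} {g : Pt m q → E} (hf : ScaledSmooth f)
    (hg : ScaledSmooth g) : ScaledSmooth fun p => f p • g p :=
  (hf.prodMk hg).comp (g := fun r : ℝ × E => r.1 • r.2) (by fun_prop)

theorem ScaledSmooth.mul {f g : Pt m q → ℝ} (hf : ScaledSmooth f)
    (hg : ScaledSmooth g) : ScaledSmooth fun p => f p * g p := hf.smul hg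

theorem ScaledSmooth.pow {f : Pt m q → ℝ} (hf : ScaledSmooth f) (n : ℕ) :
    ScaledSmooth fun p => f p ^ n :=
  hf.comp (g := fun r => r ^ n) (by fun_prop)

theorem ScaledSmooth.sum {ι : Type*} {f : ι → Pt m q → E} {t : Finset ι}
    (hf : ∀ i ∈ t, ScaledSmooth (f i)) : ScaledSmooth fun p => ∑ i ∈ t, f i p := by
  classical
  induction t using Finset.induction_on with
  | empty => simpa using ScaledSmooth.const 0
  | insert a t ha ih =>
    simp only [Finset.sum_insert ha]
    exact (hf a (by simp)).add (ih fun i hi => hf i (by simp [hi]))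

theorem scaledSmooth_pi {ι : Type*} [Fintype ι] {f : Pt m q → ι → ℝ} :
    ScaledSmooth f ↔ ∀ i, ScaledSmooth fun p => f p i := by
  refine ⟨fun h i => h.comp (g := fun v : ι → ℝ => v i) (by fun_prop), fun h => ?_⟩
  choose F hF h using h
  exact ⟨fun r i => F i r, contDiff_pi.2 hF, fun x ϑ μ => funext fun i => h i x ϑ μ⟩

theorem ScaledSmooth.state (k : Fin (m + 1)) : ScaledSmooth fun p : Pt m q => p.1 k :=
  scaledSmooth_iff.2 ⟨fun r => r.1 k, by fun_prop, rfl⟩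

theorem ScaledSmooth.scaled (k : Fin (m + 1)) : ScaledSmooth fun p : Pt m q => p.2.2 * p.1 k :=
  scaledSmooth_iff.2 ⟨fun r => r.2.2 k, by fun_prop, rfl⟩

theorem ScaledSmooth.estimate : ScaledSmooth fun p : Pt m q => p.2.1 :=
  scaledSmooth_iff.2 ⟨fun r => r.2.1, by fun_prop, rfl⟩

theorem ScaledSmooth.of_state {f : State m → E} (hf : ContDiff ℝ ∞ f) :
    ScaledSmooth fun p : Pt m q => f p.1 :=
  scaledSmooth_iff.2 ⟨fun r => f r.1, by fun_prop, rfl⟩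

theorem ScaledSmooth.congr {f g : Pt m q → E} (hf : ScaledSmooth f) (h : ∀ p, g p = f p) :
    ScaledSmooth g := by
  rwa [show g = f from funext h]

end ScaledSmooth

/-! ### Partial derivatives and the factor `μ` -/

section Derivatives

/-- Varying the state also moves the third argument `μ x`, at rate `μ`. Hence `∂f/∂xⱼ` contains a
bare `μ` and need not be `ScaledSmooth`, and `∂f/∂μ` contains a bare `x`; the combinations below
pair the two into `μ x`. -/
theorem fderiv_comp_lift {F : State m × Par q × State m → ℝ} (hF : ContDiff ℝ ∞ F)
    (p v : Pt m q) :
    fderiv ℝ (F ∘ lift) p v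
      = fderiv ℝ F (lift p) (v.1, v.2.1, v.2.2 • p.1 + p.2.2 • v.1) := by
  have h1 : HasFDerivAt F (fderiv ℝ F (lift p)) (lift p) :=
    (hF.differentiable (by simp)).differentiableAt.hasFDerivAt
  have hl : HasFDerivAt (lift : Pt m q → _) ((ContinuousLinearMap.fst ℝ _ _).prod
      (((ContinuousLinearMap.fst ℝ _ _).comp (ContinuousLinearMap.snd ℝ _ _)).prod
        (p.2.2 • (ContinuousLinearMap.fst ℝ (State m) (Par q × ℝ)) +
          ((ContinuousLinearMap.snd ℝ _ _).comp
            (ContinuousLinearMap.snd ℝ (State m) (Par q × ℝ))).smulRight p.1))) p := by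
    have e1 : HasFDerivAt (fun p : Pt m q => p.1) (ContinuousLinearMap.fst ℝ _ _) p :=
      hasFDerivAt_fst
    have e2 : HasFDerivAt (fun p : Pt m q => p.2) (ContinuousLinearMap.snd ℝ _ _) p :=
      hasFDerivAt_snd
    have e3 : HasFDerivAt (fun p : Pt m q => p.2.2) ((ContinuousLinearMap.snd ℝ _ _).comp
        (ContinuousLinearMap.snd ℝ _ _)) p := hasFDerivAt_snd.comp p e2
    have e4 : HasFDerivAt (fun p : Pt m q => p.2.1) ((ContinuousLinearMap.fst ℝ _ _).comp
        (ContinuousLinearMap.snd ℝ _ _)) p := hasFDerivAt_fst.comp p e2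
    exact e1.prodMk (e4.prodMk (e3.smul e1))
  rw [(h1.comp p hl).fderiv]
  simp [add_comm]

theorem ScaledSmooth.fderiv_estimate {f : Pt m q → ℝ} (hf : ScaledSmooth f)
    {v : Pt m q → Par q} (hv : ScaledSmooth v) : ScaledSmooth fun p => dtheta f p (v p) := by
  obtain ⟨F, hF, rfl⟩ := scaledSmooth_iff.1 hf
  obtain ⟨V, hV, rfl⟩ := scaledSmooth_iff.1 hv
  refine scaledSmooth_iff.2 ⟨fun r => fderiv ℝ F r (0, V r, 0), ?_, funext fun p => ?_⟩
  · exact (hF.fderiv_right (m := ∞) (by simp)).clm_apply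
      (contDiff_const.prodMk (hV.prodMk contDiff_const))
  · simp [dtheta, fderiv_comp_lift hF]

/-- The coordinate `xₖ` absorbs the factor `μ` of the chain rule, since `μ xₖ` is an admissible
argument. -/
theorem ScaledSmooth.dx_mul_state {f : Pt m q → ℝ} (hf : ScaledSmooth f) (j k : Fin (m + 1)) :
    ScaledSmooth fun p => dx f j p * p.1 k := by
  obtain ⟨F, hF, rfl⟩ := scaledSmooth_iff.1 hf
  refine scaledSmooth_iff.2 ⟨fun r => fderiv ℝ F r (Pi.single j 1, 0, 0) * r.1 k
    + fderiv ℝ F r (0, 0, Pi.single j 1) * r.2.2 k, ?_, funext fun p => ?_⟩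
  · have hD := hF.fderiv_right (m := ∞) (by simp)
    refine ContDiff.add (ContDiff.mul (hD.clm_apply contDiff_const) (by fun_prop))
      (ContDiff.mul (hD.clm_apply contDiff_const) (by fun_prop))
  · have : ((Pi.single j 1, 0, p.2.2 • Pi.single j 1) : State m × Par q × State m)
        = (Pi.single j 1, 0, 0) + p.2.2 • (0, 0, Pi.single j 1) := by simp
    simp only [dx, fderiv_comp_lift hF, zero_smul, zero_add, Function.comp_apply]
    rw [this, map_add, map_smul]
    simp [lift]
    ring

theorem ScaledSmooth.mul_dmu {f : Pt m q → ℝ} (hf : ScaledSmooth f) :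
    ScaledSmooth fun p => p.2.2 * dmu f p := by
  obtain ⟨F, hF, rfl⟩ := scaledSmooth_iff.1 hf
  refine scaledSmooth_iff.2 ⟨fun r => fderiv ℝ F r (0, 0, r.2.2), ?_, funext fun p => ?_⟩
  · exact (hF.fderiv_right (m := ∞) (by simp)).clm_apply
      (contDiff_const.prodMk (contDiff_const.prodMk (by fun_prop)))
  · simp only [dmu, fderiv_comp_lift hF, Function.comp_apply]
    rw [← smul_eq_mul, ← map_smul]
    simp [lift]

end Derivatives

/-- A function of `(x, ϑ, μ)` that is linear in `x` up to coefficients that are smooth functions of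
`(x, ϑ, μ x)`. -/
def ScaledVanishing (f : Pt m q → ℝ) : Prop :=
  ∃ G : Fin (m + 1) → Pt m q → ℝ, (∀ k, ScaledSmooth (G k)) ∧ ∀ p, f p = ∑ k, G k p * p.1 k

/-! ### Functions that are linear in the state up to such coefficients -/

section ScaledVanishing

variable {f g : Pt m q → ℝ}

theorem ScaledVanishing.congr (hf : ScaledVanishing f) (h : ∀ p, g p = f p) :
    ScaledVanishing g := by
  rwa [show g = f from funext h]

theorem ScaledVanishing.scaledSmooth (hf : ScaledVanishing f) : ScaledSmooth f := by
  obtain ⟨G, hG, h⟩ := hf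
  exact (ScaledSmooth.sum fun k _ => (hG k).mul (.state k)).congr h

theorem ScaledVanishing.scaled (hf : ScaledVanishing f) : ScaledSmooth fun p => p.2.2 * f p := by
  obtain ⟨G, hG, h⟩ := hf
  refine (ScaledSmooth.sum (t := Finset.univ) fun k _ => (hG k).mul (.scaled k)).congr fun p => ?_
  rw [h, Finset.mul_sum]
  exact Finset.sum_congr rfl fun k _ => by ring

theorem ScaledVanishing.zero : ScaledVanishing fun _ : Pt m q => (0 : ℝ) :=
  ⟨fun _ _ => 0, fun _ => .const 0, by simp⟩

theorem ScaledVanishing.add (hf : ScaledVanishing f) (hg : ScaledVanishing g) :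
    ScaledVanishing fun p => f p + g p := by
  obtain ⟨G, hG, h⟩ := hf
  obtain ⟨G', hG', h'⟩ := hg
  exact ⟨fun k p => G k p + G' k p, fun k => (hG k).add (hG' k), fun p => by
    simp [h, h', add_mul, Finset.sum_add_distrib]⟩

theorem ScaledVanishing.mul (hf : ScaledSmooth f) (hg : ScaledVanishing g) :
    ScaledVanishing fun p => f p * g p := by
  obtain ⟨G, hG, h⟩ := hg
  refine ⟨fun k p => f p * G k p, fun k => hf.mul (hG k), fun p => ?_⟩
  simp only [h, Finset.mul_sum]
  exact Finset.sum_congr rfl fun k _ => by ring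

theorem ScaledVanishing.neg (hf : ScaledVanishing f) : ScaledVanishing fun p => -f p :=
  (ScaledVanishing.mul (.const (-1)) hf).congr fun p => by ring

theorem ScaledVanishing.sub (hf : ScaledVanishing f) (hg : ScaledVanishing g) :
    ScaledVanishing fun p => f p - g p :=
  (hf.add hg.neg).congr fun p => by ring

theorem ScaledVanishing.sum {ι : Type*} {f : ι → Pt m q → ℝ} {t : Finset ι}
    (hf : ∀ i ∈ t, ScaledVanishing (f i)) : ScaledVanishing fun p => ∑ i ∈ t, f i p := by
  classical
  induction t using Finset.induction_on with
  | empty => simpa using ScaledVanishing.zero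
  | insert a t ha ih =>
    simp only [Finset.sum_insert ha]
    exact (hf a (by simp)).add (ih fun i hi => hf i (by simp [hi]))

theorem ScaledVanishing.state (k : Fin (m + 1)) : ScaledVanishing fun p : Pt m q => p.1 k :=
  ⟨fun j _ => if j = k then 1 else 0, fun _ => .const _, fun p => by simp⟩

theorem ScaledVanishing.contDiff (hf : ScaledVanishing f) : ContDiff ℝ ∞ f :=
  hf.scaledSmooth.contDiff

theorem hasFDerivAt_of_eq_sum {G : Fin (m + 1) → Pt m q → ℝ} (hG : ∀ k, ScaledSmooth (G k))
    (h : ∀ p, f p = ∑ k, G k p * p.1 k) (p : Pt m q) :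
    HasFDerivAt f (∑ k, (G k p • (ContinuousLinearMap.proj k).comp
      (ContinuousLinearMap.fst ℝ (State m) (Par q × ℝ)) + p.1 k • fderiv ℝ (G k) p)) p := by
  rw [show f = fun p => ∑ k, G k p * p.1 k from funext h]
  refine HasFDerivAt.fun_sum fun k _ => HasFDerivAt.mul ?_ ?_
  · exact ((hG k).contDiff.differentiable (by simp)).differentiableAt.hasFDerivAt
  · exact ((ContinuousLinearMap.proj k).comp
      (ContinuousLinearMap.fst ℝ (State m) (Par q × ℝ))).hasFDerivAt

/-- By the Leibniz rule, `∂ⱼ ∑ Gₖ xₖ = Gⱼ + ∑ (∂ⱼ Gₖ) xₖ`, and in the sum each derivative comes with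
a coordinate that absorbs its `μ`. This is the reason to carry linearity in `x` through the
recursion. -/
theorem ScaledVanishing.dx (hf : ScaledVanishing f) (j : Fin (m + 1)) :
    ScaledSmooth (dx f j) := by
  obtain ⟨G, hG, h⟩ := hf
  refine ((ScaledSmooth.sum (t := Finset.univ) fun k _ =>
    (hG k).dx_mul_state j k).add (hG j)).congr fun p => ?_
  have hd := hasFDerivAt_of_eq_sum hG h p
  unfold Backstepping.dx
  rw [hd.fderiv]
  simp [Finset.sum_add_distrib, Pi.single_apply, mul_comm]
  ring

theorem ScaledVanishing.dtheta (hf : ScaledVanishing f) {v : Pt m q → Par q}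
    (hv : ScaledSmooth v) : ScaledVanishing fun p => dtheta f p (v p) := by
  obtain ⟨G, hG, h⟩ := hf
  refine ⟨fun k p => Backstepping.dtheta (G k) p (v p), fun k => (hG k).fderiv_estimate hv,
    fun p => ?_⟩
  have hd := hasFDerivAt_of_eq_sum hG h p
  simp only [Backstepping.dtheta, hd.fderiv]
  simp [mul_comm]

theorem ScaledVanishing.mul_dmu (hf : ScaledVanishing f) :
    ScaledVanishing fun p => p.2.2 * dmu f p := by
  obtain ⟨G, hG, h⟩ := hf
  refine ⟨fun k p => p.2.2 * dmu (G k) p, fun k => (hG k).mul_dmu, fun p => ?_⟩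
  have hd := hasFDerivAt_of_eq_sum hG h p
  simp only [dmu, hd.fderiv]
  simp [Finset.mul_sum]
  exact Finset.sum_congr rfl fun k _ => by ring

/-- A smooth function of the state that vanishes at the origin is linear in the state up to smooth
coefficients. -/
theorem ScaledVanishing.of_state {f : State m → ℝ} (hf : ContDiff ℝ ∞ f) (h0 : f 0 = 0) :
    ScaledVanishing fun p : Pt m q => f p.1 := by
  have hD : ContDiff ℝ ∞ (fderiv ℝ f) := hf.fderiv_right (by simp)
  -- Hadamard's lemma: integrate the derivative of `f` along the segment from `0` to `x`.
  refine ⟨fun k p => ∫ t in (0 : ℝ)..1, fderiv ℝ f (t • p.1) (Pi.single k 1), fun k => ?_,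
    fun p => ?_⟩
  · refine ScaledSmooth.of_state (f := fun x : State m =>
      ∫ t in (0 : ℝ)..1, fderiv ℝ f (t • x) (Pi.single k 1)) ?_
    refine contDiff_infty.2 fun n => contDiff_intervalIntegral n
      (H := fun r : State m × ℝ => fderiv ℝ f (r.2 • r.1) (Pi.single k 1)) ?_
    exact ((hD.comp (g := fderiv ℝ f) (f := fun r : State m × ℝ => r.2 • r.1)
      (by fun_prop)).clm_apply contDiff_const).of_le (by exact_mod_cast le_top)
  · have hcont : ∀ v, Continuous fun t : ℝ => fderiv ℝ f (t • p.1) v := fun v =>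
      (hD.continuous.comp (by fun_prop : Continuous fun t : ℝ => t • p.1)).clm_apply
        continuous_const
    have hd : ∀ t ∈ Set.uIcc (0 : ℝ) 1,
        HasDerivAt (fun t : ℝ => f (t • p.1)) (fderiv ℝ f (t • p.1) p.1) t := by
      intro t _
      have h1 : HasFDerivAt f (fderiv ℝ f (t • p.1)) (t • p.1) :=
        (hf.differentiable (by simp)).differentiableAt.hasFDerivAt
      have h2 : HasDerivAt (fun t : ℝ => t • p.1) p.1 t := by
        simpa using (hasDerivAt_id t).smul_const p.1
      exact h1.comp_hasDerivAt t h2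
    have hint := intervalIntegral.integral_eq_sub_of_hasDerivAt hd
      ((hcont p.1).intervalIntegrable 0 1)
    simp only [one_smul, zero_smul, h0, sub_zero] at hint
    beta_reduce
    rw [← hint]
    have hsum : ∀ t : ℝ, fderiv ℝ f (t • p.1) p.1
        = ∑ k, fderiv ℝ f (t • p.1) (Pi.single k 1) * p.1 k := by
      intro t
      have hv : fderiv ℝ f (t • p.1) p.1
          = fderiv ℝ f (t • p.1) (∑ k, p.1 k • Pi.single k 1) := by rw [← pi_eq_sum_univ']
      rw [hv, map_sum]
      refine Finset.sum_congr rfl fun k _ => ?_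
      rw [map_smul, smul_eq_mul, mul_comm]
    simp only [hsum]
    rw [intervalIntegral.integral_finsetSum]
    · simp
    · exact fun k _ => ((hcont _).mul continuous_const).intervalIntegrable 0 1

end ScaledVanishing

/-! ### Dependence on the leading coordinates -/

section Dependence

variable {β : Type*}

/-- A map of `(x, ϑ, μ)` depends on `x` only through the coordinates in `I`. -/
def StateDependsOn (f : Pt m q → β) (I : Set (Fin (m + 1))) : Prop :=
  ∀ ⦃x y : State m⦄ (ϑ : Par q) (μ : ℝ), (∀ i ∈ I, x i = y i) → f (x, ϑ, μ) = f (y, ϑ, μ)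

theorem StateDependsOn.mono {f : Pt m q → β} {I J : Set (Fin (m + 1))} (hf : StateDependsOn f I)
    (hIJ : I ⊆ J) : StateDependsOn f J :=
  fun _ _ ϑ μ h => hf ϑ μ fun i hi => h i (hIJ hi)

/-- Translating `f` by two base points that agree on `I` gives the same function, and the derivative
at a base point is that of the translate at `0`. -/
theorem StateDependsOn.fderiv {f : Pt m q → ℝ} {I : Set (Fin (m + 1))} (hf : StateDependsOn f I) :
    StateDependsOn (fderiv ℝ f) I := by
  intro x y ϑ μ h
  have e : (fun p => f (p + (x, ϑ, μ))) = fun p => f (p + (y, ϑ, μ)) := by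
    funext p
    obtain ⟨x', ϑ', μ'⟩ := p
    exact hf _ _ fun i hi => by simp [h i hi]
  have h1 := fderiv_comp_add_right (𝕜 := ℝ) (f := f) (x := 0) (x, ϑ, μ)
  have h2 := fderiv_comp_add_right (𝕜 := ℝ) (f := f) (x := 0) (y, ϑ, μ)
  rw [zero_add] at h1 h2
  rw [← h1, ← h2, e]

theorem StateDependsOn.dx_eq_zero {f : Pt m q → ℝ} {I : Set (Fin (m + 1))}
    (hf : StateDependsOn f I) (hd : Differentiable ℝ f) {j : Fin (m + 1)} (hj : j ∉ I)
    (p : Pt m q) : dx f j p = 0 := by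
  have h1 : HasDerivAt (fun t : ℝ => p + t • ((Pi.single j 1, 0, 0) : Pt m q))
      (Pi.single j 1, 0, 0) 0 := by
    simpa using ((hasDerivAt_id (0 : ℝ)).smul_const ((Pi.single j 1, 0, 0) : Pt m q)).const_add p
  have h2 := (hd (p + (0 : ℝ) • ((Pi.single j 1, 0, 0) : Pt m q))).hasFDerivAt.comp_hasDerivAt
    (0 : ℝ) h1
  have h3 : (f ∘ fun t : ℝ => p + t • ((Pi.single j 1, 0, 0) : Pt m q)) = fun _ => f p := by
    funext t
    obtain ⟨x, ϑ, μ⟩ := p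
    simp only [Function.comp_apply, Prod.smul_mk, smul_zero, Prod.mk_add_mk, add_zero]
    refine hf _ _ fun i hi => ?_
    have : i ≠ j := fun h => hj (h ▸ hi)
    simp [this]
  rw [h3, zero_smul, add_zero] at h2
  exact (h2.unique (hasDerivAt_const _ _))

/-- The projection that sets the coordinates outside `I` to zero. -/
noncomputable def restrict (I : Finset (Fin (m + 1))) (x : State m) : State m :=
  fun k => if k ∈ I then x k else 0

theorem contDiff_restrict (I : Finset (Fin (m + 1))) :
    ContDiff ℝ ∞ (restrict I : State m → State m) := by
  refine contDiff_pi.2 fun k => ?_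
  by_cases hk : k ∈ I
  · simpa [restrict, hk] using contDiff_apply ℝ ℝ k
  · simpa [restrict, hk] using contDiff_const

theorem restrict_smul (I : Finset (Fin (m + 1))) (c : ℝ) (x : State m) :
    restrict I (c • x) = c • restrict I x := by
  funext k
  by_cases hk : k ∈ I <;> simp [restrict, hk]

theorem restrict_congr {I : Finset (Fin (m + 1))} {x y : State m} (h : ∀ i ∈ I, x i = y i) :
    restrict I x = restrict I y := by
  funext k
  by_cases hk : k ∈ I
  · simp [restrict, hk, h k hk]
  · simp [restrict, hk]

theorem StateDependsOn.eq_restrict {f : Pt m q → β} {I : Finset (Fin (m + 1))}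
    (hf : StateDependsOn f I) (p : Pt m q) : f p = f (restrict I p.1, p.2) :=
  hf p.2.1 p.2.2 fun i hi => by simp [restrict, Finset.mem_coe.1 hi]

theorem ScaledSmooth.restrict {E : Type*} [NormedAddCommGroup E] [NormedSpace ℝ E] {f : Pt m q → E}
    (hf : ScaledSmooth f) (I : Finset (Fin (m + 1))) :
    ScaledSmooth fun p => f (restrict I p.1, p.2) := by
  obtain ⟨F, hF, h⟩ := hf
  refine ⟨fun r => F (Backstepping.restrict I r.1, r.2.1, Backstepping.restrict I r.2.2), ?_,
    fun x ϑ μ => ?_⟩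
  · have := contDiff_restrict I
    fun_prop
  · simp only [restrict_smul]
    exact h _ _ _

/-- Inserting the projection to the coordinates in `I` leaves `f` unchanged and removes the terms
outside `I`. As the projection commutes with scaling, the coefficients remain smooth in `(x, θ̂, μ
x)`. -/
theorem ScaledVanishing.exists_eq_sum {f : Pt m q → ℝ} {I : Finset (Fin (m + 1))}
    (hf : ScaledVanishing f) (hI : StateDependsOn f I) :
    ∃ G : Fin (m + 1) → Pt m q → ℝ, (∀ k, ScaledSmooth (G k)) ∧ (∀ k, StateDependsOn (G k) I) ∧
      ∀ p, f p = ∑ k ∈ I, G k p * p.1 k := by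
  obtain ⟨G, hG, h⟩ := hf
  refine ⟨fun k p => G k (Backstepping.restrict I p.1, p.2), fun k => (hG k).restrict I, ?_, ?_⟩
  · intro k x y ϑ μ hxy
    simp only
    rw [restrict_congr hxy]
  · intro p
    rw [hI.eq_restrict p, h, ← Finset.sum_subset (Finset.subset_univ I)]
    · exact Finset.sum_congr rfl fun k hk => by simp [Backstepping.restrict, hk]
    · intro k _ hk
      simp [Backstepping.restrict, hk]

end Dependence

/-! ### Regularity of the signals of the design -/

section Recursion

variable {P : Params m q} {φ : Fin (m + 1) → State m → Par q}
  {a : Fin (m + 1) → Pt m q → ℝ}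
  {W : Fin (m + 1) → Pt m q → Matrix (Fin (m + 1)) (Fin q) ℝ}

theorem zPrev_zero (p : Pt m q) : zPrev a 0 p = 0 := rfl

theorem zPrev_succ (j : Fin m) (p : Pt m q) : zPrev a j.succ p = z a j.castSucc p := rfl

/-- The regularity of a reference signal: it is linear in the state up to smooth coefficients and
depends only on the preceding coordinates. -/
structure IsReference (i : Fin (m + 1)) (f : Pt m q → ℝ) : Prop where
  vanishing : ScaledVanishing f
  dependsOn : StateDependsOn f (Set.Iio i)

theorem scaledVanishing_z {i : Fin (m + 1)} (ha : IsReference i (a i)) :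
    ScaledVanishing (z a i) :=
  (ScaledVanishing.state i).sub ha.vanishing

theorem stateDependsOn_z {i : Fin (m + 1)} (ha : IsReference i (a i)) :
    StateDependsOn (z a i) (Set.Iic i) := by
  intro x y ϑ μ h
  simp only [z]
  rw [h i Set.self_mem_Iic, ha.dependsOn ϑ μ fun j hj => h j (Set.Iio_subset_Iic_self hj)]

theorem scaledVanishing_zPrev {i : Fin (m + 1)} (ha : ∀ j ≤ i, IsReference j (a j)) :
    ScaledVanishing (zPrev a i) := by
  cases i using Fin.cases with
  | zero => exact ScaledVanishing.zero
  | succ j => exact scaledVanishing_z (ha _ j.castSucc_lt_succ.le)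

theorem stateDependsOn_zPrev {i : Fin (m + 1)} (ha : ∀ j ≤ i, IsReference j (a j)) :
    StateDependsOn (zPrev a i) (Set.Iic i) := by
  cases i using Fin.cases with
  | zero => exact fun _ _ _ _ _ => rfl
  | succ j =>
    exact (stateDependsOn_z (ha _ j.castSucc_lt_succ.le)).mono
      (Set.Iic_subset_Iic.2 j.castSucc_lt_succ.le)

theorem scaledSmooth_s {i : Fin (m + 1)} (ha : IsReference i (a i)) : ScaledSmooth (s a i) :=
  (scaledVanishing_z ha).scaled

theorem stateDependsOn_s {i : Fin (m + 1)} (ha : IsReference i (a i)) :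
    StateDependsOn (s a i) (Set.Iic i) := by
  intro x y ϑ μ h
  simp only [s, stateDependsOn_z ha ϑ μ h]

theorem scaledVanishing_w (hφ_smooth : ∀ i, ContDiff ℝ ∞ (φ i)) (hφ_zero : ∀ i, φ i 0 = 0)
    {i : Fin (m + 1)} (ha : IsReference i (a i)) (c : Fin q) :
    ScaledVanishing fun p => w φ a i p c := by
  have hφ : ∀ j, ScaledVanishing fun p : Pt m q => φ j p.1 c := fun j =>
    ScaledVanishing.of_state (contDiff_pi.1 (hφ_smooth j) c) (by simp [hφ_zero])
  refine ((hφ i).sub (ScaledVanishing.sum (t := Finset.Iio i) fun j _ =>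
    ScaledVanishing.mul (ha.vanishing.dx j) (hφ j))).congr fun p => ?_
  simp [w]

theorem stateDependsOn_w (hφ_dep : ∀ i, DependsOn (φ i) (Set.Iic i))
    {i : Fin (m + 1)} (ha : IsReference i (a i)) : StateDependsOn (w φ a i) (Set.Iic i) := by
  intro x y ϑ μ h
  have hd := ha.dependsOn.fderiv ϑ μ fun j hj => h j (Set.Iio_subset_Iic_self hj)
  simp only [w, dx, hd, hφ_dep i h]
  congr 1
  refine Finset.sum_congr rfl fun j hj => ?_
  rw [hφ_dep j fun k hk => h k (hk.trans (Finset.mem_Iio.1 hj).le)]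

/-- In `μ sⱼ wⱼ = (μ zⱼ)(μ wⱼ)` there is one factor `μ` for each of two factors that are linear in
the state. -/
theorem scaledSmooth_tau (hφ_smooth : ∀ i, ContDiff ℝ ∞ (φ i)) (hφ_zero : ∀ i, φ i 0 = 0)
    {i : Fin (m + 1)} (ha : ∀ j ≤ i, IsReference j (a j)) : ScaledSmooth (tau φ a i) := by
  refine scaledSmooth_pi.2 fun c => ?_
  refine (ScaledSmooth.sum (t := Finset.Iic i) fun j hj =>
    (scaledSmooth_s (ha j (Finset.mem_Iic.1 hj))).mul
      (scaledVanishing_w hφ_smooth hφ_zero (ha j (Finset.mem_Iic.1 hj)) c).scaled).congr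
    fun p => ?_
  simp only [tau, Finset.sum_apply, Pi.smul_apply, smul_eq_mul]
  exact Finset.sum_congr rfl fun j _ => by ring

theorem stateDependsOn_tau (hφ_dep : ∀ i, DependsOn (φ i) (Set.Iic i))
    {i : Fin (m + 1)} (ha : ∀ j ≤ i, IsReference j (a j)) :
    StateDependsOn (tau φ a i) (Set.Iic i) := by
  intro x y ϑ μ h
  refine Finset.sum_congr rfl fun j hj => ?_
  have hj' := Finset.mem_Iic.1 hj
  rw [stateDependsOn_s (ha j hj') ϑ μ fun k hk => h k (le_trans hk hj'),
    stateDependsOn_w hφ_dep (ha j hj') ϑ μ fun k hk => h k (le_trans hk hj')]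

theorem ScaledSmooth.mulVec {v : Pt m q → Par q} (hv : ScaledSmooth v)
    (A : Matrix (Fin q) (Fin q) ℝ) : ScaledSmooth fun p => A *ᵥ v p :=
  hv.comp (g := fun u => A *ᵥ u) (by
    refine contDiff_pi.2 fun i => ?_
    simp only [Matrix.mulVec, dotProduct]
    fun_prop)

theorem scaledVanishing_dotProduct {u v : Pt m q → Par q} (hu : ∀ c, ScaledVanishing fun p => u p c)
    (hv : ScaledSmooth v) : ScaledVanishing fun p => u p ⬝ᵥ v p :=
  (ScaledVanishing.sum (t := Finset.univ) fun c _ =>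
    ScaledVanishing.mul (scaledSmooth_pi.1 hv c) (hu c)).congr fun p => by
      simp [dotProduct, mul_comm]

theorem scaledVanishing_crossTerm (hφ_smooth : ∀ i, ContDiff ℝ ∞ (φ i)) (hφ_zero : ∀ i, φ i 0 = 0)
    {i : Fin (m + 1)} (ha : ∀ j ≤ i, IsReference j (a j)) :
    ScaledVanishing (crossTerm P φ a i) := by
  refine (ScaledVanishing.sum (t := Finset.Iio i)
    (f := fun j p => dtheta (a j) p (P.Gam *ᵥ ((p.2.2 * s a j p) • w φ a i p))) fun j hj =>
    (ha j (Finset.mem_Iio.1 hj).le).vanishing.dtheta (ScaledSmooth.mulVec ?_ P.Gam))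
  refine scaledSmooth_pi.2 fun c => ?_
  refine ((scaledSmooth_s (ha j (Finset.mem_Iio.1 hj).le)).mul
    (scaledVanishing_w hφ_smooth hφ_zero (ha i le_rfl) c).scaled).congr fun p => ?_
  simp only [Pi.smul_apply, smul_eq_mul]
  ring

theorem stateDependsOn_crossTerm (hφ_dep : ∀ i, DependsOn (φ i) (Set.Iic i))
    {i : Fin (m + 1)} (ha : ∀ j ≤ i, IsReference j (a j)) :
    StateDependsOn (crossTerm P φ a i) (Set.Iic i) := by
  intro x y ϑ μ h
  refine Finset.sum_congr rfl fun j hj => ?_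
  have hj' := (Finset.mem_Iio.1 hj).le
  simp only [dtheta]
  rw [stateDependsOn_s (ha j hj') ϑ μ fun k hk => h k (le_trans hk hj'),
    stateDependsOn_w hφ_dep (ha i le_rfl) ϑ μ h,
    (ha j hj').dependsOn.fderiv ϑ μ fun k hk => h k ((le_of_lt hk).trans hj')]

theorem scaledVanishing_chainTerm {i : Fin (m + 1)} (ha : IsReference i (a i)) :
    ScaledVanishing (chainTerm a i) := by
  refine (ScaledVanishing.sum (t := Finset.univ) (f := fun (j : Fin m) (p : Pt m q) =>
    if j.castSucc < i then dx (a i) j.castSucc p * p.1 j.succ else 0) fun j _ => ?_)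
  split_ifs
  · exact ScaledVanishing.mul (ha.vanishing.dx _) (.state _)
  · exact .zero

theorem stateDependsOn_chainTerm {i : Fin (m + 1)} (ha : IsReference i (a i)) :
    StateDependsOn (chainTerm a i) (Set.Iic i) := by
  intro x y ϑ μ h
  refine Finset.sum_congr rfl fun j _ => ?_
  split_ifs with hj
  · simp only [dx]
    rw [h j.succ (Fin.castSucc_lt_iff_succ_le.1 hj),
      ha.dependsOn.fderiv ϑ μ fun k hk => h k (Set.Iio_subset_Iic_self hk)]
  · rfl

theorem scaledSmooth_frobSq {i : Fin (m + 1)}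
    (hW : ∀ (j : Fin (m + 1)) (c : Fin q), ScaledSmooth fun p : Pt m q => W i p j c) :
    ScaledSmooth (frobSq W i) :=
  ScaledSmooth.sum fun j _ => ScaledSmooth.sum fun c _ => (hW j c).pow 2

theorem scaledVanishing_mul_dmu {f : Pt m q → ℝ} (hf : ScaledVanishing f) (c : ℝ) :
    ScaledVanishing fun p => dmu f p * (c * p.2.2) :=
  (ScaledVanishing.mul (.const c) hf.mul_dmu).congr fun p => by ring

/-- A virtual control is an admissible reference signal for the next coordinate. -/
theorem isReference_virtualControl (hφ_smooth : ∀ i, ContDiff ℝ ∞ (φ i))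
    (hφ_dep : ∀ i, DependsOn (φ i) (Set.Iic i)) (hφ_zero : ∀ i, φ i 0 = 0) {i : Fin m}
    (ha : ∀ j ≤ i.castSucc, IsReference j (a j))
    (hW : ∀ (j : Fin (m + 1)) (c : Fin q), ScaledSmooth fun p : Pt m q => W i.castSucc p j c)
    (hWd : StateDependsOn (W i.castSucc) (Set.Iic i.castSucc)) :
    IsReference i.succ (virtualControl P φ a W i.castSucc) := by
  have hi := ha _ le_rfl
  constructor
  · refine ScaledVanishing.add (ScaledVanishing.add (ScaledVanishing.add (ScaledVanishing.add
      (ScaledVanishing.sub (ScaledVanishing.sub (ScaledVanishing.mul ?_ (scaledVanishing_z hi))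
      (scaledVanishing_zPrev ha)) (scaledVanishing_dotProduct
      (scaledVanishing_w hφ_smooth hφ_zero hi) .estimate))
      (hi.vanishing.dtheta ((scaledSmooth_tau hφ_smooth hφ_zero ha).mulVec _)))
      (scaledVanishing_crossTerm hφ_smooth hφ_zero ha)) (scaledVanishing_chainTerm hi))
      (scaledVanishing_mul_dmu hi.vanishing _)
    refine ((ScaledSmooth.const _).add ((ScaledSmooth.const _).add ((ScaledSmooth.const _).mul
      (ScaledSmooth.add (.const _) ((ScaledSmooth.const _).mul (scaledSmooth_frobSq hW)))))).neg
  · have hset : (Set.Iio i.succ : Set (Fin (m + 1))) = Set.Iic i.castSucc := by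
      ext j
      simp only [Set.mem_Iio, Set.mem_Iic]
      exact Fin.le_castSucc_iff.symm
    rw [hset]
    intro x y ϑ μ h
    have hd := hi.dependsOn.fderiv ϑ μ fun j hj => h j (Set.Iio_subset_Iic_self hj)
    have hz : zeta P W i.castSucc (x, ϑ, μ) = zeta P W i.castSucc (y, ϑ, μ) := by
      simp only [zeta, frobSq, hWd ϑ μ h]
    simp only [virtualControl, dtheta, dmu]
    rw [hz, hd, stateDependsOn_z hi ϑ μ h, stateDependsOn_zPrev ha ϑ μ h,
      stateDependsOn_w hφ_dep hi ϑ μ h, stateDependsOn_tau hφ_dep ha ϑ μ h,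
      stateDependsOn_crossTerm hφ_dep ha ϑ μ h, stateDependsOn_chainTerm hi ϑ μ h]

theorem scaledVanishing_psi (hφ_smooth : ∀ i, ContDiff ℝ ∞ (φ i)) (hφ_zero : ∀ i, φ i 0 = 0)
    (ha : ∀ j, IsReference j (a j)) : ScaledVanishing (psi P φ a) := by
  have hi := ha (Fin.last m)
  have ha' : ∀ j ≤ Fin.last m, IsReference j (a j) := fun j _ => ha j
  exact ScaledVanishing.sub (ScaledVanishing.sub (ScaledVanishing.sub (ScaledVanishing.sub
    (ScaledVanishing.add (scaledVanishing_zPrev ha') (scaledVanishing_dotProduct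
      (scaledVanishing_w hφ_smooth hφ_zero hi) .estimate)) (scaledVanishing_chainTerm hi))
      (hi.vanishing.dtheta ((scaledSmooth_tau hφ_smooth hφ_zero ha').mulVec _)))
      (scaledVanishing_mul_dmu hi.vanishing _)) (scaledVanishing_crossTerm hφ_smooth hφ_zero ha')

theorem isReference_zero (i : Fin (m + 1)) : IsReference i (0 : Pt m q → ℝ) :=
  ⟨ScaledVanishing.zero, fun _ _ _ _ _ => rfl⟩

/-- Strong induction along the recursion; it covers every admissible choice of the matrices, not
only the one constructed for existence. -/
theorem Design.isReference (hφ_smooth : ∀ i, ContDiff ℝ ∞ (φ i))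
    (hφ_dep : ∀ i, DependsOn (φ i) (Set.Iic i)) (hφ_zero : ∀ i, φ i 0 = 0) (D : Design P φ)
    (i : Fin (m + 1)) : IsReference i (D.a i) := by
  induction i using WellFoundedLT.induction with
  | ind i ih =>
    cases i using Fin.cases with
    | zero => rw [D.a_zero]; exact isReference_zero 0
    | succ i =>
      rw [show D.a i.succ = _ from funext (D.a_succ i)]
      exact isReference_virtualControl hφ_smooth hφ_dep hφ_zero
        (fun j hj => ih j (hj.trans_lt i.castSucc_lt_succ)) (fun j c => D.W_smooth _ j c)
        fun x y ϑ μ h => D.W_dependsOn _ ϑ μ h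

end Recursion

/-! ### Inverting the triangular change to error coordinates -/

section ErrorCoordinates

variable {a : Fin (m + 1) → Pt m q → ℝ}

/-- `f` is a linear combination of `z₁, …, zᵢ` with coefficients that are smooth functions of
`(x, ϑ, μ x)` and depend only on `x₁, …, xᵢ`. -/
def InErrorSpan (a : Fin (m + 1) → Pt m q → ℝ) (i : Fin (m + 1)) (f : Pt m q → ℝ) : Prop :=
  ∃ c : Fin (m + 1) → Pt m q → ℝ, (∀ j, ScaledSmooth (c j)) ∧
    (∀ j, StateDependsOn (c j) (Set.Iic i)) ∧ ∀ p, f p = ∑ j ∈ Finset.Iic i, c j p * z a j p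

theorem InErrorSpan.mono {i k : Fin (m + 1)} (hik : i ≤ k) {f : Pt m q → ℝ}
    (hf : InErrorSpan a i f) : InErrorSpan a k f := by
  obtain ⟨c, hc, hcd, h⟩ := hf
  refine ⟨fun j p => if j ≤ i then c j p else 0, fun j => ?_, fun j => ?_, fun p => ?_⟩
  · by_cases hj : j ≤ i
    · simpa [hj] using hc j
    · simpa [hj] using ScaledSmooth.const 0
  · intro x y ϑ μ hxy
    simp only
    rw [hcd j ϑ μ fun l hl => hxy l (le_trans hl hik)]
  · rw [h, ← Finset.sum_subset (Finset.Iic_subset_Iic.2 hik)]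
    · exact Finset.sum_congr rfl fun j hj => by simp [Finset.mem_Iic.1 hj]
    · intro j _ hj
      simp [show ¬ j ≤ i from fun h => hj (Finset.mem_Iic.2 h)]

theorem InErrorSpan.zero (i : Fin (m + 1)) : InErrorSpan a i fun _ => 0 :=
  ⟨fun _ _ => 0, fun _ => .const 0, fun _ _ _ _ _ _ => rfl, by simp⟩

theorem InErrorSpan.add {i : Fin (m + 1)} {f g : Pt m q → ℝ} (hf : InErrorSpan a i f)
    (hg : InErrorSpan a i g) : InErrorSpan a i fun p => f p + g p := by
  obtain ⟨c, hc, hcd, h⟩ := hf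
  obtain ⟨c', hc', hcd', h'⟩ := hg
  refine ⟨fun j p => c j p + c' j p, fun j => (hc j).add (hc' j), fun j x y ϑ μ hxy => ?_,
    fun p => ?_⟩
  · simp only [hcd j ϑ μ hxy, hcd' j ϑ μ hxy]
  · simp [h, h', add_mul, Finset.sum_add_distrib]

theorem InErrorSpan.mul {i : Fin (m + 1)} {f g : Pt m q → ℝ} (hg : ScaledSmooth g)
    (hgd : StateDependsOn g (Set.Iic i)) (hf : InErrorSpan a i f) :
    InErrorSpan a i fun p => g p * f p := by
  obtain ⟨c, hc, hcd, h⟩ := hf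
  refine ⟨fun j p => g p * c j p, fun j => hg.mul (hc j), fun j x y ϑ μ hxy => ?_, fun p => ?_⟩
  · simp only [hcd j ϑ μ hxy, hgd ϑ μ hxy]
  · simp only [h, Finset.mul_sum, mul_assoc]

theorem InErrorSpan.sum {i : Fin (m + 1)} {ι : Type*} {f : ι → Pt m q → ℝ} {t : Finset ι}
    (hf : ∀ k ∈ t, InErrorSpan a i (f k)) : InErrorSpan a i fun p => ∑ k ∈ t, f k p := by
  classical
  induction t using Finset.induction_on with
  | empty => simpa using InErrorSpan.zero i
  | insert b t hb ih =>
    simp only [Finset.sum_insert hb]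
    exact (hf b (by simp)).add (ih fun k hk => hf k (by simp [hk]))

theorem InErrorSpan.z (i : Fin (m + 1)) : InErrorSpan a i (z a i) :=
  ⟨fun j _ => if j = i then 1 else 0, fun _ => .const _, fun _ _ _ _ _ _ => rfl, fun p => by simp⟩

/-- `xᵢ = zᵢ + α_{i-1}`, and `α_{i-1}` is a combination of the earlier coordinates, to which strong
induction applies. -/
theorem inErrorSpan_state {i : Fin (m + 1)} (ha : ∀ j ≤ i, IsReference j (a j)) :
    InErrorSpan a i fun p => p.1 i := by
  induction i using WellFoundedLT.induction with
  | ind i ih =>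
    have hi := ha i le_rfl
    obtain ⟨G, hG, hGd, h⟩ := hi.vanishing.exists_eq_sum (I := Finset.Iio i)
      (by simpa using hi.dependsOn)
    have h1 : InErrorSpan a i fun p => Backstepping.z a i p + ∑ k ∈ Finset.Iio i, G k p * p.1 k := by
      refine (InErrorSpan.z i).add (InErrorSpan.sum fun k hk => ?_)
      have hk' := Finset.mem_Iio.1 hk
      exact InErrorSpan.mul (hG k) ((hGd k).mono (by simp [Set.Iio_subset_Iic_self]))
        ((ih k hk' fun j hj => ha j (hj.trans hk'.le)).mono hk'.le)
    have e : (fun p : Pt m q => p.1 i)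
        = fun p => Backstepping.z a i p + ∑ k ∈ Finset.Iio i, G k p * p.1 k := by
      funext p
      rw [← h p]
      simp [Backstepping.z]
    rwa [e]

/-- Source of the factors `Wᵢ` and `ψ̄`: rewrite each coordinate through the errors. -/
theorem ScaledVanishing.inErrorSpan {i : Fin (m + 1)} (ha : ∀ j ≤ i, IsReference j (a j))
    {f : Pt m q → ℝ} (hf : ScaledVanishing f) (hfd : StateDependsOn f (Set.Iic i)) :
    InErrorSpan a i f := by
  obtain ⟨G, hG, hGd, h⟩ := hf.exists_eq_sum (I := Finset.Iic i) (by simpa using hfd)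
  rw [show f = fun p => ∑ k ∈ Finset.Iic i, G k p * p.1 k from funext h]
  refine InErrorSpan.sum fun k hk => ?_
  have hk' := Finset.mem_Iic.1 hk
  exact InErrorSpan.mul (hG k) (by simpa using hGd k)
    ((inErrorSpan_state fun j hj => ha j (hj.trans hk')).mono hk')

end ErrorCoordinates

/-! ### Existence of a design -/

section Existence

variable {P : Params m q} {φ : Fin (m + 1) → State m → Par q}

theorem zPrev_congr {a a' : Fin (m + 1) → Pt m q → ℝ} {i : Fin (m + 1)}
    (h : ∀ j ≤ i, a j = a' j) : zPrev a i = zPrev a' i := by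
  cases i using Fin.cases with
  | zero => rfl
  | succ j =>
    funext p
    simp only [zPrev_succ, z, h _ j.castSucc_lt_succ.le]

theorem virtualControl_congr {a a' : Fin (m + 1) → Pt m q → ℝ}
    {W W' : Fin (m + 1) → Pt m q → Matrix (Fin (m + 1)) (Fin q) ℝ} {i : Fin (m + 1)}
    (h : ∀ j ≤ i, a j = a' j) (hW : W i = W' i) :
    virtualControl P φ a W i = virtualControl P φ a' W' i := by
  funext p
  have hi := h i le_rfl
  have hw : ∀ j ≤ i, w φ a j p = w φ a' j p := fun j hj => by simp only [w, h j hj]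
  have hs : ∀ j ≤ i, s a j p = s a' j p := fun j hj => by simp only [s, z, h j hj]
  have htau : tau φ a i p = tau φ a' i p := Finset.sum_congr rfl fun j hj => by
    rw [hw j (Finset.mem_Iic.1 hj), hs j (Finset.mem_Iic.1 hj)]
  have hcross : crossTerm P φ a i p = crossTerm P φ a' i p := Finset.sum_congr rfl fun j hj => by
    have hj' := (Finset.mem_Iio.1 hj).le
    rw [hw i le_rfl, hs j hj', h j hj']
  simp only [virtualControl, hcross, htau, hw i le_rfl, zPrev_congr h, chainTerm, z, zeta, frobSq,
    hi, hW]

theorem exists_design (hφ_smooth : ∀ i, ContDiff ℝ ∞ (φ i))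
    (hφ_dep : ∀ i, DependsOn (φ i) (Set.Iic i)) (hφ_zero : ∀ i, φ i 0 = 0) :
    Nonempty (Design P φ) := by
  have partialDesign : ∀ l : ℕ, ∃ (a : Fin (m + 1) → Pt m q → ℝ)
      (W : Fin (m + 1) → Pt m q → Matrix (Fin (m + 1)) (Fin q) ℝ),
      a 0 = 0 ∧ (∀ i, IsReference i (a i)) ∧
      (∀ i j c, ScaledSmooth fun p : Pt m q => W i p j c) ∧
      (∀ i, StateDependsOn (W i) (Set.Iic i)) ∧
      (∀ i : Fin m, (i : ℕ) < l → a i.succ = virtualControl P φ a W i.castSucc) ∧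
      (∀ i : Fin (m + 1), (i : ℕ) < l → ∀ p c,
        w φ a i p c = ∑ j ∈ Finset.Iic i, W i p j c * z a j p) := by
    intro l
    induction l with
    | zero =>
      exact ⟨0, 0, rfl, isReference_zero, fun _ _ _ => .const 0, fun _ _ _ _ _ _ => rfl,
        by simp, by simp⟩
    | succ l ih =>
      obtain ⟨a, W, ha0, ha, hW, hWd, hstep, hw⟩ := ih
      by_cases hl : l < m + 1
      swap
      · exact ⟨a, W, ha0, ha, hW, hWd, fun i _ => hstep i (by omega), fun i _ => hw i (by omega)⟩
      set i₀ : Fin (m + 1) := ⟨l, hl⟩ with hi₀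
      have hspan : ∀ c : Fin q, InErrorSpan a i₀ fun p => w φ a i₀ p c := fun c =>
        (scaledVanishing_w hφ_smooth hφ_zero (ha i₀) c).inErrorSpan (fun j _ => ha j)
          fun x y ϑ μ h => by simp only [stateDependsOn_w hφ_dep (ha i₀) ϑ μ h]
      choose C hC hCd hCw using hspan
      set W' : Fin (m + 1) → Pt m q → Matrix (Fin (m + 1)) (Fin q) ℝ :=
        Function.update W i₀ fun p => Matrix.of fun j c => C c j p with hW'
      have hW's : ∀ i j c, ScaledSmooth fun p : Pt m q => W' i p j c := by
        intro i j c
        by_cases hi : i = i₀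
        · subst hi; simpa [hW'] using hC c j
        · simpa [hW', Function.update_of_ne hi] using hW i j c
      have hW'd : ∀ i, StateDependsOn (W' i) (Set.Iic i) := by
        intro i
        by_cases hi : i = i₀
        · subst hi
          intro x y ϑ μ h
          ext j c
          simpa [hW'] using hCd c j ϑ μ h
        · simpa [hW', Function.update_of_ne hi] using hWd i
      -- Only the reference with index `l + 1` changes, and the equations already established
      -- involve indices at most `l`. For `l = m` no such index exists and `a' = a`.
      set a' : Fin (m + 1) → Pt m q → ℝ := fun j =>
        if (j : ℕ) = l + 1 then virtualControl P φ a W' i₀ else a j with ha'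
      have haa : ∀ j : Fin (m + 1), (j : ℕ) ≤ l → a' j = a j := fun j hj => by
        simp [ha', show (j : ℕ) ≠ l + 1 by omega]
      refine ⟨a', W', ?_, fun j => ?_, hW's, hW'd, fun i hi => ?_, fun i hi p c => ?_⟩
      · rw [haa 0 (Nat.zero_le _), ha0]
      · by_cases hj : (j : ℕ) = l + 1
        · have hlm : l < m := by omega
          have ej : j = (⟨l, hlm⟩ : Fin m).succ := Fin.ext hj
          have ei : i₀ = (⟨l, hlm⟩ : Fin m).castSucc := rfl
          have : a' j = virtualControl P φ a W' i₀ := by simp [ha', hj]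
          rw [this, ej, ei]
          exact isReference_virtualControl hφ_smooth hφ_dep hφ_zero (fun j _ => ha j)
            (fun j c => hW's _ j c) (hW'd _)
        · simpa [ha', hj] using ha j
      · have hc : ∀ j ≤ i.castSucc, a' j = a j := fun j hj => haa j (by
          have : (j : ℕ) ≤ i := hj
          omega)
        rw [virtualControl_congr (W' := W') hc rfl]
        by_cases hil : (i : ℕ) = l
        · have ei : i.castSucc = i₀ := Fin.ext hil
          simp [ha', ei, hil]
        · have hlt : (i : ℕ) < l := by omega
          have hne : i.castSucc ≠ i₀ := fun h => hil (congrArg Fin.val h)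
          rw [haa i.succ (by simpa using hlt), hstep i hlt]
          exact virtualControl_congr (fun _ _ => rfl) (by simp [hW', Function.update_of_ne hne])
      · have hz : ∀ j ∈ Finset.Iic i, z a' j p = z a j p := fun j hj => by
          have : (j : ℕ) ≤ i := Fin.le_def.1 (Finset.mem_Iic.1 hj)
          simp only [z, haa j (by omega)]
        have hw' : w φ a' i p = w φ a i p := by simp only [w, haa i (by omega)]
        rw [hw']
        by_cases hil : i = i₀
        · subst hil
          refine (hCw c p).trans ?_
          exact Finset.sum_congr rfl fun j hj => by simp [hW', hz j hj]
        · have hlt : (i : ℕ) < l := by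
            have : (i : ℕ) ≠ l := fun h => hil (Fin.ext h)
            omega
          rw [hw i hlt]
          exact Finset.sum_congr rfl fun j hj => by
            simp [hW', hz j hj, Function.update_of_ne hil]
  obtain ⟨a, W, ha0, ha, hW, hWd, hstep, hw⟩ := partialDesign (m + 1)
  obtain ⟨c, hc, _, hcp⟩ := (scaledVanishing_psi (P := P) hφ_smooth hφ_zero ha).inErrorSpan
    (i := Fin.last m) (fun j _ => ha j) (by
      intro x y ϑ μ h
      rw [show x = y from funext fun i => h i (Fin.le_last i)])
  exact ⟨{
    a := a
    W := W
    ψbar := fun p j => c j p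
    a_zero := ha0
    a_succ := fun i p => congrFun (hstep i (by omega)) p
    W_dependsOn := fun i ϑ μ _ _ h => hWd i ϑ μ h
    W_smooth := hW
    w_eq := fun i p c => hw i i.2 p c
    ψbar_smooth := scaledSmooth_pi.2 hc
    psi_eq := fun p => by
      rw [hcp p]
      congr 1
      ext j
      simp [Fin.le_last] }⟩

end Existence

/-! ### Young's inequality and the quadratic form of `Γ⁻¹` -/

section LinearAlgebra

/-- Young's inequality without square roots: the squares of the two sides differ by at least `d² (A
r² - B)² / 4`. -/
theorem mul_le_of_sq_le {r X A B d : ℝ} (hA : 0 ≤ A) (hB : 0 ≤ B) (hd : 0 ≤ d)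
    (hX : X ^ 2 ≤ A * B * d ^ 2) : r * X ≤ d / 2 * (A * r ^ 2 + B) := by
  refine le_of_sq_le_sq ?_ (by positivity)
  have h1 : (r * X) ^ 2 ≤ r ^ 2 * (A * B * d ^ 2) := by
    rw [mul_pow]
    exact mul_le_mul_of_nonneg_left hX (sq_nonneg r)
  have h2 : 0 ≤ d ^ 2 * (A * r ^ 2 - B) ^ 2 := by positivity
  nlinarith

/-- A quadratic form `vᵀ Γ⁻¹ v` with `Γ` positive definite bounds the coordinates of `v`. -/
theorem sq_le_of_posDef {Γ : Matrix (Fin q) (Fin q) ℝ} (hΓ : Γ.PosDef) (v : Par q) (c : Fin q) :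
    v c ^ 2 ≤ Γ c c * (v ⬝ᵥ (Γ⁻¹ *ᵥ v)) := by
  have hdet : IsUnit Γ.det := hΓ.isUnit.map Matrix.detMonoidHom
  have hcc : 0 < Γ c c := hΓ.diag_pos
  have hsymm : Γ⁻¹ᵀ = Γ⁻¹ := by
    have := hΓ.inv.isHermitian
    rwa [Matrix.IsHermitian, Matrix.conjTranspose_eq_transpose_of_trivial] at this
  -- In the inner product of `Γ⁻¹`, the vector `u` represents the coordinate `c` and has squared
  -- length `Γ c c`; what follows is Cauchy–Schwarz for `v` and `u`.
  set u : Par q := Γ *ᵥ Pi.single c 1 with hu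
  have hΓu : Γ⁻¹ *ᵥ u = Pi.single c 1 := by
    rw [hu, Matrix.mulVec_mulVec, Matrix.nonsing_inv_mul _ hdet, Matrix.one_mulVec]
  have hvu : v ⬝ᵥ (Γ⁻¹ *ᵥ u) = v c := by rw [hΓu]; simp
  have huv : u ⬝ᵥ (Γ⁻¹ *ᵥ v) = v c := by
    rw [Matrix.dotProduct_mulVec, ← Matrix.mulVec_transpose, hsymm, hΓu]; simp
  have huu : u ⬝ᵥ (Γ⁻¹ *ᵥ u) = Γ c c := by
    rw [hΓu, hu]; simp
  have hpos := hΓ.inv.posSemidef.dotProduct_mulVec_nonneg (v - (v c / Γ c c) • u)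
  simp only [star_trivial, Matrix.mulVec_sub, Matrix.mulVec_smul, sub_dotProduct, dotProduct_sub,
    smul_dotProduct, dotProduct_smul, hvu, huv, huu, smul_eq_mul] at hpos
  have e : v c / Γ c c * Γ c c = v c := div_mul_cancel₀ _ hcc.ne'
  rw [e] at hpos
  have h2 : v c / Γ c c * v c ≤ v ⬝ᵥ (Γ⁻¹ *ᵥ v) := by linarith
  calc v c ^ 2 = Γ c c * (v c / Γ c c * v c) := by field_simp
    _ ≤ _ := mul_le_mul_of_nonneg_left h2 hcc.le

end LinearAlgebra

/-! ### Error dynamics and their energy estimate -/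

section VectorField

variable (P : Params m q) (φ : Fin (m + 1) → State m → Par q) (D : Design P φ)

/-- The right-hand side of the system equations of the closed loop, for the parameter values
`θ` and `b`. -/
noncomputable def stateRate (θ : Par q) (b : ℝ) (p : Pt m q) (ρ : ℝ) : State m := fun i =>
  φ i p.1 ⬝ᵥ θ + Fin.lastCases (motive := fun _ => ℝ)
    (b * (ρ * ubar P D.a D.W D.ψbar p)) (fun j => p.1 j.succ) i

/-- The rate of `zᵢ` along the closed loop. -/
noncomputable def zRate (θ : Par q) (b : ℝ) (p : Pt m q) (ρ : ℝ) (i : Fin (m + 1)) : ℝ :=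
  stateRate P φ D θ b p ρ i
    - fderiv ℝ (D.a i) p (stateRate P φ D θ b p ρ, thetaRate P φ D p, P.lam * p.2.2)

variable {P φ D}

theorem fderiv_eq_sum (f : Pt m q → ℝ) (p : Pt m q) (v : State m) (η : Par q) (c : ℝ) :
    fderiv ℝ f p (v, η, c) = ∑ j, dx f j p * v j + dtheta f p η + dmu f p * c := by
  have e : ((v, η, c) : Pt m q) = ∑ j, v j • (Pi.single j 1, 0, 0) + (0, η, 0) + c • (0, 0, 1) := by
    have h1 : ∑ j, v j • ((Pi.single j 1, 0, 0) : Pt m q)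
        = ContinuousLinearMap.inl ℝ (State m) (Par q × ℝ) v := by
      conv_rhs => rw [pi_eq_sum_univ' v]
      rw [map_sum]
      exact Finset.sum_congr rfl fun j _ => by simp
    rw [h1]
    simp
  rw [e, map_add, map_add, map_sum, map_smul]
  simp only [map_smul, dx, dtheta, dmu, smul_eq_mul, mul_comm]

theorem dtheta_eq (f : Pt m q → ℝ) (p : Pt m q) :
    ∃ L : Par q →ₗ[ℝ] ℝ, ∀ v, dtheta f p (P.Gam *ᵥ v) = L v :=
  ⟨(fderiv ℝ f p).toLinearMap ∘ₗ LinearMap.inr ℝ (State m) (Par q × ℝ) ∘ₗ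
    LinearMap.inl ℝ (Par q) ℝ ∘ₗ Matrix.mulVecLin P.Gam, fun _ => rfl⟩

theorem tau_last (p : Pt m q) :
    tau φ D.a (Fin.last m) p = ∑ j, (p.2.2 * s D.a j p) • w φ D.a j p := by
  unfold tau
  congr 1
  ext j
  simp [Fin.le_last]

/-- The rate of `zᵢ` in terms of the regressor and the correction terms of the design. -/
theorem zRate_eq (hd : ∀ i, Differentiable ℝ (D.a i))
    (hdep : ∀ i, StateDependsOn (D.a i) (Set.Iio i)) (θ : Par q) (b : ℝ) (p : Pt m q) (ρ : ℝ)
    (i : Fin (m + 1)) :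
    zRate P φ D θ b p ρ i = w φ D.a i p ⬝ᵥ θ + Fin.lastCases (motive := fun _ => ℝ)
      (b * (ρ * ubar P D.a D.W D.ψbar p)) (fun j => p.1 j.succ) i
      - chainTerm D.a i p - dtheta (D.a i) p (P.Gam *ᵥ tau φ D.a (Fin.last m) p)
      - dmu (D.a i) p * (P.lam * p.2.2) := by
  -- This truncates the full gradient to the sums over `j < i` in `w` and `chainTerm`; in particular
  -- the input does not enter through the reference signals.
  have hzero : ∀ j, ¬ j < i → dx (D.a i) j p = 0 := fun j hj =>
    (hdep i).dx_eq_zero (hd i) hj p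
  have hw : w φ D.a i p ⬝ᵥ θ
      = φ i p.1 ⬝ᵥ θ - ∑ j, dx (D.a i) j p * (φ j p.1 ⬝ᵥ θ) := by
    rw [w, sub_dotProduct, sum_dotProduct]
    congr 1
    rw [← Finset.sum_subset (Finset.subset_univ (Finset.Iio i))]
    · exact Finset.sum_congr rfl fun j _ => by rw [smul_dotProduct, smul_eq_mul]
    · intro j _ hj
      rw [hzero j fun h => hj (Finset.mem_Iio.2 h), zero_mul]
  have hchain : ∑ j, dx (D.a i) j p * Fin.lastCases (motive := fun _ => ℝ)
      (b * (ρ * ubar P D.a D.W D.ψbar p)) (fun j => p.1 j.succ) j = chainTerm D.a i p := by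
    rw [Fin.sum_univ_castSucc, hzero _ (Fin.le_last i).not_gt, zero_mul, add_zero]
    refine Finset.sum_congr rfl fun j _ => ?_
    rw [Fin.lastCases_castSucc]
    split_ifs with h
    · rfl
    · rw [hzero _ h, zero_mul]
  rw [zRate, fderiv_eq_sum, ← hchain, hw]
  simp only [stateRate, mul_add, Finset.sum_add_distrib, thetaRate]
  ring

/-- The virtual control may use only `τᵢ`, whereas `θ̂` is updated with `τₙ`; the mismatch `τᵢ - τₙ`
is what the cross terms have to compensate. -/
theorem zRate_castSucc (hd : ∀ i, Differentiable ℝ (D.a i))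
    (hdep : ∀ i, StateDependsOn (D.a i) (Set.Iio i)) (θ : Par q) (b : ℝ) (p : Pt m q) (ρ : ℝ)
    (i : Fin m) :
    zRate P φ D θ b p ρ i.castSucc = w φ D.a i.castSucc p ⬝ᵥ (θ - p.2.1)
      + (z D.a i.succ p - (P.k i.castSucc + zeta P D.W i.castSucc p) * z D.a i.castSucc p)
      - zPrev D.a i.castSucc p
      + (dtheta (D.a i.castSucc) p
          (P.Gam *ᵥ (tau φ D.a i.castSucc p - tau φ D.a (Fin.last m) p))
        + crossTerm P φ D.a i.castSucc p) := by
  have hz : p.1 i.succ = z D.a i.succ p + virtualControl P φ D.a D.W i.castSucc p := by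
    rw [← D.a_succ, z]; ring
  obtain ⟨L, hL⟩ := dtheta_eq (P := P) (D.a i.castSucc) p
  rw [zRate_eq hd hdep, Fin.lastCases_castSucc, hz, virtualControl, dotProduct_sub, hL, hL, hL,
    map_sub]
  ring

/-- Here nothing is cancelled exactly, since `b` is unknown; the terms are collected in `ψ`. The
vanishing mismatch is kept so that all rows have the same shape. -/
theorem zRate_last (hd : ∀ i, Differentiable ℝ (D.a i))
    (hdep : ∀ i, StateDependsOn (D.a i) (Set.Iio i)) (θ : Par q) (b : ℝ) (p : Pt m q) (ρ : ℝ) :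
    zRate P φ D θ b p ρ (Fin.last m) = w φ D.a (Fin.last m) p ⬝ᵥ (θ - p.2.1)
      + (b * (ρ * ubar P D.a D.W D.ψbar p) + psi P φ D.a p)
      - zPrev D.a (Fin.last m) p
      + (dtheta (D.a (Fin.last m)) p
          (P.Gam *ᵥ (tau φ D.a (Fin.last m) p - tau φ D.a (Fin.last m) p))
        + crossTerm P φ D.a (Fin.last m) p) := by
  obtain ⟨L, hL⟩ := dtheta_eq (P := P) (D.a (Fin.last m)) p
  rw [zRate_eq hd hdep, Fin.lastCases_last, psi, dotProduct_sub, hL, hL, sub_self, map_zero]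
  ring

/-- The correction terms that stem from the adaptation of the estimate cancel. -/
theorem sum_mul_dtheta_add_crossTerm (p : Pt m q) :
    ∑ i, p.2.2 * s D.a i p * (dtheta (D.a i) p
        (P.Gam *ᵥ (tau φ D.a i p - tau φ D.a (Fin.last m) p)) + crossTerm P φ D.a i p) = 0 := by
  choose L hL using fun i => dtheta_eq (P := P) (D.a i) p
  set c : Fin (m + 1) → ℝ := fun i => p.2.2 * s D.a i p with hc
  have htau : ∀ i, tau φ D.a i p - tau φ D.a (Fin.last m) p
      = -∑ j ∈ Finset.Ioi i, c j • w φ D.a j p := by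
    intro i
    have hdisj : Disjoint (Finset.Iic i) (Finset.Ioi i) :=
      Finset.disjoint_left.2 fun j h1 h2 =>
        (Finset.mem_Iic.1 h1).not_gt (Finset.mem_Ioi.1 h2)
    have huniv : Finset.univ = (Finset.Iic i).disjUnion (Finset.Ioi i) hdisj := by
      ext j
      simp [le_or_gt]
    rw [tau_last, huniv, Finset.sum_disjUnion]
    simp [tau, hc]
  have h1 : ∀ i, p.2.2 * s D.a i p * dtheta (D.a i) p
      (P.Gam *ᵥ (tau φ D.a i p - tau φ D.a (Fin.last m) p))
      = -∑ j ∈ Finset.Ioi i, c i * c j * L i (w φ D.a j p) := by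
    intro i
    change c i * _ = _
    rw [hL, htau, map_neg, map_sum, mul_neg, Finset.mul_sum]
    congr 1
    exact Finset.sum_congr rfl fun j _ => by rw [map_smul, smul_eq_mul]; ring
  have h2 : ∀ i, p.2.2 * s D.a i p * crossTerm P φ D.a i p
      = ∑ j ∈ Finset.Iio i, c j * c i * L j (w φ D.a i p) := by
    intro i
    change c i * _ = _
    rw [crossTerm, Finset.mul_sum]
    exact Finset.sum_congr rfl fun j _ => by rw [hL, map_smul, smul_eq_mul]; ring
  -- Mismatches and cross terms run over the same pairs, listed by the smaller index on one side and
  -- by the larger on the other.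
  have hswap : ∑ i, ∑ j ∈ Finset.Ioi i, c i * c j * L i (w φ D.a j p)
      = ∑ i, ∑ j ∈ Finset.Iio i, c j * c i * L j (w φ D.a i p) :=
    Finset.sum_comm' (by simp)
  simp only [mul_add, Finset.sum_add_distrib]
  rw [Finset.sum_congr rfl fun i _ => h1 i, Finset.sum_congr rfl fun i _ => h2 i,
    Finset.sum_neg_distrib, hswap]
  ring

/-- Skew-symmetry of the coupling: `-z_{i-1}` in one row offsets `z_{i+1}` in the row before. -/
theorem sum_mul_zPrev (p : Pt m q) :
    ∑ i, p.2.2 * s D.a i p * zPrev D.a i p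
      = ∑ j : Fin m, p.2.2 * s D.a j.castSucc p * z D.a j.succ p := by
  rw [Fin.sum_univ_succ, zPrev_zero, mul_zero, zero_add]
  refine Finset.sum_congr rfl fun j _ => ?_
  rw [zPrev_succ, s, s]
  ring

theorem frobSq_nonneg (W : Fin (m + 1) → Pt m q → Matrix (Fin (m + 1)) (Fin q) ℝ)
    (i : Fin (m + 1)) (p : Pt m q) : 0 ≤ frobSq W i p :=
  Finset.sum_nonneg fun _ _ => Finset.sum_nonneg fun _ _ => sq_nonneg _

theorem mul_w_eq (p : Pt m q) (i : Fin (m + 1)) (c : Fin q) :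
    p.2.2 * w φ D.a i p c = ∑ j ∈ Finset.Iic i, D.W i p j c * s D.a j p := by
  rw [D.w_eq, Finset.mul_sum]
  exact Finset.sum_congr rfl fun j _ => by rw [s]; ring

theorem sq_mul_w_dotProduct_le (p : Pt m q) (i : Fin (m + 1)) {Δ : Par q} {d : ℝ}
    (hΔ : ∑ c, Δ c ^ 2 ≤ d ^ 2) :
    (p.2.2 * (w φ D.a i p ⬝ᵥ Δ)) ^ 2
      ≤ frobSq D.W i p * (∑ j ∈ Finset.Iic i, s D.a j p ^ 2) * d ^ 2 := by
  have e : p.2.2 * (w φ D.a i p ⬝ᵥ Δ) = ∑ c, p.2.2 * w φ D.a i p c * Δ c := by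
    rw [dotProduct, Finset.mul_sum]
    exact Finset.sum_congr rfl fun c _ => by ring
  have h1 : ∑ c, (p.2.2 * w φ D.a i p c) ^ 2
      ≤ frobSq D.W i p * ∑ j ∈ Finset.Iic i, s D.a j p ^ 2 := by
    rw [frobSq, Finset.sum_comm, Finset.sum_mul]
    refine Finset.sum_le_sum fun c _ => ?_
    rw [mul_w_eq]
    exact Finset.sum_mul_sq_le_sq_mul_sq _ _ _
  rw [e]
  refine (Finset.sum_mul_sq_le_sq_mul_sq _ _ _).trans ?_
  exact mul_le_mul h1 hΔ (Finset.sum_nonneg fun _ _ => sq_nonneg _)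
    (mul_nonneg (frobSq_nonneg _ _ _) (Finset.sum_nonneg fun _ _ => sq_nonneg _))

/-- Young's inequality in row `i` costs `|Wᵢ|_F² sᵢ²` and the sum of `sⱼ²` over `j ≤ i`. Exchanging
the sums counts `sⱼ²` once for every row from `j` on, which explains the term `(n+1-i)δ` in `ζᵢ`. -/
theorem tau_last_dotProduct_le (p : Pt m q) {Δ : Par q} (hΔ : ∑ c, Δ c ^ 2 ≤ P.del ^ 2) :
    tau φ D.a (Fin.last m) p ⬝ᵥ Δ
      ≤ ∑ i, P.del / 2 * (frobSq D.W i p + ((m : ℝ) + 1 - ((i : ℕ) : ℝ))) * s D.a i p ^ 2 := by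
  have hswap : ∑ i : Fin (m + 1), ∑ j ∈ Finset.Iic i, s D.a j p ^ 2
      = ∑ j : Fin (m + 1), ((m : ℝ) + 1 - ((j : ℕ) : ℝ)) * s D.a j p ^ 2 := by
    rw [Finset.sum_comm' (t' := Finset.univ) (s' := fun j => Finset.Ici j) (by simp)]
    refine Finset.sum_congr rfl fun j _ => ?_
    rw [Finset.sum_const, Fin.card_Ici, nsmul_eq_mul, Nat.cast_sub j.2.le]
    push_cast
    ring
  calc tau φ D.a (Fin.last m) p ⬝ᵥ Δ
      = ∑ i, s D.a i p * (p.2.2 * (w φ D.a i p ⬝ᵥ Δ)) := by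
        rw [tau_last, sum_dotProduct]
        exact Finset.sum_congr rfl fun i _ => by rw [smul_dotProduct, smul_eq_mul]; ring
    _ ≤ ∑ i, P.del / 2 * (frobSq D.W i p * s D.a i p ^ 2 + ∑ j ∈ Finset.Iic i, s D.a j p ^ 2) :=
        Finset.sum_le_sum fun i _ => mul_le_of_sq_le (frobSq_nonneg _ _ _)
          (Finset.sum_nonneg fun _ _ => sq_nonneg _) P.del_nonneg (sq_mul_w_dotProduct_le p i hΔ)
    _ = P.del / 2 * (∑ i, frobSq D.W i p * s D.a i p ^ 2
          + ∑ i : Fin (m + 1), ∑ j ∈ Finset.Iic i, s D.a j p ^ 2) := by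
        rw [← Finset.sum_add_distrib, Finset.mul_sum]
    _ = _ := by
        rw [hswap, ← Finset.sum_add_distrib, Finset.mul_sum]
        exact Finset.sum_congr rfl fun i _ => by ring

/-- Young's inequality with weight `ε`: the first part is covered by `ε|ψ̄|²` in `κ`, the second by
the `1/ε` in every row. -/
theorem mul_psi_le (p : Pt m q) :
    p.2.2 * s D.a (Fin.last m) p * psi P φ D.a p
      ≤ 1 / 2 * (P.eps * ∑ j, D.ψbar p j ^ 2) * s D.a (Fin.last m) p ^ 2
        + 1 / 2 * (1 / P.eps) * ∑ i, s D.a i p ^ 2 := by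
  have heps := P.eps_pos
  have e : p.2.2 * s D.a (Fin.last m) p * psi P φ D.a p
      = s D.a (Fin.last m) p * ∑ j, D.ψbar p j * s D.a j p := by
    rw [D.psi_eq, mul_comm p.2.2, mul_assoc, Finset.mul_sum]
    congr 1
    exact Finset.sum_congr rfl fun j _ => by rw [s]; ring
  rw [e]
  refine (mul_le_of_sq_le (A := P.eps * ∑ j, D.ψbar p j ^ 2)
    (B := 1 / P.eps * ∑ i, s D.a i p ^ 2) (d := 1) ?_ ?_ zero_le_one ?_).trans (le_of_eq (by ring))
  · exact mul_nonneg heps.le (Finset.sum_nonneg fun _ _ => sq_nonneg _)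
  · exact mul_nonneg (by positivity) (Finset.sum_nonneg fun _ _ => sq_nonneg _)
  · refine (Finset.sum_mul_sq_le_sq_mul_sq _ _ _).trans (le_of_eq ?_)
    field_simp

/-- Splitting `θ - θ̂` at `ℓ` leaves a bounded part for the damping and a constant-parameter part
for adaptation. The last row lacks damping of its own, hence the positive `κ sₙ²`, to be compensated
by the input. -/
theorem sum_mul_sRate_le (hd : ∀ i, Differentiable ℝ (D.a i))
    (hdep : ∀ i, StateDependsOn (D.a i) (Set.Iio i)) {θ ℓ : Par q}
    (hθ : ∑ c, (θ - ℓ) c ^ 2 ≤ P.del ^ 2) (b : ℝ) (p : Pt m q) (ρ : ℝ) :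
    ∑ i, s D.a i p * (P.lam * s D.a i p + p.2.2 * zRate P φ D θ b p ρ i)
      ≤ -∑ i, P.k i * s D.a i p ^ 2 + kappa P D.W D.ψbar p * s D.a (Fin.last m) p ^ 2
        + tau φ D.a (Fin.last m) p ⬝ᵥ (ℓ - p.2.1)
        + p.2.2 * s D.a (Fin.last m) p * (b * (ρ * ubar P D.a D.W D.ψbar p)) := by
  set v : Fin (m + 1) → ℝ := Fin.lastCases (motive := fun _ => ℝ)
    (b * (ρ * ubar P D.a D.W D.ψbar p) + psi P φ D.a p) (fun i => z D.a i.succ p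
      - (P.k i.castSucc + zeta P D.W i.castSucc p) * z D.a i.castSucc p) with hv
  have hz : ∀ i, zRate P φ D θ b p ρ i = w φ D.a i p ⬝ᵥ (θ - p.2.1) + v i - zPrev D.a i p
      + (dtheta (D.a i) p (P.Gam *ᵥ (tau φ D.a i p - tau φ D.a (Fin.last m) p))
        + crossTerm P φ D.a i p) := by
    intro i
    cases i using Fin.lastCases with
    | last => rw [zRate_last hd hdep, hv, Fin.lastCases_last]
    | cast i => rw [zRate_castSucc hd hdep, hv, Fin.lastCases_castSucc]
  have htau : tau φ D.a (Fin.last m) p ⬝ᵥ (θ - p.2.1)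
      = ∑ i, p.2.2 * s D.a i p * (w φ D.a i p ⬝ᵥ (θ - p.2.1)) := by
    rw [tau_last, sum_dotProduct]
    exact Finset.sum_congr rfl fun i _ => by rw [smul_dotProduct, smul_eq_mul]
  have hsplit : tau φ D.a (Fin.last m) p ⬝ᵥ (θ - p.2.1)
      = tau φ D.a (Fin.last m) p ⬝ᵥ (θ - ℓ) + tau φ D.a (Fin.last m) p ⬝ᵥ (ℓ - p.2.1) := by
    rw [← dotProduct_add, sub_add_sub_cancel]
  have hvsum : ∑ i, p.2.2 * s D.a i p * v i
      = ∑ j : Fin m, p.2.2 * s D.a j.castSucc p * z D.a j.succ p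
        - ∑ j : Fin m, (P.k j.castSucc + zeta P D.W j.castSucc p) * s D.a j.castSucc p ^ 2
        + p.2.2 * s D.a (Fin.last m) p * (b * (ρ * ubar P D.a D.W D.ψbar p))
        + p.2.2 * s D.a (Fin.last m) p * psi P φ D.a p := by
    rw [Fin.sum_univ_castSucc, hv, Fin.lastCases_last, mul_add, ← add_assoc,
      ← Finset.sum_sub_distrib]
    congr 2
    refine Finset.sum_congr rfl fun j _ => ?_
    rw [Fin.lastCases_castSucc]
    simp only [s]
    ring
  have hexpand : ∑ i, s D.a i p * (P.lam * s D.a i p + p.2.2 * zRate P φ D θ b p ρ i)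
      = P.lam * ∑ i, s D.a i p ^ 2 + ∑ i, p.2.2 * s D.a i p * (w φ D.a i p ⬝ᵥ (θ - p.2.1))
        + ∑ i, p.2.2 * s D.a i p * v i - ∑ i, p.2.2 * s D.a i p * zPrev D.a i p
        + ∑ i, p.2.2 * s D.a i p * (dtheta (D.a i) p
          (P.Gam *ᵥ (tau φ D.a i p - tau φ D.a (Fin.last m) p)) + crossTerm P φ D.a i p) := by
    rw [Finset.mul_sum, ← Finset.sum_add_distrib, ← Finset.sum_add_distrib,
      ← Finset.sum_sub_distrib, ← Finset.sum_add_distrib]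
    exact Finset.sum_congr rfl fun i _ => by rw [hz]; ring
  have hzeta : ∑ i, zeta P D.W i p * s D.a i p ^ 2
      = P.lam * ∑ i, s D.a i p ^ 2
        + ∑ i, P.del / 2 * (frobSq D.W i p + ((m : ℝ) + 1 - ((i : ℕ) : ℝ))) * s D.a i p ^ 2
        + 1 / 2 * (1 / P.eps) * ∑ i, s D.a i p ^ 2 := by
    rw [Finset.mul_sum, Finset.mul_sum, ← Finset.sum_add_distrib, ← Finset.sum_add_distrib]
    exact Finset.sum_congr rfl fun i _ => by rw [zeta]; ring
  -- In the last row the coefficient `n+1-i` of `δ` equals one.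
  have hkap : kappa P D.W D.ψbar p = P.k (Fin.last m) + zeta P D.W (Fin.last m) p
      + 1 / 2 * (P.eps * ∑ j, D.ψbar p j ^ 2) := by
    rw [kappa, zeta, Fin.val_last]
    ring
  have hkz : ∑ j : Fin m, (P.k j.castSucc + zeta P D.W j.castSucc p) * s D.a j.castSucc p ^ 2
      = ∑ i, P.k i * s D.a i p ^ 2 + ∑ i, zeta P D.W i p * s D.a i p ^ 2
        - (P.k (Fin.last m) + zeta P D.W (Fin.last m) p) * s D.a (Fin.last m) p ^ 2 := by
    rw [← Finset.sum_add_distrib, Fin.sum_univ_castSucc]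
    simp only [← add_mul]
    ring
  have h1 := tau_last_dotProduct_le (D := D) p hθ
  have h2 := mul_psi_le (D := D) p
  rw [hexpand, sum_mul_dtheta_add_crossTerm, sum_mul_zPrev, hvsum, ← htau, hsplit, hkap, hkz]
  linarith [hzeta]

end VectorField

/-! ### Bounds that are uniform in `μ` -/

section Bounds

theorem ScaledSmooth.exists_bound {E : Type*} [NormedAddCommGroup E] [NormedSpace ℝ E]
    {f : Pt m q → E} (hf : ScaledSmooth f) (R : ℝ) :
    ∃ C, 0 ≤ C ∧ ∀ p : Pt m q, ‖p.1‖ ≤ R → ‖p.2.1‖ ≤ R → ‖p.2.2 • p.1‖ ≤ R → ‖f p‖ ≤ C := by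
  obtain ⟨F, hF, h⟩ := hf
  obtain ⟨C, hC⟩ := ((isCompact_closedBall (0 : State m) R).prod
    ((isCompact_closedBall (0 : Par q) R).prod
      (isCompact_closedBall (0 : State m) R))).exists_bound_of_continuousOn hF.continuous.continuousOn
  refine ⟨max C 0, le_max_right _ _, fun p h1 h2 h3 => ?_⟩
  rw [show f p = _ from h p.1 p.2.1 p.2.2]
  exact (hC _ ⟨mem_closedBall_zero_iff.2 h1, mem_closedBall_zero_iff.2 h2,
    mem_closedBall_zero_iff.2 h3⟩).trans (le_max_left _ _)

/-- Bounds on the scaled errors and the parameter estimate bound the scaled state. -/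
theorem exists_bound_scaled_state {a : Fin (m + 1) → Pt m q → ℝ} (ha : ∀ i, IsReference i (a i))
    (R : ℝ) (i : Fin (m + 1)) :
    ∃ M, 0 ≤ M ∧ ∀ p : Pt m q, 1 ≤ p.2.2 → ‖p.2.1‖ ≤ R → (∀ j, |s a j p| ≤ R) →
      |p.2.2 * p.1 i| ≤ M := by
  induction i using WellFoundedLT.induction with
  | ind i ih =>
    choose! M hM0 hM using ih
    obtain ⟨G, hG, hGd, h⟩ := (ha i).vanishing.exists_eq_sum (I := Finset.Iio i)
      (by simpa using (ha i).dependsOn)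
    set R' : ℝ := |R| + ∑ k ∈ Finset.Iio i, M k with hR'
    have hsum0 : 0 ≤ ∑ k ∈ Finset.Iio i, M k :=
      Finset.sum_nonneg fun k hk => hM0 k (Finset.mem_Iio.1 hk)
    have hR'0 : 0 ≤ R' := add_nonneg (abs_nonneg R) hsum0
    have hMR : ∀ k ∈ Finset.Iio i, M k ≤ R' := fun k hk =>
      (Finset.single_le_sum (f := M) (fun k hk => hM0 k (Finset.mem_Iio.1 hk)) hk).trans
        (le_add_of_nonneg_left (abs_nonneg R))
    choose C hC0 hC using fun k => (hG k).exists_bound R'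
    refine ⟨|R| + ∑ k ∈ Finset.Iio i, C k * M k, add_nonneg (abs_nonneg R)
      (Finset.sum_nonneg fun k hk => mul_nonneg (hC0 k) (hM0 k (Finset.mem_Iio.1 hk))),
      fun p hμ hϑ hs => ?_⟩
    have hy : ∀ k ∈ Finset.Iio i, |p.2.2 * p.1 k| ≤ M k := fun k hk =>
      hM k (Finset.mem_Iio.1 hk) p hμ hϑ hs
    -- The coefficients `G k` see only the preceding coordinates, so they may be evaluated at the
    -- truncated state, which the induction already bounds; `1 ≤ μ` turns a bound on `μ x` into one
    -- on `x`.
    have hrest : ‖p.2.2 • restrict (Finset.Iio i) p.1‖ ≤ R' := by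
      refine (pi_norm_le_iff_of_nonneg hR'0).2 fun k => ?_
      by_cases hk : k ∈ Finset.Iio i
      · simpa [restrict, hk] using (hy k hk).trans (hMR k hk)
      · simpa [restrict, hk] using hR'0
    have hrest' : ‖restrict (Finset.Iio i) p.1‖ ≤ R' := by
      refine le_trans ?_ hrest
      rw [norm_smul, Real.norm_of_nonneg (zero_le_one.trans hμ)]
      exact le_mul_of_one_le_left (norm_nonneg _) hμ
    have hGb : ∀ k, |G k p| ≤ C k := fun k => by
      rw [(hGd k).eq_restrict p]
      exact hC k _ hrest' (hϑ.trans ((le_abs_self R).trans (le_add_of_nonneg_right hsum0))) hrest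
    have e : p.2.2 * p.1 i = s a i p + ∑ k ∈ Finset.Iio i, G k p * (p.2.2 * p.1 k) := by
      have : p.2.2 * p.1 i = s a i p + p.2.2 * a i p := by rw [s, z]; ring
      rw [this, h, Finset.mul_sum]
      congr 1
      exact Finset.sum_congr rfl fun k _ => by ring
    rw [e]
    refine (abs_add_le _ _).trans (add_le_add ((hs i).trans (le_abs_self R)) ?_)
    refine (Finset.abs_sum_le_sum_abs _ _).trans (Finset.sum_le_sum fun k hk => ?_)
    rw [abs_mul]
    exact mul_le_mul (hGb k) (hy k hk) (abs_nonneg _) (hC0 k)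

end Bounds

/-! ### The Lyapunov function -/

section Lyapunov

variable {P : Params m q} {φ : Fin (m + 1) → State m → Par q}

theorem scaledSmooth_kappa (D : Design P φ) : ScaledSmooth (kappa P D.W D.ψbar) :=
  (ScaledSmooth.const _).add ((ScaledSmooth.const _).mul (((ScaledSmooth.const _).mul
    ((scaledSmooth_frobSq (D.W_smooth _)).add (.const _))).add (.const _) |>.add
    ((ScaledSmooth.const _).mul (ScaledSmooth.sum fun j _ =>
      (scaledSmooth_pi.1 D.ψbar_smooth j).pow 2))))

theorem kappa_nonneg (D : Design P φ) (p : Pt m q) : 0 ≤ kappa P D.W D.ψbar p := by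
  have h1 := P.k_pos (Fin.last m)
  have h2 := P.lam_pos
  have h3 := P.del_nonneg
  have h4 := P.eps_pos
  have h5 := frobSq_nonneg D.W (Fin.last m) p
  have h6 : 0 ≤ ∑ j, D.ψbar p j ^ 2 := Finset.sum_nonneg fun _ _ => sq_nonneg _
  unfold kappa
  positivity

theorem scaledVanishing_ubar {D : Design P φ} (ha : ∀ i, IsReference i (D.a i)) :
    ScaledVanishing (ubar P D.a D.W D.ψbar) :=
  ScaledVanishing.mul (scaledSmooth_kappa D).neg (scaledVanishing_z (ha _))

theorem scaledSmooth_thetaRate (hφ_smooth : ∀ i, ContDiff ℝ ∞ (φ i)) (hφ_zero : ∀ i, φ i 0 = 0)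
    {D : Design P φ} (ha : ∀ i, IsReference i (D.a i)) : ScaledSmooth (thetaRate P φ D) :=
  (scaledSmooth_tau hφ_smooth hφ_zero fun j _ => ha j).mulVec _

theorem rhoRate_eq (D : Design P φ) (σ : ℝ) (p : Pt m q) :
    rhoRate P φ D σ p
      = P.gam * σ * (kappa P D.W D.ψbar p * s D.a (Fin.last m) p ^ 2) := by
  simp only [rhoRate, ubar, s]
  ring

theorem scaledSmooth_rhoRate {D : Design P φ} (ha : ∀ i, IsReference i (D.a i)) (σ : ℝ) :
    ScaledSmooth (rhoRate P φ D σ) :=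
  ((ScaledSmooth.const (P.gam * σ)).mul ((scaledSmooth_kappa D).mul
    ((scaledSmooth_s (ha (Fin.last m))).pow 2))).congr (rhoRate_eq D σ)

/-- The Lyapunov function of the closed loop; `c` is a lower bound of `|b|`. -/
noncomputable def lyapunov (D : Design P φ) (ℓ : Par q) (c σ : ℝ) (p : Pt m q) (ρ : ℝ) : ℝ :=
  1 / 2 * ∑ i, s D.a i p ^ 2 + 1 / 2 * ((p.2.1 - ℓ) ⬝ᵥ (P.Gam⁻¹ *ᵥ (p.2.1 - ℓ)))
    + c / (2 * P.gam) * (σ * ρ - 1 / c) ^ 2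

/-- The derivative of the Lyapunov function along the closed loop. -/
noncomputable def lyapunovRate (D : Design P φ) (ℓ : Par q) (c σ : ℝ) (θ : Par q) (b : ℝ)
    (p : Pt m q) (ρ : ℝ) : ℝ :=
  ∑ i, s D.a i p * (P.lam * s D.a i p + p.2.2 * zRate P φ D θ b p ρ i)
    + tau φ D.a (Fin.last m) p ⬝ᵥ (p.2.1 - ℓ)
    + c / P.gam * (σ * ρ - 1 / c) * (σ * rhoRate P φ D σ p)

/-- With `K = κ sₙ²`, the input contributes `-|b| σρ̂ K` and the adaptation of `ρ̂` contributes `c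
σρ̂ K - K`. As `c ≤ |b|` and `σρ̂ ≥ 0`, together they are at most `-K`, which pays for `κ sₙ²` in
`sum_mul_sRate_le`. -/
theorem lyapunovRate_le {D : Design P φ} (ha : ∀ i, IsReference i (D.a i)) {θ ℓ : Par q}
    (hθ : ∑ c, (θ - ℓ) c ^ 2 ≤ P.del ^ 2) {b c σ : ℝ} (hc : 0 < c) (hσ : σ * σ = 1)
    (hb : b = σ * |b|) (hcb : c ≤ |b|) (p : Pt m q) {ρ : ℝ} (hρ : 0 ≤ σ * ρ) :
    lyapunovRate D ℓ c σ θ b p ρ ≤ -∑ i, P.k i * s D.a i p ^ 2 := by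
  have h1 := sum_mul_sRate_le (D := D) (fun i => (ha i).vanishing.contDiff.differentiable (by simp))
    (fun i => (ha i).dependsOn) hθ b p ρ
  have h2 : tau φ D.a (Fin.last m) p ⬝ᵥ (ℓ - p.2.1)
      = -(tau φ D.a (Fin.last m) p ⬝ᵥ (p.2.1 - ℓ)) := by
    rw [← dotProduct_neg, neg_sub]
  set K := kappa P D.W D.ψbar p * s D.a (Fin.last m) p ^ 2 with hK
  have hK0 : 0 ≤ K := mul_nonneg (kappa_nonneg D p) (sq_nonneg _)
  have h3 : p.2.2 * s D.a (Fin.last m) p * (b * (ρ * ubar P D.a D.W D.ψbar p))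
      = -(|b| * (σ * ρ) * K) := by
    conv_lhs => rw [hb]
    rw [hK]
    simp only [ubar, s]
    ring
  have h4 : c / P.gam * (σ * ρ - 1 / c) * (σ * rhoRate P φ D σ p) = c * (σ * ρ) * K - K := by
    have hg := P.gam_pos.ne'
    have : σ * rhoRate P φ D σ p = P.gam * K := by
      rw [rhoRate_eq, hK]
      linear_combination (P.gam * (kappa P D.W D.ψbar p * s D.a (Fin.last m) p ^ 2)) * hσ
    rw [this]
    field_simp
  have h5 : c * (σ * ρ) * K ≤ |b| * (σ * ρ) * K := by gcongr
  unfold lyapunovRate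
  linarith

theorem contDiff_s {a : Fin (m + 1) → Pt m q → ℝ} (ha : ∀ i, IsReference i (a i))
    (i : Fin (m + 1)) : ContDiff ℝ ∞ (s a i) :=
  (scaledSmooth_s (ha i)).contDiff

theorem continuous_lyapunov {D : Design P φ} (ha : ∀ i, IsReference i (D.a i)) (ℓ : Par q)
    (c σ : ℝ) : Continuous fun r : Pt m q × ℝ => lyapunov D ℓ c σ r.1 r.2 := by
  have hs : ∀ i, Continuous (s D.a i) := fun i => (contDiff_s ha i).continuous
  unfold lyapunov
  refine Continuous.add (Continuous.add (continuous_const.mul (continuous_finsetSum _ fun i _ =>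
    ((hs i).comp continuous_fst).pow 2)) (continuous_const.mul ?_)) (by fun_prop)
  exact Continuous.dotProduct (by fun_prop) (continuous_const.matrix_mulVec (by fun_prop))

theorem exists_bound_of_lyapunov_le {D : Design P φ} (ha : ∀ i, IsReference i (D.a i)) (ℓ : Par q)
    {c σ : ℝ} (hc : 0 < c) (hσ : σ * σ = 1) (v : ℝ) :
    ∃ M, 0 ≤ M ∧ ∀ (p : Pt m q) (ρ : ℝ), 1 ≤ p.2.2 → lyapunov D ℓ c σ p ρ ≤ v →
      ‖p.1‖ ≤ M ∧ ‖p.2.1‖ ≤ M ∧ ‖p.2.2 • p.1‖ ≤ M ∧ |ρ| ≤ M := by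
  -- A crude bound that avoids square roots; only finiteness matters.
  have abs_le : ∀ r t : ℝ, r ^ 2 ≤ t → |r| ≤ t + 1 := fun r t h => by
    have h1 := sq_abs r
    nlinarith [sq_nonneg (|r| - 1), abs_nonneg r]
  have hg := P.gam_pos
  set R : ℝ := |v| * 2 + 1 + ∑ i, (P.Gam i i * (|v| * 2) + 1 + |ℓ i|) with hR
  have hdiag : ∀ i, 0 < P.Gam i i := fun i => P.Gam_pos.diag_pos
  have hterm : ∀ i, 0 ≤ P.Gam i i * (|v| * 2) + 1 + |ℓ i| := fun i => by
    have := (hdiag i).le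
    positivity
  have hsum0 := Finset.sum_nonneg fun (i : Fin q) (_ : i ∈ Finset.univ) => hterm i
  have hR0 : 0 ≤ R := by
    rw [hR]
    have := abs_nonneg v
    linarith
  choose M hM0 hM using exists_bound_scaled_state ha R
  have hMsum : 0 ≤ ∑ i, M i := Finset.sum_nonneg fun i _ => hM0 i
  set B : ℝ := |v| * (2 * P.gam / c) + 1 + 1 / c with hB
  have hB0 : 0 ≤ B := by positivity
  refine ⟨∑ i, M i + R + B, by positivity, fun p ρ hμ hlyap => ?_⟩
  have h1 : 0 ≤ ∑ i, s D.a i p ^ 2 := Finset.sum_nonneg fun _ _ => sq_nonneg _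
  have h2 : 0 ≤ (p.2.1 - ℓ) ⬝ᵥ (P.Gam⁻¹ *ᵥ (p.2.1 - ℓ)) := by
    simpa using P.Gam_pos.inv.posSemidef.dotProduct_mulVec_nonneg (p.2.1 - ℓ)
  have h3 : 0 ≤ c / (2 * P.gam) * (σ * ρ - 1 / c) ^ 2 := by positivity
  have hv := le_abs_self v
  unfold lyapunov at hlyap
  have hs : ∀ i, |s D.a i p| ≤ R := fun i => by
    have h4 := Finset.single_le_sum (f := fun i => s D.a i p ^ 2) (fun _ _ => sq_nonneg _)
      (Finset.mem_univ i)
    have h5 := abs_le (s D.a i p) (|v| * 2) (by linarith)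
    rw [hR]
    linarith
  have hϑ : ‖p.2.1‖ ≤ R := by
    refine (pi_norm_le_iff_of_nonneg hR0).2 fun i => ?_
    have h4 := sq_le_of_posDef P.Gam_pos (p.2.1 - ℓ) i
    have h5 : P.Gam i i * ((p.2.1 - ℓ) ⬝ᵥ (P.Gam⁻¹ *ᵥ (p.2.1 - ℓ))) ≤ P.Gam i i * (|v| * 2) :=
      mul_le_mul_of_nonneg_left (by linarith) (hdiag i).le
    have h6 := abs_le _ _ (h4.trans h5)
    have h7 : |p.2.1 i| ≤ |(p.2.1 - ℓ) i| + |ℓ i| := by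
      have := abs_add_le ((p.2.1 - ℓ) i) (ℓ i)
      simpa using this
    have h8 := Finset.single_le_sum (f := fun i => P.Gam i i * (|v| * 2) + 1 + |ℓ i|)
      (fun i _ => hterm i) (Finset.mem_univ i)
    rw [Real.norm_eq_abs, hR]
    have := abs_nonneg v
    linarith
  have hy : ‖p.2.2 • p.1‖ ≤ ∑ i, M i := by
    refine (pi_norm_le_iff_of_nonneg hMsum).2 fun i => ?_
    exact (hM i p hμ hϑ hs).trans
      (Finset.single_le_sum (f := M) (fun i _ => hM0 i) (Finset.mem_univ i))
  have hx : ‖p.1‖ ≤ ‖p.2.2 • p.1‖ := by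
    rw [norm_smul, Real.norm_of_nonneg (zero_le_one.trans hμ)]
    exact le_mul_of_one_le_left (norm_nonneg _) hμ
  have hρ : |ρ| ≤ B := by
    have h4 : (σ * ρ - 1 / c) ^ 2 ≤ |v| * (2 * P.gam / c) := by
      have e : (σ * ρ - 1 / c) ^ 2
          = c / (2 * P.gam) * (σ * ρ - 1 / c) ^ 2 * (2 * P.gam / c) := by
        field_simp
      rw [e]
      exact mul_le_mul_of_nonneg_right (by linarith) (by positivity)
    have h5 := abs_le _ _ h4
    have hσ1 : |σ| = 1 := by
      have : |σ| * |σ| = 1 := by rw [← abs_mul, hσ, abs_one]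
      nlinarith [abs_nonneg σ]
    have h6 : |σ * ρ| = |ρ| := by rw [abs_mul, hσ1, one_mul]
    have h7 := abs_add_le (σ * ρ - 1 / c) (1 / c)
    rw [sub_add_cancel, h6, abs_of_pos (by positivity : 0 < 1 / c)] at h7
    rw [hB]
    linarith
  exact ⟨by linarith, by linarith, by linarith, by linarith⟩

/-- The rate of the parameter estimate is quadratic in the scaled errors. -/
theorem abs_thetaRate_le {D : Design P φ} {B : ℝ} {p : Pt m q} (c : Fin q)
    (hB : ∀ i j d, |D.W i p j d| ≤ B) :
    |thetaRate P φ D p c|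
      ≤ (∑ d, |P.Gam c d|) * (B * ((m : ℝ) + 1)) * ∑ i, s D.a i p ^ 2 := by
  have htau : ∀ d, |tau φ D.a (Fin.last m) p d| ≤ B * ((m : ℝ) + 1) * ∑ i, s D.a i p ^ 2 := by
    intro d
    have hB0 : 0 ≤ B := (abs_nonneg _).trans (hB 0 0 d)
    have hw : ∀ i, |p.2.2 * w φ D.a i p d| ≤ B * ∑ j, |s D.a j p| := by
      intro i
      rw [mul_w_eq]
      refine (Finset.abs_sum_le_sum_abs _ _).trans ?_
      rw [Finset.mul_sum]
      refine (Finset.sum_le_sum fun j _ => ?_).trans (Finset.sum_le_sum_of_subset_of_nonneg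
        (Finset.subset_univ _) fun j _ _ => mul_nonneg hB0 (abs_nonneg _))
      rw [abs_mul]
      exact mul_le_mul_of_nonneg_right (hB i j d) (abs_nonneg _)
    have e : tau φ D.a (Fin.last m) p d = ∑ i, s D.a i p * (p.2.2 * w φ D.a i p d) := by
      rw [tau_last]
      simp only [Finset.sum_apply, Pi.smul_apply, smul_eq_mul]
      exact Finset.sum_congr rfl fun i _ => by ring
    have hcs := sq_sum_le_card_mul_sum_sq (s := Finset.univ) (f := fun j => |s D.a j p|)
    simp only [Finset.card_univ, Fintype.card_fin, Nat.cast_add, Nat.cast_one, sq_abs] at hcs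
    calc |tau φ D.a (Fin.last m) p d|
        ≤ ∑ i, |s D.a i p| * (B * ∑ j, |s D.a j p|) := by
          rw [e]
          refine (Finset.abs_sum_le_sum_abs _ _).trans (Finset.sum_le_sum fun i _ => ?_)
          rw [abs_mul]
          exact mul_le_mul_of_nonneg_left (hw i) (abs_nonneg _)
      _ = B * (∑ j, |s D.a j p|) ^ 2 := by rw [← Finset.sum_mul]; ring
      _ ≤ B * (((m : ℝ) + 1) * ∑ i, s D.a i p ^ 2) := mul_le_mul_of_nonneg_left hcs hB0
      _ = _ := by ring
  rw [thetaRate, Matrix.mulVec, dotProduct, mul_assoc, Finset.sum_mul]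
  refine (Finset.abs_sum_le_sum_abs _ _).trans (Finset.sum_le_sum fun d _ => ?_)
  rw [abs_mul]
  exact mul_le_mul_of_nonneg_left (htau d) (abs_nonneg _)

theorem sum_sq_s_le (D : Design P φ) (p : Pt m q) :
    ∑ i, s D.a i p ^ 2 ≤ (∑ i, 1 / P.k i) * ∑ i, P.k i * s D.a i p ^ 2 := by
  rw [Finset.mul_sum]
  refine Finset.sum_le_sum fun i _ => ?_
  have hk := P.k_pos i
  have h1 := Finset.single_le_sum (f := fun i => 1 / P.k i)
    (fun i _ => (one_div_pos.2 (P.k_pos i)).le) (Finset.mem_univ i)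
  calc s D.a i p ^ 2 = 1 / P.k i * (P.k i * s D.a i p ^ 2) := by field_simp
    _ ≤ _ := mul_le_mul_of_nonneg_right h1 (by positivity)

end Lyapunov

end Backstepping

/-! ### The closed loop as a differential equation -/

namespace Backstepping

open Set Filter

variable {m q : ℕ} {P : Params m q} {φ : Fin (m + 1) → State m → Par q} {D : Design P φ}

/-- The vector field of the closed loop; the first argument consists of `μ`, `θ` and `b`. -/
noncomputable def closedLoop (D : Design P φ) (σ : ℝ)
    (r : (ℝ × Par q × ℝ) × (State m × Par q × ℝ)) : State m × Par q × ℝ :=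
  (stateRate P φ D r.1.2.1 r.1.2.2 (r.2.1, r.2.2.1, r.1.1) r.2.2.2,
    thetaRate P φ D (r.2.1, r.2.2.1, r.1.1), rhoRate P φ D σ (r.2.1, r.2.2.1, r.1.1))

/-- The time-varying data of the closed loop. -/
noncomputable def timeData (P : Params m q) (θ : ℝ → Par q) (b : ℝ → ℝ) (t : ℝ) : ℝ × Par q × ℝ :=
  (Real.exp (P.lam * t), θ t, b t)

/-- Time enters only through the data `(μ, θ, b)`, so the field is jointly smooth although `θ` and
`b` may jump. -/
theorem contDiff_closedLoop (hφ_smooth : ∀ i, ContDiff ℝ ∞ (φ i)) (hφ_zero : ∀ i, φ i 0 = 0)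
    (ha : ∀ i, IsReference i (D.a i)) (σ : ℝ) : ContDiff ℝ 1 (closedLoop D σ) := by
  refine ContDiff.of_le (n := ∞) ?_ (by exact_mod_cast le_top)
  have hp : ContDiff ℝ ∞ fun r : (ℝ × Par q × ℝ) × (State m × Par q × ℝ) =>
      ((r.2.1, r.2.2.1, r.1.1) : Pt m q) := by fun_prop
  have hu := (scaledVanishing_ubar ha).contDiff.comp hp
  refine ContDiff.prodMk (contDiff_pi.2 fun i => ContDiff.add ?_ ?_)
    (((scaledSmooth_thetaRate hφ_smooth hφ_zero ha).contDiff.comp hp).prodMk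
      ((scaledSmooth_rhoRate ha σ).contDiff.comp hp))
  · have h := hφ_smooth i
    simp only [dotProduct]
    refine ContDiff.sum fun c _ => ContDiff.mul ?_ (by fun_prop)
    exact contDiff_pi.1 (h.comp (by fun_prop :
      ContDiff ℝ ∞ fun r : (ℝ × Par q × ℝ) × (State m × Par q × ℝ) => r.2.1)) c
  · cases i using Fin.lastCases with
    | last =>
      simp only [Fin.lastCases_last]
      exact ContDiff.mul (by fun_prop) (ContDiff.mul (by fun_prop) hu)
    | cast i =>
      simp only [Fin.lastCases_castSucc]
      fun_prop

theorem piecewiseContinuous_timeData {θ : ℝ → Par q} {b : ℝ → ℝ} (hθ : PiecewiseContinuous θ)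
    (hb : PiecewiseContinuous b) : PiecewiseContinuous (timeData P θ b) :=
  (Continuous.piecewiseContinuous (by fun_prop)).prodMk (hθ.prodMk hb)

section Derivatives

variable {θ : ℝ → Par q} {b : ℝ → ℝ} {σ : ℝ} {X : ℝ → State m × Par q × ℝ} {t : ℝ}

/-- The arguments of the control laws along a trajectory of the closed loop. -/
noncomputable abbrev ptOf (P : Params m q) (X : ℝ → State m × Par q × ℝ) (t : ℝ) : Pt m q :=
  pt P (fun r => (X r).1) (fun r => (X r).2.1) t

theorem hasDerivAt_ptOf {v : State m × Par q × ℝ} (hX : HasDerivAt X v t) :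
    HasDerivAt (ptOf P X) (v.1, v.2.1, P.lam * Real.exp (P.lam * t)) t := by
  have h1 : HasDerivAt (fun r => (X r).1) v.1 t := hX.fst
  have h2 : HasDerivAt (fun r => (X r).2.1) v.2.1 t := hX.snd.fst
  have h3 : HasDerivAt (fun r => Real.exp (P.lam * r)) (P.lam * Real.exp (P.lam * t)) t := by
    have := ((hasDerivAt_id t).const_mul P.lam).exp
    simpa [mul_comm] using this
  exact h1.prodMk (h2.prodMk h3)

theorem hasDerivAt_s (ha : ∀ i, IsReference i (D.a i))
    (hX : HasDerivAt X (closedLoop D σ (timeData P θ b t, X t)) t) (i : Fin (m + 1)) :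
    HasDerivAt (fun r => s D.a i (ptOf P X r))
      (P.lam * s D.a i (ptOf P X t)
        + (ptOf P X t).2.2 * zRate P φ D (θ t) (b t) (ptOf P X t) (X t).2.2 i) t := by
  have hp := hasDerivAt_ptOf (P := P) hX
  have h1 : HasDerivAt (fun r => (ptOf P X r).1 i)
      (stateRate P φ D (θ t) (b t) (ptOf P X t) (X t).2.2 i) t := (hasDerivAt_pi.1 hp.fst) i
  have h2 : HasDerivAt (fun r => (ptOf P X r).2.2) (P.lam * (ptOf P X t).2.2) t := hp.snd.snd
  have h3 := ((ha i).vanishing.contDiff.differentiable (by simp)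
    (ptOf P X t)).hasFDerivAt.comp_hasDerivAt t hp
  refine (h2.mul (h1.sub h3)).congr_deriv ?_
  simp only [s, z, zRate]
  change _ = P.lam * (_ * _) + _ * (_ - fderiv ℝ (D.a i) (ptOf P X t)
    (stateRate P φ D (θ t) (b t) (ptOf P X t) (X t).2.2, thetaRate P φ D (ptOf P X t),
      P.lam * Real.exp (P.lam * t)))
  simp only [closedLoop, timeData, pt, Function.comp_apply, Pi.sub_apply]
  ring

/-- `Γ⁻¹` in the quadratic form undoes `Γ` in the update law, which leaves `τₙᵀ(θ̂ - ℓ)`. -/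
theorem hasDerivAt_lyapunov (ha : ∀ i, IsReference i (D.a i)) (ℓ : Par q) (c : ℝ)
    (hX : HasDerivAt X (closedLoop D σ (timeData P θ b t, X t)) t) :
    HasDerivAt (fun r => lyapunov D ℓ c σ (ptOf P X r) (X r).2.2)
      (lyapunovRate D ℓ c σ (θ t) (b t) (ptOf P X t) (X t).2.2) t := by
  have hdet : IsUnit P.Gam.det := P.Gam_pos.isUnit.map Matrix.detMonoidHom
  have hsymm : P.Gam⁻¹ᵀ = P.Gam⁻¹ := by
    have := P.Gam_pos.inv.isHermitian
    rwa [Matrix.IsHermitian, Matrix.conjTranspose_eq_transpose_of_trivial] at this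
  have hs := HasDerivAt.fun_sum (u := Finset.univ) fun i _ => (hasDerivAt_s ha hX i).pow 2
  set τ := tau φ D.a (Fin.last m) (ptOf P X t) with hτ
  have hϑ : ∀ c, HasDerivAt (fun r => ((X r).2.1 - ℓ) c) ((P.Gam *ᵥ τ) c) t := fun c => by
    have := hasDerivAt_pi.1 hX.snd.fst c
    exact this.sub_const (ℓ c)
  have hΓϑ : ∀ c, HasDerivAt (fun r => (P.Gam⁻¹ *ᵥ ((X r).2.1 - ℓ)) c) (τ c) t := fun c => by
    have := HasDerivAt.fun_sum (u := Finset.univ) fun d _ => (hϑ d).const_mul (P.Gam⁻¹ c d)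
    refine this.congr_deriv ?_
    change (P.Gam⁻¹ *ᵥ (P.Gam *ᵥ τ)) c = τ c
    rw [Matrix.mulVec_mulVec, Matrix.nonsing_inv_mul _ hdet, Matrix.one_mulVec]
  have hQ : HasDerivAt (fun r => ((X r).2.1 - ℓ) ⬝ᵥ (P.Gam⁻¹ *ᵥ ((X r).2.1 - ℓ)))
      (2 * (τ ⬝ᵥ ((X t).2.1 - ℓ))) t := by
    have := HasDerivAt.fun_sum (u := Finset.univ) fun c _ => (hϑ c).mul (hΓϑ c)
    refine this.congr_deriv ?_
    rw [Finset.sum_add_distrib]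
    change (P.Gam *ᵥ τ) ⬝ᵥ (P.Gam⁻¹ *ᵥ ((X t).2.1 - ℓ)) + ((X t).2.1 - ℓ) ⬝ᵥ τ = _
    rw [Matrix.dotProduct_mulVec, ← Matrix.mulVec_transpose, hsymm, Matrix.mulVec_mulVec,
      Matrix.nonsing_inv_mul _ hdet, Matrix.one_mulVec, dotProduct_comm _ τ]
    ring
  have hρ : HasDerivAt (fun r => (X r).2.2) (rhoRate P φ D σ (ptOf P X t)) t := hX.snd.snd
  have hρ2 := (((hρ.const_mul σ).sub_const (1 / c)).pow 2).const_mul (c / (2 * P.gam))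
  refine (((hs.const_mul (1 / 2)).add (hQ.const_mul (1 / 2))).add hρ2).congr_deriv ?_
  rw [lyapunovRate, Finset.mul_sum]
  congr 1
  · congr 1
    · exact Finset.sum_congr rfl fun i _ => by push_cast; ring
    · change 1 / 2 * (2 * (τ ⬝ᵥ ((X t).2.1 - ℓ))) = τ ⬝ᵥ ((X t).2.1 - ℓ)
      ring
  · have := P.gam_pos.ne'
    push_cast
    field_simp

end Derivatives

/-! ### Monotone quantities along trajectories -/

section Trajectories

variable {θ : ℝ → Par q} {b : ℝ → ℝ} {σ c T : ℝ} {ℓ : Par q} {X : ℝ → State m × Par q × ℝ}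

/-- The rate of `σρ̂` is `γ_ρ κ sₙ² ≥ 0`. This preserves the sign of `ρ̂` and later gives its
convergence. -/
theorem monotoneOn_rho (hσ : σ * σ = 1)
    (hX : IsTrajectory (fun t X => closedLoop D σ (timeData P θ b t, X)) 0 T X) :
    MonotoneOn (fun t => σ * (X t).2.2) (Icc 0 T) := by
  obtain ⟨hXc, S, hS, hXd⟩ := hX
  have := antitoneOn_of_hasDerivAt_nonpos_off_finite (g := fun t => -(σ * (X t).2.2)) hS
    (by fun_prop)
    (fun t ht hts => ((HasDerivAt.const_mul σ (hXd t ht hts).snd.snd :)).neg) (fun t ht hts => by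
      change -(σ * rhoRate P φ D σ (ptOf P X t)) ≤ 0
      rw [rhoRate_eq]
      have h1 := kappa_nonneg D (ptOf P X t)
      have h2 := P.gam_pos
      have e : σ * (P.gam * σ * (kappa P D.W D.ψbar (ptOf P X t)
          * s D.a (Fin.last m) (ptOf P X t) ^ 2))
          = P.gam * (kappa P D.W D.ψbar (ptOf P X t) * s D.a (Fin.last m) (ptOf P X t) ^ 2) := by
        linear_combination (P.gam * (kappa P D.W D.ψbar (ptOf P X t)
          * s D.a (Fin.last m) (ptOf P X t) ^ 2)) * hσ
      rw [e]
      exact neg_nonpos.2 (by positivity))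
  exact fun r hr t ht hrt => neg_le_neg_iff.1 (this hr ht hrt)

/-- Along trajectories, the decay of the Lyapunov function dominates quantities whose rate is
bounded by `∑ kᵢ sᵢ²`. -/
theorem antitoneOn_add_lyapunov (ha : ∀ i, IsReference i (D.a i)) (hc : 0 < c) (hσ : σ * σ = 1)
    (hθ : ∀ t, 0 ≤ t → ∑ d, (θ t - ℓ) d ^ 2 ≤ P.del ^ 2)
    (hb : ∀ t, 0 ≤ t → b t = σ * |b t| ∧ c ≤ |b t|)
    (hX : IsTrajectory (fun t X => closedLoop D σ (timeData P θ b t, X)) 0 T X)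
    (h0 : 0 < σ * (X 0).2.2) (u : Par q)
    (hu : ∀ t ∈ Icc 0 T,
      u ⬝ᵥ thetaRate P φ D (ptOf P X t) ≤ ∑ i, P.k i * s D.a i (ptOf P X t) ^ 2) :
    AntitoneOn (fun t => u ⬝ᵥ (X t).2.1 + lyapunov D ℓ c σ (ptOf P X t) (X t).2.2) (Icc 0 T) := by
  have hmono := monotoneOn_rho hσ hX
  obtain ⟨hXc, S, hS, hXd⟩ := hX
  have hρ : ∀ t ∈ Icc 0 T, 0 ≤ σ * (X t).2.2 := fun t ht =>
    h0.le.trans (hmono ⟨le_rfl, ht.1.trans ht.2⟩ ht ht.1)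
  refine antitoneOn_of_hasDerivAt_nonpos_off_finite (g' := fun t =>
    u ⬝ᵥ thetaRate P φ D (ptOf P X t)
      + lyapunovRate D ℓ c σ (θ t) (b t) (ptOf P X t) (X t).2.2) hS ?_ ?_ ?_
  · refine ContinuousOn.add ?_ ?_
    · have hcont : Continuous fun r : State m × Par q × ℝ => u ⬝ᵥ r.2.1 :=
        continuous_const.dotProduct continuous_snd.fst
      exact hcont.comp_continuousOn hXc
    · have hcont : ContinuousOn (fun t => (ptOf P X t, (X t).2.2)) (Icc 0 T) := by
        unfold ptOf pt
        fun_prop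
      exact Continuous.comp_continuousOn (g := fun r : Pt m q × ℝ => lyapunov D ℓ c σ r.1 r.2)
        (f := fun t => (ptOf P X t, (X t).2.2)) (continuous_lyapunov ha ℓ c σ) hcont
  · intro t ht hts
    have h1 : ∀ d, HasDerivAt (fun r => u d * (X r).2.1 d)
        (u d * thetaRate P φ D (ptOf P X t) d) t := fun d =>
      HasDerivAt.const_mul (u d) (hasDerivAt_pi.1 (hXd t ht hts).snd.fst d)
    have h2 : HasDerivAt (fun r => u ⬝ᵥ (X r).2.1) (u ⬝ᵥ thetaRate P φ D (ptOf P X t)) t :=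
      HasDerivAt.fun_sum (u := Finset.univ) fun d _ => h1 d
    have h3 := hasDerivAt_lyapunov ha ℓ c (hXd t ht hts)
    exact h2.fun_add h3
  · intro t ht _
    have h1 := hu t (Ioo_subset_Icc_self ht)
    have h2 := lyapunovRate_le ha (hθ t ht.1.le) hc hσ (hb t ht.1.le).1 (hb t ht.1.le).2
      (ptOf P X t) (hρ t (Ioo_subset_Icc_self ht))
    linarith

theorem lyapunov_le_initial (ha : ∀ i, IsReference i (D.a i)) (hc : 0 < c) (hσ : σ * σ = 1)
    (hθ : ∀ t, 0 ≤ t → ∑ d, (θ t - ℓ) d ^ 2 ≤ P.del ^ 2)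
    (hb : ∀ t, 0 ≤ t → b t = σ * |b t| ∧ c ≤ |b t|)
    (hX : IsTrajectory (fun t X => closedLoop D σ (timeData P θ b t, X)) 0 T X)
    (h0 : 0 < σ * (X 0).2.2) {t : ℝ} (ht : t ∈ Icc 0 T) :
    lyapunov D ℓ c σ (ptOf P X t) (X t).2.2
      ≤ lyapunov D ℓ c σ ((X 0).1, (X 0).2.1, 1) (X 0).2.2 := by
  have h1 := antitoneOn_add_lyapunov ha hc hσ hθ hb hX h0 0 (fun t _ => by
    rw [zero_dotProduct]
    exact Finset.sum_nonneg fun i _ => mul_nonneg (P.k_pos i).le (sq_nonneg _))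
    (left_mem_Icc.2 (ht.1.trans ht.2)) ht ht.1
  have h2 : ptOf P X 0 = ((X 0).1, (X 0).2.1, 1) := by simp [ptOf, pt]
  simpa [h2] using h1

theorem one_le_ptOf {t : ℝ} (ht : 0 ≤ t) : 1 ≤ (ptOf P X t).2.2 :=
  Real.one_le_exp (mul_nonneg P.lam_pos.le ht)

end Trajectories

theorem lyapunov_nonneg (D : Design P φ) (ℓ : Par q) {c : ℝ} (hc : 0 < c) (σ : ℝ) (p : Pt m q)
    (ρ : ℝ) : 0 ≤ lyapunov D ℓ c σ p ρ := by
  have h1 : 0 ≤ ∑ i, s D.a i p ^ 2 := Finset.sum_nonneg fun _ _ => sq_nonneg _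
  have h2 : 0 ≤ (p.2.1 - ℓ) ⬝ᵥ (P.Gam⁻¹ *ᵥ (p.2.1 - ℓ)) := by
    simpa using P.Gam_pos.inv.posSemidef.dotProduct_mulVec_nonneg (p.2.1 - ℓ)
  have h3 := P.gam_pos
  unfold lyapunov
  positivity

/-- A bound of the scaled state in terms of the initial values, which depends continuously on
them. -/
theorem exists_continuous_bound (ha : ∀ i, IsReference i (D.a i)) (ℓ : Par q) {c σ : ℝ}
    (hc : 0 < c) (hσ : σ * σ = 1) :
    ∃ N : State m × Par q × ℝ → ℝ, Continuous N ∧ (∀ v, 0 < N v) ∧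
      ∀ (v : State m × Par q × ℝ) (p : Pt m q) (ρ : ℝ), 1 ≤ p.2.2 →
        lyapunov D ℓ c σ p ρ ≤ lyapunov D ℓ c σ (v.1, v.2.1, 1) v.2.2 →
        ‖WithLp.toLp 2 (p.2.2 • p.1)‖ ≤ N v := by
  set L : State m × Par q × ℝ → ℝ := fun v => lyapunov D ℓ c σ (v.1, v.2.1, 1) v.2.2 with hL
  have hLc : Continuous L := Continuous.comp
    (g := fun r : Pt m q × ℝ => lyapunov D ℓ c σ r.1 r.2)
    (f := fun v : State m × Par q × ℝ => ((v.1, v.2.1, 1), v.2.2))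
    (continuous_lyapunov ha ℓ c σ) (by fun_prop)
  -- The admissible values form an upward closed, hence convex, set, and near `v` one constant
  -- serves because `L ≤ L v + 1` there; local constants are then patched by a partition of unity.
  obtain ⟨N, hN⟩ := exists_continuous_forall_mem_convex_of_local_const
    (t := fun v : State m × Par q × ℝ => {r : ℝ | 0 < r ∧ ∀ (p : Pt m q) (ρ : ℝ), 1 ≤ p.2.2 →
      lyapunov D ℓ c σ p ρ ≤ L v → ‖WithLp.toLp 2 (p.2.2 • p.1)‖ ≤ r})
    (fun v => by
      refine Set.OrdConnected.convex ⟨fun r hr r' _ y hy => ⟨hr.1.trans_le hy.1, ?_⟩⟩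
      exact fun p ρ hμ h => (hr.2 p ρ hμ h).trans hy.1)
    (fun v => by
      obtain ⟨M, _, hM⟩ := exists_bound_of_lyapunov_le ha ℓ hc hσ (L v + 1)
      -- `State m` carries the supremum norm; `C` converts its bound into a Euclidean one.
      obtain ⟨C, hC⟩ := (isCompact_closedBall (0 : State m) M).exists_bound_of_continuousOn
        (PiLp.continuous_toLp 2 fun _ : Fin (m + 1) => ℝ).continuousOn
      refine ⟨max C 1, ?_⟩
      filter_upwards [hLc.continuousAt.eventually (ge_mem_nhds (lt_add_one (L v)))] with y hy
      refine ⟨lt_max_of_lt_right one_pos, fun p ρ hμ h => ?_⟩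
      exact (hC _ (mem_closedBall_zero_iff.2 (hM p ρ hμ (h.trans hy)).2.2.1)).trans
        (le_max_left _ _))
  exact ⟨N, N.continuous, fun v => (hN v).1, fun v => (hN v).2⟩

/-! ### Solutions and trajectories -/

section Solutions

variable {θ : ℝ → Par q} {b : ℝ → ℝ} {σ : ℝ}

/-- The adaptive laws contain neither `θ` nor `b`, so their right-hand sides are continuous and they
hold at all times; the system equations are recovered wherever both parameters are continuous. -/
theorem isSolution_of_isTrajectory (hφ_smooth : ∀ i, ContDiff ℝ ∞ (φ i)) (hφ_zero : ∀ i, φ i 0 = 0)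
    (ha : ∀ i, IsReference i (D.a i)) {X : ℝ → State m × Par q × ℝ}
    (hX : ∀ T, IsTrajectory (fun t X => closedLoop D σ (timeData P θ b t, X)) 0 T X) :
    IsSolution P φ D σ θ b (Ici 0) (fun t => (X t).1) (fun t => (X t).2.1)
      (fun t => (X t).2.2) := by
  have hXc : ContinuousOn X (Ici 0) := by
    intro t ht
    have h1 := (hX (t + 1)).1 t ⟨ht, by linarith⟩
    refine h1.mono_of_mem_nhdsWithin ?_
    rw [← Ici_inter_Iic]
    exact inter_mem self_mem_nhdsWithin (mem_nhdsWithin_of_mem_nhds (Iic_mem_nhds (by linarith)))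
  have hpt : ContinuousOn (ptOf P X) (Ici 0) := by
    unfold ptOf pt
    fun_prop
  have law : ∀ {E : Type} [NormedAddCommGroup E] [NormedSpace ℝ E] {f : ℝ → E} {g : Pt m q → E},
      Continuous g → ContinuousOn f (Ici 0) →
      (∀ T, ∃ S : Set ℝ, S.Finite ∧ ∀ t ∈ Ioo 0 T, t ∉ S → HasDerivAt f (g (ptOf P X t)) t) →
      ∀ t ∈ Ici (0 : ℝ), HasDerivWithinAt f (g (ptOf P X t)) (Ici 0) t := by
    intro E _ _ f g hg hf hd t ht
    obtain ⟨S, hS, hd⟩ := hd (t + 1)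
    have hgc : ContinuousOn (fun r => g (ptOf P X r)) (Ici 0) := hg.comp_continuousOn hpt
    have hf' : ContinuousOn f (Icc 0 (t + 1)) := hf.mono fun r hr => hr.1
    rcases (mem_Ici.1 ht).eq_or_lt with rfl | hpos
    · exact hasDerivWithinAt_Ici_of_off_finite (g := fun r => g (ptOf P X r)) hS hf' hd
        ⟨le_rfl, by norm_num⟩ ((hgc 0 ht).mono Ioi_subset_Ici_self)
    · exact (hasDerivAt_of_off_finite (g := fun r => g (ptOf P X r)) hS hf' hd
        ⟨hpos, lt_add_one t⟩ (hgc.continuousAt (Ici_mem_nhds hpos))).hasDerivWithinAt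
  have deriv : ∀ t ∈ Ici (0 : ℝ), 0 < t → ContinuousAt θ t → ContinuousAt b t →
      HasDerivAt X (closedLoop D σ (timeData P θ b t, X t)) t := by
    intro t _ hpos hθ hb
    obtain ⟨hc, S, hS, hd⟩ := hX (t + 1)
    refine hasDerivAt_of_off_finite (g := fun r => closedLoop D σ (timeData P θ b r, X r)) hS hc hd
      ⟨hpos, lt_add_one t⟩ ?_
    have hdata : ContinuousAt (timeData P θ b) t := by
      unfold timeData
      exact ContinuousAt.prodMk (by fun_prop) (hθ.prodMk hb)
    exact (contDiff_closedLoop hφ_smooth hφ_zero ha σ).continuous.continuousAt.comp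
      (f := fun r => (timeData P θ b r, X r))
      (hdata.prodMk (hXc.continuousAt (Ici_mem_nhds hpos)))
  refine ⟨by fun_prop, ?_, ?_, ?_, ?_⟩
  · intro t ht hpos hθ hb i
    have h1 := hasDerivAt_pi.1 (deriv t ht hpos hθ hb).fst i.castSucc
    refine h1.congr_deriv ?_
    simp [closedLoop, stateRate, timeData]
  · intro t ht hpos hθ hb
    have h1 := hasDerivAt_pi.1 (deriv t ht hpos hθ hb).fst (Fin.last m)
    refine h1.congr_deriv ?_
    simp [closedLoop, stateRate, timeData, pt]
  · refine law (scaledSmooth_thetaRate hφ_smooth hφ_zero ha).contDiff.continuous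
      (by fun_prop) fun T => ?_
    obtain ⟨_, S, hS, hd⟩ := hX T
    exact ⟨S, hS, fun t ht hts => (hd t ht hts).snd.fst⟩
  · refine law (scaledSmooth_rhoRate ha σ).contDiff.continuous (by fun_prop) fun T => ?_
    obtain ⟨_, S, hS, hd⟩ := hX T
    exact ⟨S, hS, fun t ht hts => (hd t ht hts).snd.snd⟩

theorem IsSolution.isTrajectory (hθ : PiecewiseContinuous θ) (hb : PiecewiseContinuous b)
    {T T' : ℝ} (hT : T' < T) {x : ℝ → State m} {th : ℝ → Par q} {rho : ℝ → ℝ}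
    (h : IsSolution P φ D σ θ b (Ico 0 T) x th rho) :
    IsTrajectory (fun t X => closedLoop D σ (timeData P θ b t, X)) 0 T'
      fun t => (x t, th t, rho t) := by
  have hsub : Icc 0 T' ⊆ Ico 0 T := fun t ht => ⟨ht.1, ht.2.trans_lt hT⟩
  refine ⟨(h.cont.mono hsub).prodMk (ContinuousOn.prodMk
    (fun t ht => (h.theta_law t (hsub ht)).continuousWithinAt.mono hsub)
    (fun t ht => (h.rho_law t (hsub ht)).continuousWithinAt.mono hsub)),
    _, (hθ.1 T').union (hb.1 T'), fun t ht hts => ?_⟩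
  simp only [mem_union, mem_ofPred_eq, not_or, not_and, not_not] at hts
  have htJ := hsub (Ioo_subset_Icc_self ht)
  have hnhds : Ico 0 T ∈ 𝓝 t := Ico_mem_nhds ht.1 htJ.2
  have hθt := (hts.1 (Ioo_subset_Icc_self ht)).continuousAt (Ici_mem_nhds ht.1)
  have hbt := (hts.2 (Ioo_subset_Icc_self ht)).continuousAt (Ici_mem_nhds ht.1)
  refine HasDerivAt.prodMk (hasDerivAt_pi.2 fun i => ?_)
    (((h.theta_law t htJ).hasDerivAt hnhds).prodMk ((h.rho_law t htJ).hasDerivAt hnhds))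
  cases i using Fin.lastCases with
  | last =>
    refine (h.ode_last t htJ ht.1 hθt hbt).congr_deriv ?_
    simp [stateRate, timeData, pt]
  | cast i =>
    refine (h.ode t htJ ht.1 hθt hbt i).congr_deriv ?_
    simp [stateRate, timeData]

end Solutions

theorem ScaledSmooth.boundedSignal {E : Type*} [NormedAddCommGroup E] [NormedSpace ℝ E]
    {f : Pt m q → E} (hf : ScaledSmooth f) {x : ℝ → State m} {th : ℝ → Par q} {M : ℝ}
    (h : ∀ t, 0 ≤ t → ‖x t‖ ≤ M ∧ ‖th t‖ ≤ M ∧ ‖Real.exp (P.lam * t) • x t‖ ≤ M) :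
    BoundedSignal fun t => f (pt P x th t) := by
  obtain ⟨C, _, hC⟩ := hf.exists_bound M
  exact ⟨C, fun t ht => hC _ (h t ht).1 (h t ht).2.1 (h t ht).2.2⟩

/-- The estimates converge along bounded trajectories. -/
theorem exists_tendsto_estimates {θ : ℝ → Par q} {b : ℝ → ℝ} {σ c : ℝ} {ℓ : Par q}
    {X : ℝ → State m × Par q × ℝ} (ha : ∀ i, IsReference i (D.a i)) (hc : 0 < c) (hσ : σ * σ = 1)
    (hθ : ∀ t, 0 ≤ t → ∑ d, (θ t - ℓ) d ^ 2 ≤ P.del ^ 2)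
    (hb : ∀ t, 0 ≤ t → b t = σ * |b t| ∧ c ≤ |b t|)
    (hX : ∀ T, IsTrajectory (fun t X => closedLoop D σ (timeData P θ b t, X)) 0 T X)
    (h0 : 0 < σ * (X 0).2.2) {M : ℝ}
    (hM : ∀ t, 0 ≤ t → ‖(X t).1‖ ≤ M ∧ ‖(X t).2.1‖ ≤ M ∧
      ‖Real.exp (P.lam * t) • (X t).1‖ ≤ M ∧ |(X t).2.2| ≤ M) :
    (∃ l, Tendsto (fun t => (X t).2.1) atTop (𝓝 l)) ∧
      ∃ l, Tendsto (fun t => (X t).2.2) atTop (𝓝 l) := by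
  constructor
  · have hWs : ScaledSmooth fun (p : Pt m q) (r : Fin (m + 1) × Fin (m + 1) × Fin q) =>
        D.W r.1 p r.2.1 r.2.2 := scaledSmooth_pi.2 fun r => D.W_smooth r.1 r.2.1 r.2.2
    obtain ⟨B, hB0, hB⟩ := hWs.exists_bound M
    have hWB : ∀ t, 0 ≤ t → ∀ i j d, |D.W i (ptOf P X t) j d| ≤ B := fun t ht i j d =>
      (norm_le_pi_norm (fun r : Fin (m + 1) × Fin (m + 1) × Fin q =>
        D.W r.1 (ptOf P X t) r.2.1 r.2.2) (i, j, d)).trans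
        (hB _ (hM t ht).1 (hM t ht).2.1 (hM t ht).2.2.1)
    -- `u = 0` gives convergence of `V` itself; a small multiple of a basis vector then isolates one
    -- coordinate of `θ̂`.
    have anti : ∀ u : Par q, (∀ t, 0 ≤ t →
        u ⬝ᵥ thetaRate P φ D (ptOf P X t) ≤ ∑ i, P.k i * s D.a i (ptOf P X t) ^ 2) →
        ∃ l, Tendsto (fun t => u ⬝ᵥ (X t).2.1 + lyapunov D ℓ c σ (ptOf P X t) (X t).2.2)
          atTop (𝓝 l) := by
      intro u hu
      refine exists_tendsto_of_antitoneOn (B := -∑ d, |u d| * M) (fun r hr t ht hrt =>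
        antitoneOn_add_lyapunov ha hc hσ hθ hb (hX t) h0 u (fun t ht => hu t ht.1)
          ⟨hr, hrt⟩ ⟨ht, le_rfl⟩ hrt) fun t ht => ?_
      have h1 := lyapunov_nonneg D ℓ hc σ (ptOf P X t) (X t).2.2
      have h2 : |u ⬝ᵥ (X t).2.1| ≤ ∑ d, |u d| * M := by
        refine (Finset.abs_sum_le_sum_abs _ _).trans (Finset.sum_le_sum fun d _ => ?_)
        rw [abs_mul]
        exact mul_le_mul_of_nonneg_left ((norm_le_pi_norm _ d).trans (hM t ht).2.1) (abs_nonneg _)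
      linarith [neg_abs_le (u ⬝ᵥ (X t).2.1)]
    have hk : ∀ t, 0 ≤ ∑ i, P.k i * s D.a i (ptOf P X t) ^ 2 := fun t =>
      Finset.sum_nonneg fun i _ => mul_nonneg (P.k_pos i).le (sq_nonneg _)
    obtain ⟨l₀, hl₀⟩ := anti 0 fun t _ => by rw [zero_dotProduct]; exact hk t
    have hcoord : ∀ d : Fin q, ∃ l, Tendsto (fun t => (X t).2.1 d) atTop (𝓝 l) := by
      intro d
      set A : ℝ := (∑ e, |P.Gam d e|) * (B * ((m : ℝ) + 1)) with hA
      have hA0 : 0 ≤ A := by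
        have : 0 ≤ ∑ e, |P.Gam d e| := Finset.sum_nonneg fun _ _ => abs_nonneg _
        positivity
      have hK0 : 0 ≤ ∑ i, 1 / P.k i := Finset.sum_nonneg fun i _ => (one_div_pos.2 (P.k_pos i)).le
      -- `A ∑ 1/kᵢ` bounds the rate of the coordinate relative to `∑ kᵢ sᵢ²`; adding one makes `C`
      -- invertible.
      set C : ℝ := A * (∑ i, 1 / P.k i) + 1 with hC
      have hCpos : 0 < C := by positivity
      obtain ⟨l₁, hl₁⟩ := anti (Pi.single d C⁻¹) fun t ht => by
        rw [single_dotProduct, inv_mul_le_iff₀ hCpos]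
        have h1 := abs_thetaRate_le (P := P) (φ := φ) d (hWB t ht)
        have h2 := mul_le_mul_of_nonneg_left (sum_sq_s_le D (ptOf P X t)) hA0
        have h3 := le_abs_self (thetaRate P φ D (ptOf P X t) d)
        have h4 := hk t
        rw [hC]
        linarith
      refine ⟨C * (l₁ - l₀), ((hl₁.sub hl₀).const_mul C).congr fun t => ?_⟩
      rw [single_dotProduct, zero_dotProduct]
      field_simp
      ring
    choose l hl using hcoord
    exact ⟨l, tendsto_pi_nhds.2 hl⟩
  · have hσ1 : |σ| = 1 := by
      have : |σ| * |σ| = 1 := by rw [← abs_mul, hσ, abs_one]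
      nlinarith [abs_nonneg σ]
    obtain ⟨l, hl⟩ := exists_tendsto_of_antitoneOn (g := fun t => -(σ * (X t).2.2)) (B := -M)
      (fun r hr t ht hrt => neg_le_neg (monotoneOn_rho hσ (hX t) ⟨hr, hrt⟩ ⟨ht, le_rfl⟩ hrt))
      (fun t ht => by
        refine neg_le_neg ((le_abs_self _).trans ?_)
        rw [abs_mul, hσ1, one_mul]
        exact (hM t ht).2.2.2)
    refine ⟨-σ * l, (hl.const_mul (-σ)).congr fun t => ?_⟩
    linear_combination (X t).2.2 * hσ

end Backstepping

/-! ### Proof of the main result -/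

theorem theorem1 {m q : ℕ}
    (φ : Fin (m + 1) → Backstepping.State m → Backstepping.Par q)
    (hφ_smooth : ∀ i, ContDiff ℝ ∞ (φ i))
    (hφ_dep : ∀ i, DependsOn (φ i) (Set.Iic i))
    (hφ_zero : ∀ i, φ i 0 = 0)
    (P : Backstepping.Params m q) :
    Nonempty (Backstepping.Design P φ) ∧
    ∀ (D : Backstepping.Design P φ)
      (θ : ℝ → Backstepping.Par q) (b : ℝ → ℝ)
      (Θ₀ : Set (Backstepping.Par q)) (ℓθ : Backstepping.Par q) (ℓb σ : ℝ),
      PiecewiseContinuous θ → PiecewiseContinuous b →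
      IsCompact Θ₀ → (∀ t : ℝ, 0 ≤ t → θ t ∈ Θ₀) →
      (∀ v ∈ Θ₀, ‖WithLp.toLp 2 (v - ℓθ)‖ ≤ P.del) →
      (σ = 1 ∨ σ = -1) → (∀ t : ℝ, 0 ≤ t → Real.sign (b t) = σ) →
      0 < |ℓb| → (∀ t : ℝ, 0 ≤ t → |ℓb| ≤ |b t|) →
      ∃ N : Backstepping.State m × Backstepping.Par q × ℝ → ℝ,
        Continuous N ∧ (∀ v, 0 < N v) ∧
        ∀ (x₀ : Backstepping.State m) (th₀ : Backstepping.Par q) (rho₀ : ℝ), 0 < σ * rho₀ →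
          ∃ (x : ℝ → Backstepping.State m) (th : ℝ → Backstepping.Par q) (rho : ℝ → ℝ),
            -- the closed loop has a global solution with the given initial values
            Backstepping.IsSolution P φ D σ θ b (Set.Ici 0) x th rho ∧
            x 0 = x₀ ∧ th 0 = th₀ ∧ rho 0 = rho₀ ∧
            -- it is the only solution, on every time interval
            (∀ (T : ℝ) (x' : ℝ → Backstepping.State m) (th' : ℝ → Backstepping.Par q)
                (rho' : ℝ → ℝ), 0 < T →
                Backstepping.IsSolution P φ D σ θ b (Set.Ico 0 T) x' th' rho' →
                x' 0 = x₀ → th' 0 = th₀ → rho' 0 = rho₀ →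
                ∀ t ∈ Set.Ico 0 T, x' t = x t ∧ th' t = th t ∧ rho' t = rho t) ∧
            -- exponential convergence of the state
            (∀ t : ℝ, 0 ≤ t →
              ‖WithLp.toLp 2 (x t)‖ ≤ N (x₀, th₀, rho₀) * Real.exp (-(P.lam * t))) ∧
            -- all signals are bounded
            BoundedSignal x ∧ BoundedSignal th ∧ BoundedSignal rho ∧
            (∀ i, BoundedSignal (fun t => Backstepping.z D.a i (Backstepping.pt P x th t))) ∧
            (∀ i, BoundedSignal (fun t => Backstepping.s D.a i (Backstepping.pt P x th t))) ∧
            (∀ i, BoundedSignal (fun t => D.a i (Backstepping.pt P x th t))) ∧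
            (∀ i, BoundedSignal (fun t => Backstepping.w φ D.a i (Backstepping.pt P x th t))) ∧
            (∀ i, BoundedSignal (fun t => Backstepping.tau φ D.a i (Backstepping.pt P x th t))) ∧
            BoundedSignal
              (fun t => Backstepping.kappa P D.W D.ψbar (Backstepping.pt P x th t)) ∧
            BoundedSignal
              (fun t => Backstepping.ubar P D.a D.W D.ψbar (Backstepping.pt P x th t)) ∧
            BoundedSignal
              (fun t => rho t * Backstepping.ubar P D.a D.W D.ψbar (Backstepping.pt P x th t)) ∧
            BoundedSignal (fun t => Backstepping.thetaRate P φ D (Backstepping.pt P x th t)) ∧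
            BoundedSignal (fun t => Backstepping.rhoRate P φ D σ (Backstepping.pt P x th t)) ∧
            -- the estimates converge
            (∃ l : Backstepping.Par q, Filter.Tendsto th Filter.atTop (𝓝 l)) ∧
            (∃ l : ℝ, Filter.Tendsto rho Filter.atTop (𝓝 l)) := by
  refine ⟨Backstepping.exists_design hφ_smooth hφ_dep hφ_zero, ?_⟩
  intro D θ b Θ₀ ℓθ ℓb σ hθ hb _ hΘ hball hσ hsign hℓ hℓb
  have ha := D.isReference hφ_smooth hφ_dep hφ_zero
  have hσ' : σ * σ = 1 := by rcases hσ with rfl | rfl <;> norm_num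
  have hθ' : ∀ t, 0 ≤ t → ∑ d, (θ t - ℓθ) d ^ 2 ≤ P.del ^ 2 := fun t ht => by
    have h1 := pow_le_pow_left₀ (norm_nonneg _) (hball _ (hΘ t ht)) 2
    simpa [EuclideanSpace.norm_sq_eq] using h1
  have hb' : ∀ t, 0 ≤ t → b t = σ * |b t| ∧ |ℓb| ≤ |b t| := fun t ht => by
    refine ⟨?_, hℓb t ht⟩
    have hne : b t ≠ 0 := abs_pos.1 (hℓ.trans_le (hℓb t ht))
    rw [← hsign t ht]
    rcases hne.lt_or_gt with h | h
    · rw [Real.sign_of_neg h, abs_of_neg h]; ring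
    · rw [Real.sign_of_pos h, abs_of_pos h, one_mul]
  have hdata := Backstepping.piecewiseContinuous_timeData (P := P) hθ hb
  have hG := Backstepping.contDiff_closedLoop hφ_smooth hφ_zero ha σ
  obtain ⟨N, hNc, hNpos, hN⟩ := Backstepping.exists_continuous_bound ha ℓθ hℓ hσ'
  refine ⟨N, hNc, hNpos, fun x₀ th₀ rho₀ h0 => ?_⟩
  -- `M` depends on the initial value of `V` but not on time; it serves both as the a priori bound
  -- for continuation and as the bound of the signals.
  obtain ⟨M, hM0, hM⟩ := Backstepping.exists_bound_of_lyapunov_le ha ℓθ hℓ hσ'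
    (Backstepping.lyapunov D ℓθ |ℓb| σ (x₀, th₀, 1) rho₀)
  have hlyap : ∀ (T : ℝ) (X : ℝ → Backstepping.State m × Backstepping.Par q × ℝ),
      IsTrajectory (fun t X => Backstepping.closedLoop D σ (Backstepping.timeData P θ b t, X)) 0 T X →
      X 0 = (x₀, th₀, rho₀) → ∀ t ∈ Set.Icc 0 T,
      Backstepping.lyapunov D ℓθ |ℓb| σ (Backstepping.ptOf P X t) (X t).2.2
        ≤ Backstepping.lyapunov D ℓθ |ℓb| σ (x₀, th₀, 1) rho₀ := by
    intro T X hX hX0 t ht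
    have h1 := Backstepping.lyapunov_le_initial ha hℓ hσ' hθ' hb' hX (by rw [hX0]; exact h0) ht
    rwa [hX0] at h1
  obtain ⟨X, hX0, hX⟩ := exists_global_isTrajectory hG hdata (X₀ := (x₀, th₀, rho₀)) fun T =>
    ⟨M, fun t ht X hX hX0 => by
      have h1 := hM _ _ (Backstepping.one_le_ptOf ht.1)
        (hlyap t X hX hX0 t (Set.right_mem_Icc.2 ht.1))
      exact max_le h1.1 (max_le h1.2.1 h1.2.2.2)⟩
  have hXM : ∀ t, 0 ≤ t → ‖(X t).1‖ ≤ M ∧ ‖(X t).2.1‖ ≤ M ∧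
      ‖Real.exp (P.lam * t) • (X t).1‖ ≤ M ∧ |(X t).2.2| ≤ M := fun t ht =>
    hM _ _ (Backstepping.one_le_ptOf ht) (hlyap t X (hX t) hX0 t (Set.right_mem_Icc.2 ht))
  have hXM' : ∀ t, 0 ≤ t → ‖(X t).1‖ ≤ M ∧ ‖(X t).2.1‖ ≤ M ∧
      ‖Real.exp (P.lam * t) • (X t).1‖ ≤ M := fun t ht =>
    ⟨(hXM t ht).1, (hXM t ht).2.1, (hXM t ht).2.2.1⟩
  have hlim := Backstepping.exists_tendsto_estimates ha hℓ hσ' hθ' hb' hX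
    (by rw [hX0]; exact h0) hXM
  have hrho : BoundedSignal fun t => (X t).2.2 := ⟨M, fun t ht => (hXM t ht).2.2.2⟩
  have hubar := (Backstepping.scaledVanishing_ubar ha).scaledSmooth.boundedSignal hXM'
  refine ⟨fun t => (X t).1, fun t => (X t).2.1, fun t => (X t).2.2,
    Backstepping.isSolution_of_isTrajectory hφ_smooth hφ_zero ha hX, by simp [hX0], by simp [hX0],
    by simp [hX0], ?_, ?_, ⟨M, fun t ht => (hXM t ht).1⟩, ⟨M, fun t ht => (hXM t ht).2.1⟩, hrho,
    fun i => (Backstepping.scaledVanishing_z (ha i)).scaledSmooth.boundedSignal hXM',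
    fun i => (Backstepping.scaledSmooth_s (ha i)).boundedSignal hXM',
    fun i => (ha i).vanishing.scaledSmooth.boundedSignal hXM',
    fun i => (Backstepping.scaledSmooth_pi.2 fun c =>
      (Backstepping.scaledVanishing_w hφ_smooth hφ_zero (ha i) c).scaledSmooth).boundedSignal hXM',
    fun i => (Backstepping.scaledSmooth_tau hφ_smooth hφ_zero fun j _ => ha j).boundedSignal hXM',
    (Backstepping.scaledSmooth_kappa D).boundedSignal hXM', hubar, ?_,
    (Backstepping.scaledSmooth_thetaRate hφ_smooth hφ_zero ha).boundedSignal hXM',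
    (Backstepping.scaledSmooth_rhoRate ha σ).boundedSignal hXM', hlim.1, hlim.2⟩
  · intro T x' th' rho' _ hsol hx hth hrho' t ht
    have h1 := hsol.isTrajectory hθ hb ht.2
    have h2 := h1.eqOn (hdata.exists_lipschitzOnWith hG t) (hX t)
      (by rw [hX0, hx, hth, hrho']) (Set.right_mem_Icc.2 ht.1)
    exact ⟨congrArg (fun v => v.1) h2, congrArg (fun v => v.2.1) h2,
      congrArg (fun v => v.2.2) h2⟩
  · intro t ht
    have h1 := hN (x₀, th₀, rho₀) _ _ (Backstepping.one_le_ptOf ht)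
      (hlyap t X (hX t) hX0 t (Set.right_mem_Icc.2 ht))
    -- The bound of the scaled state by `N` is turned into decay of the state.
    have h2 : (X t).1 = Real.exp (-(P.lam * t)) • Real.exp (P.lam * t) • (X t).1 := by
      rw [smul_smul, ← Real.exp_add, neg_add_cancel, Real.exp_zero, one_smul]
    beta_reduce
    rw [h2, WithLp.toLp_smul, norm_smul, Real.norm_of_nonneg (Real.exp_pos _).le, mul_comm]
    exact mul_le_mul_of_nonneg_right h1 (Real.exp_pos _).le
  · obtain ⟨C, hC⟩ := hrho
    obtain ⟨C', hC'⟩ := hubar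
    refine ⟨C * C', fun t ht => ?_⟩
    rw [norm_mul]
    exact mul_le_mul (hC t ht) (hC' t ht) (norm_nonneg _) ((norm_nonneg _).trans (hC t ht))
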